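/- Let $n\ge 2$ be even and let $N$ be a compact smooth $n$-manifold without boundary. A pair $(g,h)$ of a Riemannian metric and a smooth symmetric $(0,2)$-tensor on $N$ is called space-like if it satisfies the Gauss and Codazzi equations $$R_{ijkl}=-(h_{ik}h_{jl}-h_{il}h_{jk}),\qquad \nabla_i h_{jk}=\nabla_j h_{ik},$$ where the sign of the curvature is such that $R_{ijij}>0$ on the round sphere and $R_{ij}=g^{kl}R_{ikjl}$. Let $J\subset[0,\infty)$ be a nondegenerate interval with $0\in J$ (for instance $[0,T)$ or $[0,\infty)$), and let $(g(t),h(t))_{t\in J}$ be a smooth (jointly in $t$ and $x$) solution of the intrinsic mean curvature flow $$\frac{\partial g_{ij}}{\partial t}=-2R_{ij}+2h_{ik}h_{jl}g^{kl},$$ $$\frac{\partial h_{ij}}{\partial t}=\Delta h_{ij}-R_{im}h_{nj}g^{mn}-R_{jm}h_{ni}g^{mn}+2h_{im}h_{jn}h_{kl}g^{mk}g^{ln}-h_{mn}h_{kl}g^{mk}g^{nl}h_{ij}$$ whose initial datum $(g(0),h(0))$ is space-like. Put $H=g^{ij}h_{ij}$, $|A|^2=g^{ij}g^{kl}h_{ik}h_{jl}$,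 $|\nabla A|^2=g^{ij}g^{kl}g^{pq}\nabla_ih_{kp}\nabla_jh_{lq}$, and let $dv$ be the Riemannian volume element, all of them (and all norms) taken with respect to $g(t)$. Then for every $t\in J$ (with one-sided derivatives at end points of $J$) $$\frac{d}{dt}\int_N H^n\,dv=-n(n-1)\int_N|\nabla H|^2H^{n-2}\,dv-n\int_N H^n\Big|h_{ij}-\frac Hn g_{ij}\Big|^2dv\le 0$$ and $$\frac{d}{dt}\int_N|A|^n\,dv=-\Big(\frac n2-1\Big)\frac n2\int_N|A|^{n-4}\big|\nabla|A|^2\big|^2dv-n\int_N|A|^{n-2}|\nabla A|^2\,dv-n\int_N|A|^n\Big|h_{ij}-\frac Hn g_{ij}\Big|^2dv\le 0,$$ where for $n=2$ the first term on the right-hand side of the second formula is understood to be zero. In particular both $\int_N H^n\,dv$ and $\int_N|A|^n\,dv$ are nonincreasing in $t\in J$. -/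

import Mathlib

open MeasureTheory Set
open scoped Manifold ContDiff

namespace IntrinsicMCF

/-! ### Tensor calculus in a coordinate domain of `ℝⁿ`

`G y` is the matrix `(g_ij)` of the metric and `K y` the matrix `(h_ij)` of a symmetric 2-tensor at
the coordinate point `y`. All indices are explicit; sums over repeated indices are written out. -/

/-- A field of `n × n` matrices on the coordinate space. -/
abbrev MatrixField (n : ℕ) : Type :=
  EuclideanSpace ℝ (Fin n) → Matrix (Fin n) (Fin n) ℝ

/-- The partial derivative `∂_i f` at `y`. -/
noncomputable def pd {n : ℕ} (i : Fin n) (f : EuclideanSpace ℝ (Fin n) → ℝ)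
    (y : EuclideanSpace ℝ (Fin n)) : ℝ :=
  fderiv ℝ f y (EuclideanSpace.single i 1)

/-- Christoffel symbols of the Levi-Civita connection,
`Γ^k_ij = ½ g^{kl} (∂_i g_jl + ∂_j g_il - ∂_l g_ij)`. -/
noncomputable def christoffel {n : ℕ} (G : MatrixField n) (k i j : Fin n)
    (y : EuclideanSpace ℝ (Fin n)) : ℝ :=
  (1 / 2) * ∑ l, (G y)⁻¹ k l *
    (pd i (fun z => G z j l) y + pd j (fun z => G z i l) y - pd l (fun z => G z i j) y)

/-- The Riemann tensor `R_ijkl = g(R(∂_i, ∂_j) ∂_l, ∂_k)`, where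
`R(X, Y) = ∇_X ∇_Y - ∇_Y ∇_X - ∇_[X,Y]`. With this sign `R_ijij` is positive on round spheres. -/
noncomputable def riemann {n : ℕ} (G : MatrixField n) (i j k l : Fin n)
    (y : EuclideanSpace ℝ (Fin n)) : ℝ :=
  ∑ m, G y k m *
    (pd i (christoffel G m j l) y - pd j (christoffel G m i l) y
      + ∑ p, (christoffel G m i p y * christoffel G p j l y
        - christoffel G m j p y * christoffel G p i l y))

/-- The Ricci tensor `R_ij = g^{kl} R_ikjl`. -/
noncomputable def ricci {n : ℕ} (G : MatrixField n) (i j : Fin n)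
    (y : EuclideanSpace ℝ (Fin n)) : ℝ :=
  ∑ k, ∑ l, (G y)⁻¹ k l * riemann G i k j l y

/-- The covariant derivative `∇_i h_jk`. -/
noncomputable def covDeriv {n : ℕ} (G K : MatrixField n) (i j k : Fin n)
    (y : EuclideanSpace ℝ (Fin n)) : ℝ :=
  pd i (fun z => K z j k) y
    - ∑ p, (christoffel G p i j y * K y p k + christoffel G p i k y * K y j p)

/-- The second covariant derivative `∇_l ∇_i h_jk`. -/
noncomputable def covDeriv₂ {n : ℕ} (G K : MatrixField n) (l i j k : Fin n)
    (y : EuclideanSpace ℝ (Fin n)) : ℝ :=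
  pd l (covDeriv G K i j k) y
    - ∑ p, (christoffel G p l i y * covDeriv G K p j k y
      + christoffel G p l j y * covDeriv G K i p k y
      + christoffel G p l k y * covDeriv G K i j p y)

/-- The rough Laplacian `(Δh)_jk = g^{li} ∇_l ∇_i h_jk`. -/
noncomputable def laplacian {n : ℕ} (G K : MatrixField n) (j k : Fin n)
    (y : EuclideanSpace ℝ (Fin n)) : ℝ :=
  ∑ l, ∑ i, (G y)⁻¹ l i * covDeriv₂ G K l i j k y

/-- The trace `H = g^{ij} h_ij`. -/
noncomputable def trace {n : ℕ} (G K : MatrixField n) (y : EuclideanSpace ℝ (Fin n)) : ℝ :=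
  ∑ i, ∑ j, (G y)⁻¹ i j * K y i j

/-- The squared norm `g^{ij} g^{kl} h_ik h_jl` of a 2-tensor; it is `|A|²` for the tensor `h`. -/
noncomputable def normSq {n : ℕ} (G K : MatrixField n) (y : EuclideanSpace ℝ (Fin n)) : ℝ :=
  ∑ i, ∑ j, ∑ k, ∑ l, (G y)⁻¹ i j * (G y)⁻¹ k l * K y i k * K y j l

/-- `|∇A|² = g^{ij} g^{kl} g^{pq} ∇_i h_kp ∇_j h_lq`. -/
noncomputable def normSqCovDeriv {n : ℕ} (G K : MatrixField n)
    (y : EuclideanSpace ℝ (Fin n)) : ℝ :=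
  ∑ i, ∑ j, ∑ k, ∑ l, ∑ p, ∑ q, (G y)⁻¹ i j * (G y)⁻¹ k l * (G y)⁻¹ p q *
    covDeriv G K i k p y * covDeriv G K j l q y

/-- `|∇f|² = g^{ij} ∂_i f ∂_j f` for a function `f`. -/
noncomputable def normSqGrad {n : ℕ} (G : MatrixField n) (f : EuclideanSpace ℝ (Fin n) → ℝ)
    (y : EuclideanSpace ℝ (Fin n)) : ℝ :=
  ∑ i, ∑ j, (G y)⁻¹ i j * pd i f y * pd j f y

/-- The trace-free part `h_ij - (H / n) g_ij`. -/
noncomputable def traceless {n : ℕ} (G K : MatrixField n) : MatrixField n :=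
  fun y => K y - (trace G K y / n) • G y

/-- Right-hand side of the evolution equation of the metric: `-2 R_ij + 2 h_ik h_jl g^{kl}`. -/
noncomputable def metricVelocity {n : ℕ} (G K : MatrixField n) (i j : Fin n)
    (y : EuclideanSpace ℝ (Fin n)) : ℝ :=
  -2 * ricci G i j y + 2 * ∑ k, ∑ l, K y i k * K y j l * (G y)⁻¹ k l

/-- Right-hand side of the evolution equation of `h`:
`Δh_ij - R_im h_nj g^{mn} - R_jm h_ni g^{mn} + 2 h_im h_jn h_kl g^{mk} g^{ln}
  - h_mn h_kl g^{mk} g^{nl} h_ij`. -/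
noncomputable def tensorVelocity {n : ℕ} (G K : MatrixField n) (i j : Fin n)
    (y : EuclideanSpace ℝ (Fin n)) : ℝ :=
  laplacian G K i j y
    - (∑ m, ∑ q, ricci G i m y * K y q j * (G y)⁻¹ m q)
    - (∑ m, ∑ q, ricci G j m y * K y q i * (G y)⁻¹ m q)
    + 2 * (∑ m, ∑ q, ∑ k, ∑ l, K y i m * K y j q * K y k l * (G y)⁻¹ m k * (G y)⁻¹ l q)
    - (∑ m, ∑ q, ∑ k, ∑ l, K y m q * K y k l * (G y)⁻¹ m k * (G y)⁻¹ q l) * K y i j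

/-! ### Tensors and measures on a manifold -/

/-- A (not necessarily continuous) covariant 2-tensor field on the `n`-manifold `M`. -/
abbrev TwoTensor (n : ℕ) (M : Type*) [TopologicalSpace M]
    [ChartedSpace (EuclideanSpace ℝ (Fin n)) M] : Type _ :=
  (x : M) → TangentSpace (𝓡 n) x →L[ℝ] TangentSpace (𝓡 n) x →L[ℝ] ℝ

/-- Smooth Riemannian metrics on the `n`-manifold `M`. -/
abbrev Metric (n : ℕ) (M : Type*) [TopologicalSpace M]
    [ChartedSpace (EuclideanSpace ℝ (Fin n)) M] [IsManifold (𝓡 n) ∞ M] : Type _ :=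
  Bundle.ContMDiffRiemannianMetric (𝓡 n) ∞ (EuclideanSpace ℝ (Fin n))
    (fun x : M => TangentSpace (𝓡 n) x)

/-- The coordinate field `∂_i` of the preferred chart at `α`, at the point with coordinates `y`. -/
noncomputable def coordVec {n : ℕ} {M : Type*} [TopologicalSpace M]
    [ChartedSpace (EuclideanSpace ℝ (Fin n)) M] (α : M) (i : Fin n)
    (y : EuclideanSpace ℝ (Fin n)) : TangentSpace (𝓡 n) ((extChartAt (𝓡 n) α).symm y) :=
  mfderiv 𝓘(ℝ, EuclideanSpace ℝ (Fin n)) (𝓡 n) (extChartAt (𝓡 n) α).symm y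
    (EuclideanSpace.single i (1 : ℝ))

/-- The components `B(∂_i, ∂_j)` of a 2-tensor in the preferred chart at `α`, as functions of the
coordinates. They are meaningful on the open set `(extChartAt (𝓡 n) α).target`. -/
noncomputable def comp {n : ℕ} {M : Type*} [TopologicalSpace M]
    [ChartedSpace (EuclideanSpace ℝ (Fin n)) M] (B : TwoTensor n M) (α : M) : MatrixField n :=
  fun y => Matrix.of fun i j => B ((extChartAt (𝓡 n) α).symm y) (coordVec α i y) (coordVec α j y)

/-- A smooth partition of unity subordinate to the preferred charts of `M`. -/
noncomputable def chartPartition (n : ℕ) (M : Type*) [TopologicalSpace M]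
    [ChartedSpace (EuclideanSpace ℝ (Fin n)) M] [IsManifold (𝓡 n) ∞ M] [T2Space M]
    [SigmaCompactSpace M] : SmoothPartitionOfUnity M (𝓡 n) M univ :=
  Classical.choose (SmoothPartitionOfUnity.exists_isSubordinate_chartAt_source (𝓡 n) M)

/-- The Riemannian volume measure `dv` of `g`: it is `√(det g_ij) dy` in coordinates, glued by a
partition of unity subordinate to the charts. -/
noncomputable def vol {n : ℕ} {M : Type*} [TopologicalSpace M]
    [ChartedSpace (EuclideanSpace ℝ (Fin n)) M] [IsManifold (𝓡 n) ∞ M] [T2Space M]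
    [SigmaCompactSpace M] [MeasurableSpace M] (g : Metric n M) : Measure M :=
  Measure.sum fun α : M =>
    Measure.map (extChartAt (𝓡 n) α).symm
      ((volume.restrict (extChartAt (𝓡 n) α).target).withDensity fun y =>
        ENNReal.ofReal (chartPartition n M α ((extChartAt (𝓡 n) α).symm y)
          * Real.sqrt (comp g.inner α y).det))

section Scalars

variable {n : ℕ} {M : Type*} [TopologicalSpace M]
  [ChartedSpace (EuclideanSpace ℝ (Fin n)) M] [IsManifold (𝓡 n) ∞ M]

/-! The scalar invariants of `(g, h)` at the point `x`, computed in the preferred chart at `x`. -/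

/-- `H = g^{ij} h_ij`. -/
noncomputable def meanCurv (g : Metric n M) (h : TwoTensor n M) (x : M) : ℝ :=
  trace (comp g.inner x) (comp h x) (extChartAt (𝓡 n) x x)

/-- `|A|`, the norm of `h` with respect to `g`. -/
noncomputable def normA (g : Metric n M) (h : TwoTensor n M) (x : M) : ℝ :=
  Real.sqrt (normSq (comp g.inner x) (comp h x) (extChartAt (𝓡 n) x x))

/-- `|∇H|²`. -/
noncomputable def gradHSq (g : Metric n M) (h : TwoTensor n M) (x : M) : ℝ :=
  normSqGrad (comp g.inner x) (trace (comp g.inner x) (comp h x)) (extChartAt (𝓡 n) x x)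

/-- `|∇A|²`. -/
noncomputable def gradASq (g : Metric n M) (h : TwoTensor n M) (x : M) : ℝ :=
  normSqCovDeriv (comp g.inner x) (comp h x) (extChartAt (𝓡 n) x x)

/-- `|∇|A|²|²`. -/
noncomputable def gradNormASq (g : Metric n M) (h : TwoTensor n M) (x : M) : ℝ :=
  normSqGrad (comp g.inner x) (normSq (comp g.inner x) (comp h x)) (extChartAt (𝓡 n) x x)

/-- `|h_ij - (H / n) g_ij|²`. -/
noncomputable def tracelessSq (g : Metric n M) (h : TwoTensor n M) (x : M) : ℝ :=
  normSq (comp g.inner x) (traceless (comp g.inner x) (comp h x)) (extChartAt (𝓡 n) x x)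

/-- `(M, g)` is space-like with the symmetric tensor `h`: in all charts the Gauss equation
`R_ijkl = -(h_ik h_jl - h_il h_jk)` and the Codazzi equation `∇_i h_jk = ∇_j h_ik` hold. -/
structure IsSpaceLike (g : Metric n M) (h : TwoTensor n M) : Prop where
  symm : ∀ (x : M) (v w : TangentSpace (𝓡 n) x), h x v w = h x w v
  gauss : ∀ (α : M), ∀ y ∈ (extChartAt (𝓡 n) α).target, ∀ i j k l : Fin n,
    riemann (comp g.inner α) i j k l y =
      -(comp h α y i k * comp h α y j l - comp h α y i l * comp h α y j k)
  codazzi : ∀ (α : M), ∀ y ∈ (extChartAt (𝓡 n) α).target, ∀ i j k : Fin n,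
    covDeriv (comp g.inner α) (comp h α) i j k y = covDeriv (comp g.inner α) (comp h α) j i k y

/-- `(g(t), h(t))`, `t ∈ J`, is a smooth solution of the intrinsic mean curvature flow. Smoothness
is joint in time and space (up to the end points of `J` that belong to `J`), and time derivatives
at such end points are one-sided. -/
structure IsFlow (g : ℝ → Metric n M) (h : ℝ → TwoTensor n M) (J : Set ℝ) : Prop where
  smooth_g : ∀ (α : M) (i j : Fin n),
    ContDiffOn ℝ ∞ (fun p : ℝ × EuclideanSpace ℝ (Fin n) => comp (g p.1).inner α p.2 i j)
      (J ×ˢ (extChartAt (𝓡 n) α).target)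
  smooth_h : ∀ (α : M) (i j : Fin n),
    ContDiffOn ℝ ∞ (fun p : ℝ × EuclideanSpace ℝ (Fin n) => comp (h p.1) α p.2 i j)
      (J ×ˢ (extChartAt (𝓡 n) α).target)
  symm_h : ∀ t ∈ J, ∀ (x : M) (v w : TangentSpace (𝓡 n) x), h t x v w = h t x w v
  evol_g : ∀ t ∈ J, ∀ (α : M), ∀ y ∈ (extChartAt (𝓡 n) α).target, ∀ i j : Fin n,
    HasDerivWithinAt (fun s => comp (g s).inner α y i j)
      (metricVelocity (comp (g t).inner α) (comp (h t) α) i j y) J t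
  evol_h : ∀ t ∈ J, ∀ (α : M), ∀ y ∈ (extChartAt (𝓡 n) α).target, ∀ i j : Fin n,
    HasDerivWithinAt (fun s => comp (h s) α y i j)
      (tensorVelocity (comp (g t).inner α) (comp (h t) α) i j y) J t

end Scalars

end IntrinsicMCF

set_option linter.unusedSectionVars false
set_option linter.unusedSimpArgs false

/-! The argument has two halves: the Gauss and Codazzi equations persist along the flow, and for
space-like data the two formulas come from integrating pointwise evolution equations.

Persistence. On the bundle TN ⊕ ℝ with the Lorentzian form g ⊕ (-1), the Levi-Civita connection and
h together define a metric connection C (`bundleConn`). Its curvature F consists of the Gauss and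
Codazzi defects, so being space-like means that C is flat. The flow itself is only degenerate
parabolic, but F solves a genuinely parabolic linear system. Indeed, modulo the entries of F, the
time derivative of C_j equals g^{kl} ∂_k F_lj plus the infinitesimal gauge transformation of a
potential φ (`map_connDefect`). Inserting this into the variation formula for curvature and applying
the second Bianchi identity gives ∂_t F = g^{kl} ∂_k ∂_l F up to terms linear in F and ∂F
(`curv_heat`, `bundleCurv_heat`). The squared norm of F in a positive definite metric is a function
on N, independent of the chart. At a spatial maximum its Hessian is nonpositive and the gradient
terms are absorbed by the good quadratic term, so its time derivative is at most a constant times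
itself (`eventually_heat_quadratic_le`). It vanishes at time 0, hence always, by the maximum
principle `eq_zero_of_deriv_le_at_max`; this is `curv_bundleConn_eq_zero`.

That C evolves in this way is shown on the difference ε_j of the two sides. It is skew for the
Lorentzian form (`map_connDefect_skew`), its bottom row vanishes by Simons' identity
(`map_connDefect_row`), and its tangential block is torsion-free by the Bianchi identities
(`map_connDefect_torsion`). A skew and torsion-free tensor vanishes, and skewness disposes of the
remaining column.

Monotonicity. For space-like data Ric = h² - Hh, so ∂_t g = 2Hh and ∂_t dv = H² dv. Simons' identity
is not needed again: tracing the equation of h yields ∂_t H = ΔH - |A|²H and ∂_t |A|² = Δ|A|² -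
2|∇A|² - 2|A|⁴. Taking powers, multiplying by dv and integrating removes the Laplacians, and n|A|² -
H² is n times the squared norm of the trace-free part. Every remaining term has a sign because n is
even.

All tensor identities are proved in an abstract commutative ring with commuting derivations. This
ring is then the ring of smooth functions of time and chart coordinates. "Modulo F" is literally
passage to the quotient by the ideal generated by the entries of F, and "lower order" means lying in
the ideal generated by F and ∂F. -/

namespace IntrinsicMCF

/-! ### Connection matrices over a differential ring -/

section DiffRing

open Matrix

variable {A : Type*} [CommRing A] [Algebra ℝ A]

/-- Entrywise application of a derivation to a matrix. -/
def Dm {m k : Type*} (D : Derivation ℝ A A) (M : Matrix m k A) : Matrix m k A := M.map D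

@[simp] lemma Dm_apply {m k : Type*} (D : Derivation ℝ A A) (M : Matrix m k A) (a : m) (b : k) :
    Dm D M a b = D (M a b) := rfl

lemma Dm_add {m k : Type*} (D : Derivation ℝ A A) (M N : Matrix m k A) :
    Dm D (M + N) = Dm D M + Dm D N := by ext; simp

lemma Dm_sub {m k : Type*} (D : Derivation ℝ A A) (M N : Matrix m k A) :
    Dm D (M - N) = Dm D M - Dm D N := by ext; simp

lemma Dm_neg {m k : Type*} (D : Derivation ℝ A A) (M : Matrix m k A) :
    Dm D (-M) = -Dm D M := by ext; simp

lemma Dm_zero {m k : Type*} (D : Derivation ℝ A A) : Dm D (0 : Matrix m k A) = 0 := by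
  ext; simp

lemma Dm_one {m : Type*} [DecidableEq m] (D : Derivation ℝ A A) :
    Dm D (1 : Matrix m m A) = 0 := by
  ext a b; by_cases hab : a = b <;> simp [hab, Matrix.one_apply]

lemma Dm_smul {m k : Type*} (D : Derivation ℝ A A) (c : A) (M : Matrix m k A) :
    Dm D (c • M) = D c • M + c • Dm D M := by
  ext; simp; ring

lemma Dm_sum {m k κ : Type*} (s : Finset κ) (D : Derivation ℝ A A) (M : κ → Matrix m k A) :
    Dm D (∑ x ∈ s, M x) = ∑ x ∈ s, Dm D (M x) := by
  ext; simp [Matrix.sum_apply]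

lemma Dm_mul {m k l : Type*} [Fintype k] (D : Derivation ℝ A A) (M : Matrix m k A)
    (N : Matrix k l A) : Dm D (M * N) = Dm D M * N + M * Dm D N := by
  ext a b
  simp only [Dm_apply, Matrix.mul_apply, map_sum, Derivation.leibniz, smul_eq_mul,
    Matrix.add_apply, ← Finset.sum_add_distrib]
  exact Finset.sum_congr rfl fun x _ => by ring

lemma Dm_transpose {m k : Type*} (D : Derivation ℝ A A) (M : Matrix m k A) :
    Dm D Mᵀ = (Dm D M)ᵀ := rfl

lemma Dm_comm {m k : Type*} {D E : Derivation ℝ A A} (hDE : ∀ x, D (E x) = E (D x))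
    (M : Matrix m k A) : Dm D (Dm E M) = Dm E (Dm D M) := by
  ext; simp [hDE]

lemma Dm_trace {m : Type*} [Fintype m] (D : Derivation ℝ A A) (M : Matrix m m A) :
    D M.trace = (Dm D M).trace := by
  simp [Matrix.trace]

lemma Dm_fromBlocks {m k m' k' : Type*} (D : Derivation ℝ A A) (P : Matrix m k A)
    (Q : Matrix m k' A) (R : Matrix m' k A) (S : Matrix m' k' A) :
    Dm D (fromBlocks P Q R S) = fromBlocks (Dm D P) (Dm D Q) (Dm D R) (Dm D S) :=
  fromBlocks_map _ _ _ _ _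

lemma Dm_of_mul_eq_one {m : Type*} [Fintype m] [DecidableEq m] (D : Derivation ℝ A A)
    {g gi : Matrix m m A} (h : gi * g = 1) : Dm D gi = -(gi * Dm D g * gi) := by
  have h' : g * gi = 1 := mul_eq_one_comm.mp h
  have := congrArg (fun M => Dm D M * gi) h
  simp only [Dm_mul, Dm_one, zero_mul, add_mul, mul_assoc, h', mul_one] at this
  rw [mul_assoc]; exact eq_neg_of_add_eq_zero_left this

variable {ι : Type*} [Fintype ι] [DecidableEq ι] {W : Type*} [Fintype W] [DecidableEq W]

/-- The curvature of the connection with matrices `C i`. -/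
def curv (d : ι → Derivation ℝ A A) (C : ι → Matrix W W A) (i j : ι) : Matrix W W A :=
  Dm (d i) (C j) - Dm (d j) (C i) + C i * C j - C j * C i

variable {d : ι → Derivation ℝ A A} {C : ι → Matrix W W A}

lemma curv_swap (i j : ι) : curv d C j i = -curv d C i j := by
  unfold curv; noncomm_ring

/-- The second Bianchi identity. -/
lemma curv_bianchi (hd : ∀ i j x, d i (d j x) = d j (d i x)) (i j k : ι) :
    Dm (d k) (curv d C i j) + Dm (d i) (curv d C j k) + Dm (d j) (curv d C k i)
      = -(C k * curv d C i j - curv d C i j * C k + C i * curv d C j k - curv d C j k * C i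
        + C j * curv d C k i - curv d C k i * C j) := by
  unfold curv
  simp only [Dm_add, Dm_sub, Dm_mul]
  rw [Dm_comm (hd k i), Dm_comm (hd k j), Dm_comm (hd i j)]
  noncomm_ring

/-- The curvature of a connection compatible with `η` is skew with respect to `η`. -/
lemma curv_skew (hd : ∀ i j x, d i (d j x) = d j (d i x)) {η : Matrix W W A}
    (hη : ∀ i, Dm (d i) η = (C i)ᵀ * η + η * C i) (i j : ι) :
    η * curv d C i j + (curv d C i j)ᵀ * η = 0 := by
  -- Differentiating the compatibility relation once more and using that second derivatives of η
  -- commute leaves exactly the skewness of the curvature.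
  have h1 := Dm_comm (hd i j) η
  rw [hη, hη] at h1
  simp only [Dm_add, Dm_mul, hη, Dm_transpose] at h1
  unfold curv
  simp only [transpose_add, transpose_sub, transpose_mul]
  have h2 := sub_eq_zero.mpr h1
  rw [← h2]
  noncomm_ring

/-- Curvature is quadratic in the connection, so its variation is the covariant exterior derivative
of the variation of the connection. -/
lemma curv_deriv {τ : Derivation ℝ A A} (hτ : ∀ i x, τ (d i x) = d i (τ x)) (i j : ι) :
    Dm τ (curv d C i j) =
      (Dm (d i) (Dm τ (C j)) + C i * Dm τ (C j) - Dm τ (C j) * C i)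
        - (Dm (d j) (Dm τ (C i)) + C j * Dm τ (C i) - Dm τ (C i) * C j) := by
  unfold curv
  simp only [Dm_add, Dm_sub, Dm_mul]
  rw [Dm_comm (hτ i), Dm_comm (hτ j)]
  noncomm_ring

/-- Two quotients are in play: π₀ discards F, while π₁ discards F and its first derivatives. One
differentiation passes from the first to the second. -/
lemma map_Dm_eq_zero {Q₀ Q₁ : Type*} [CommRing Q₀] [CommRing Q₁] {π₀ : A →+* Q₀} {π₁ : A →+* Q₁}
    {D : Derivation ℝ A A} (h01 : ∀ x, π₀ x = 0 → π₁ (D x) = 0)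
    {M : Matrix W W A} (hM : π₀.mapMatrix M = 0) : π₁.mapMatrix (Dm D M) = 0 := by
  ext a b
  exact h01 _ (congrFun (congrFun hM a) b)

lemma mapMatrix_smul_eq {Q : Type*} [CommRing Q] (π : A →+* Q) (c : A) (M : Matrix W W A) :
    π.mapMatrix (c • M) = π c • π.mapMatrix M := by
  ext a b; simp

/-- If a connection moves, up to a gauge transformation and modulo its curvature, by the divergence
of its curvature, then the curvature satisfies a heat equation modulo lower order terms. -/
theorem curv_heat {Q₀ Q₁ : Type*} [CommRing Q₀] [CommRing Q₁] {π₀ : A →+* Q₀} {π₁ : A →+* Q₁}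
    (h0 : ∀ x, π₀ x = 0 → π₁ x = 0) (h1 : ∀ i x, π₀ x = 0 → π₁ (d i x) = 0)
    (hd : ∀ i j x, d i (d j x) = d j (d i x))
    {τ : Derivation ℝ A A} (hτ : ∀ i x, τ (d i x) = d i (τ x))
    (hF : ∀ i j, π₀.mapMatrix (curv d C i j) = 0) (gi : Matrix ι ι A) (φ : Matrix W W A)
    (hφ : ∀ j, π₀.mapMatrix (Dm τ (C j) - ∑ k, ∑ l, gi k l • Dm (d k) (curv d C l j)
      - (Dm (d j) φ + C j * φ - φ * C j)) = 0) (i j : ι) :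
    π₁.mapMatrix (Dm τ (curv d C i j)) =
      π₁.mapMatrix (∑ k, ∑ l, gi k l • Dm (d k) (Dm (d l) (curv d C i j))) := by
  have lift : ∀ {M : Matrix W W A}, π₀.mapMatrix M = 0 → π₁.mapMatrix M = 0 := fun hM => by
    ext a b; exact h0 _ (congrFun (congrFun hM a) b)
  have liftD : ∀ k {M : Matrix W W A}, π₀.mapMatrix M = 0 → π₁.mapMatrix (Dm (d k) M) = 0 :=
    fun k M hM => map_Dm_eq_zero (h1 k) hM
  set Y : ι → Matrix W W A := fun j => ∑ k, ∑ l, gi k l • Dm (d k) (curv d C l j) with hY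
  have hY0 : ∀ j, π₁.mapMatrix (Y j) = 0 := fun j => by
    simp only [hY, map_sum, mapMatrix_smul_eq, liftD _ (hF _ _), smul_zero, Finset.sum_const_zero]
  obtain ⟨ε, hε⟩ : ∃ ε : ι → Matrix W W A, ∀ j, ε j = Dm τ (C j) - Y j
      - (Dm (d j) φ + C j * φ - φ * C j) := ⟨_, fun _ => rfl⟩
  have hε0 : ∀ j, π₀.mapMatrix (ε j) = 0 := fun j => by rw [hε]; exact hφ j
  have ha : ∀ j, Dm τ (C j) = Y j + (Dm (d j) φ + C j * φ - φ * C j) + ε j := fun j => by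
    rw [hε]; abel
  -- The gauge term D_jφ contributes only the commutator of F with φ to the variation of F, because
  -- two covariant derivatives of φ commute up to curvature.
  have key : Dm τ (curv d C i j) = (Dm (d i) (Y j) - Dm (d j) (Y i))
      + (C i * Y j - Y j * C i - (C j * Y i - Y i * C j))
      + (Dm (d i) (ε j) + C i * ε j - ε j * C i - (Dm (d j) (ε i) + C j * ε i - ε i * C j))
      + (curv d C i j * φ - φ * curv d C i j) := by
    rw [curv_deriv hτ, ha, ha]
    simp only [Dm_add, Dm_sub, Dm_mul, curv]
    rw [Dm_comm (hd i j)]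
    noncomm_ring
  -- Derivatives that fall on the coefficients g^{kl} multiply a first derivative of F and disappear
  -- under π₁.
  have hDY : ∀ i j, π₁.mapMatrix (Dm (d i) (Y j)) =
      π₁.mapMatrix (∑ k, ∑ l, gi k l • Dm (d k) (Dm (d i) (curv d C l j))) := fun i j => by
    simp only [hY, Dm_sum, Dm_smul, map_sum, map_add, mapMatrix_smul_eq, liftD _ (hF _ _),
      smul_zero, zero_add]
    simp only [Dm_comm (hd i _)]
  -- Modulo F the second Bianchi identity says that the cyclic sum of plain derivatives of F is
  -- zero. Differentiating it once trades ∂_k(∂_i F_lj - ∂_j F_li) for ∂_k ∂_l F_ij.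
  have hB : ∀ k l, π₁.mapMatrix (Dm (d k) (Dm (d i) (curv d C l j)))
      - π₁.mapMatrix (Dm (d k) (Dm (d j) (curv d C l i))) =
      π₁.mapMatrix (Dm (d k) (Dm (d l) (curv d C i j))) := fun k l => by
    have hb := curv_bianchi (C := C) hd i j l
    have h2 : π₀.mapMatrix (Dm (d l) (curv d C i j) + Dm (d i) (curv d C j l)
        + Dm (d j) (curv d C l i)) = 0 := by
      rw [hb]; simp only [map_neg, map_add, map_sub, map_mul, hF, mul_zero, zero_mul, sub_zero,
        add_zero, neg_zero]
    have h3 := liftD k h2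
    rw [curv_swap (d := d) (C := C) l j, Dm_neg] at h3
    simp only [Dm_add, Dm_neg, map_add, map_neg] at h3
    rw [← sub_eq_zero, ← neg_eq_zero, ← h3]
    abel
  rw [key]
  simp only [map_add, map_sub, map_mul, hDY, hY0, lift (hF _ _), lift (hε0 _), liftD _ (hε0 _),
    mul_zero, zero_mul, sub_zero, add_zero]
  simp only [map_sum, mapMatrix_smul_eq, ← Finset.sum_sub_distrib, ← smul_sub, hB]

end DiffRing

/-! ### The Levi-Civita connection and the evolution of the Gauss-Codazzi tensor -/

section DiffRing

open Matrix

variable {A : Type*} [CommRing A] [Algebra ℝ A] {ι : Type*} [Fintype ι] [DecidableEq ι]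

/-- The matrices `Γ i` (with `Γ i k j = Γ^k_ij`) define a torsion-free connection compatible with
the symmetric form `g`. -/
structure LeviCivita (d : ι → Derivation ℝ A A) (g : Matrix ι ι A) (Γ : ι → Matrix ι ι A) :
    Prop where
  symm : gᵀ = g
  torsion : ∀ i j k, Γ i k j = Γ j k i
  compat : ∀ i, Dm (d i) g = (Γ i)ᵀ * g + g * Γ i

lemma double_cancel {Q : Type*} [CommRing Q] [Algebra ℝ Q] {x : Q} (h : x + x = 0) : x = 0 := by
  have h1 : (2 : ℝ) • x = 0 := by rw [two_smul, h]
  simpa using congrArg (fun z => (1 / 2 : ℝ) • z) h1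

/-- Skew in one pair of indices and symmetric in another: going around the permutations of three
indices reverses the sign. This is the uniqueness argument for the Levi-Civita connection. -/
lemma skew_symm_eq_zero {Q : Type*} [CommRing Q] [Algebra ℝ Q] {Y : ι → ι → ι → Q}
    (h1 : ∀ i c j, Y i c j = -Y i j c) (h2 : ∀ i c j, Y i c j = Y j c i) (i c j : ι) :
    Y i c j = 0 := by
  apply double_cancel
  have : Y i c j = -Y i c j := by
    calc Y i c j = -Y i j c := h1 _ _ _
      _ = -Y c j i := by rw [h2 i j c]
      _ = Y c i j := by rw [h1 c j i, neg_neg]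
      _ = Y j i c := h2 _ _ _
      _ = -Y j c i := h1 _ _ _
      _ = -Y i c j := by rw [h2 j c i]
  nth_rewrite 2 [this]
  exact add_neg_cancel _

/-- A difference of connection matrices that is skew and torsion-free vanishes. -/
lemma skew_torsion_free_eq_zero {Q : Type*} [CommRing Q] [Algebra ℝ Q] {g gi : Matrix ι ι Q}
    (hg : gᵀ = g) (hgi : gi * g = 1) {X : ι → Matrix ι ι Q}
    (h1 : ∀ i, (X i)ᵀ * g + g * X i = 0) (h2 : ∀ i j k, X i k j = X j k i) (i : ι) : X i = 0 := by
  have h3 : ∀ i c j, (g * X i) c j = 0 := by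
    refine skew_symm_eq_zero (Y := fun i c j => (g * X i) c j) (fun i c j => ?_) fun i c j => ?_
    · have := congrFun (congrFun (h1 i) c) j
      have h4 : ((X i)ᵀ * g) c j = (g * X i) j c := by
        rw [← transpose_apply (g * X i), transpose_mul, hg]
      rw [Matrix.add_apply, h4] at this
      exact eq_neg_of_add_eq_zero_right this
    · simp [mul_apply, h2 i j]
  have h4 : g * X i = 0 := by ext; exact h3 _ _ _
  rw [← Matrix.one_mul (X i), ← hgi, Matrix.mul_assoc, h4, Matrix.mul_zero]

variable {d : ι → Derivation ℝ A A} {g gi h : Matrix ι ι A} {Γ : ι → Matrix ι ι A}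

/-- The connection given by the Koszul formula is the Levi-Civita connection. -/
lemma leviCivita_of_koszul (hg : gᵀ = g) (hgi : g * gi = 1)
    (hΓ : ∀ i j k, Γ i k j =
      (1 / 2 : ℝ) • ∑ l, gi k l * (d i (g j l) + d j (g i l) - d l (g i j))) :
    LeviCivita d g Γ := by
  have hs : ∀ i j, g i j = g j i := fun i j => congrFun (congrFun hg j) i
  have hlow : ∀ i c j, (g * Γ i) c j
      = (1 / 2 : ℝ) • (d i (g j c) + d j (g i c) - d c (g i j)) := by
    intro i c j
    have h1 : (g * gi).mulVec (fun l => (d i (g j l) + d j (g i l) - d l (g i j))) c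
        = d i (g j c) + d j (g i c) - d c (g i j) := by
      rw [hgi, one_mulVec]
    rw [← h1, ← mulVec_mulVec]
    simp only [mul_apply, hΓ, mulVec, dotProduct]
    rw [Finset.smul_sum]
    exact Finset.sum_congr rfl fun a _ => mul_smul_comm _ _ _
  refine ⟨hg, fun i j k => ?_, fun i => ?_⟩
  · rw [hΓ, hΓ]
    congr 1
    refine Finset.sum_congr rfl fun l _ => ?_
    rw [hs i j]; ring
  · ext a b
    have h1 : ((Γ i)ᵀ * g) a b = (g * Γ i) b a := by
      rw [← transpose_apply (g * Γ i), transpose_mul, hg]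
    rw [Matrix.add_apply, h1, hlow, hlow, ← smul_add, Dm_apply]
    have h2 : d i (g a b) + d a (g i b) - d b (g i a) + (d i (g b a) + d b (g i a) - d a (g i b))
        = (2 : ℝ) • d i (g a b) := by
      rw [hs b a, two_smul]; ring
    rw [h2, smul_smul]; norm_num

/-- The curvature transforms as a tensor under a change of coordinates (with Jacobian matrix `J`)
and of frame (with transition matrix `S`). -/
lemma curv_pullback {B κ W W' : Type*} [CommRing B] [Algebra ℝ B] [Fintype κ] [Fintype W]
    [DecidableEq W] [Fintype W'] [DecidableEq W'] {d' : κ → Derivation ℝ B B} {π : B →+* A}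
    {J : Matrix κ ι A} (hπ : ∀ i f, d i (π f) = ∑ p, J p i * π (d' p f))
    (hd : ∀ i j x, d i (d j x) = d j (d i x))
    (hJ : ∀ i j p, d i (J p j) = d j (J p i)) {C : ι → Matrix W W A} {C' : κ → Matrix W' W' B}
    {S : Matrix W' W A}
    (hS : ∀ i, S * C i = Dm (d i) S + (∑ p, J p i • (C' p).map π) * S) (i j : ι) :
    S * curv d C i j = (∑ p, ∑ q, (J p i * J q j) • (curv d' C' p q).map π) * S := by
  set Θ : ι → Matrix W' W' A := fun i => ∑ p, J p i • (C' p).map π with hΘ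
  have hS' : ∀ i, Dm (d i) S = S * C i - Θ i * S := fun i => by rw [hS]; abel
  have hπm : ∀ i (M : Matrix W' W' B), Dm (d i) (M.map π) = ∑ p, J p i • (Dm (d' p) M).map π := by
    intro i M
    ext a b
    simp [hπ, Matrix.sum_apply]
  -- The pulled-back connection Θ has the pulled-back curvature; the derivatives of the Jacobian
  -- cancel because they are symmetric in i and j.
  have h1 : Dm (d i) (Θ j) - Dm (d j) (Θ i) + Θ i * Θ j - Θ j * Θ i
      = ∑ p, ∑ q, (J p i * J q j) • (curv d' C' p q).map π := by
    have e1 : ∀ i j, Dm (d i) (Θ j) = ∑ q, d i (J q j) • (C' q).map π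
        + ∑ p, ∑ q, (J p i * J q j) • (Dm (d' p) (C' q)).map π := by
      intro i j
      simp only [hΘ, Dm_sum, Dm_smul, hπm, Finset.sum_add_distrib, Finset.smul_sum, smul_smul]
      congr 1
      rw [Finset.sum_comm]
      refine Finset.sum_congr rfl fun p _ => Finset.sum_congr rfl fun q _ => by rw [mul_comm]
    have e2 : ∀ i j, Θ i * Θ j = ∑ p, ∑ q, (J p i * J q j) • ((C' p).map π * (C' q).map π) := by
      intro i j
      simp only [hΘ, Finset.sum_mul, Finset.mul_sum, smul_mul_smul_comm]
      exact Finset.sum_comm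
    have e3 : ∀ i j (N : κ → κ → Matrix W' W' A), ∑ p, ∑ q, (J p j * J q i) • N p q
        = ∑ p, ∑ q, (J p i * J q j) • N q p := by
      intro i j N
      rw [Finset.sum_comm]
      refine Finset.sum_congr rfl fun p _ => Finset.sum_congr rfl fun q _ => by rw [mul_comm]
    rw [e1, e1, e2, e2, e3 i j, e3 i j]
    simp only [hJ j i, curv, ← Finset.sum_sub_distrib, ← Finset.sum_add_distrib, ← smul_sub,
      ← smul_add, add_sub_add_left_eq_sub]
    refine Finset.sum_congr rfl fun p _ => Finset.sum_congr rfl fun q _ => ?_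
    congr 1
    ext a b
    simp [mul_apply]
  rw [← h1]
  -- The gauge law expresses dS through the two connections, and d²S = 0 is then the intertwining of
  -- their curvatures.
  have h2 : Dm (d i) (Dm (d j) S) = Dm (d j) (Dm (d i) S) := Dm_comm (hd i j) S
  simp only [hS', Dm_sub, Dm_mul] at h2
  rw [← sub_eq_zero] at h2 ⊢
  rw [← h2]
  unfold curv
  simp only [Matrix.sub_mul, Matrix.mul_sub, Matrix.add_mul, Matrix.mul_add, Matrix.mul_assoc]
  abel

/-- The connection transforms by the usual law under a change of coordinates. -/
lemma leviCivita_pullback {B κ : Type*} [CommRing B] [Algebra ℝ B] [Fintype κ] [DecidableEq κ]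
    {d' : κ → Derivation ℝ B B} {π : B →+* A}
    {J : Matrix κ ι A} {Ji : Matrix ι κ A} (hJi : J * Ji = 1)
    (hπ : ∀ i f, d i (π f) = ∑ p, J p i * π (d' p f))
    (hJ : ∀ i j p, d i (J p j) = d j (J p i)) {g' : Matrix κ κ B} {Γ' : κ → Matrix κ κ B}
    (hgi : gi * g = 1) (L : LeviCivita d g Γ) (L' : LeviCivita d' g' Γ')
    (hg : g = Jᵀ * g'.map π * J) (i : ι) :
    J * Γ i = Dm (d i) J + (∑ p, J p i • (Γ' p).map π) * J := by
  set Θ : ι → Matrix κ κ A := fun i => ∑ p, J p i • (Γ' p).map π with hΘ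
  have hdg : ∀ i, Dm (d i) (g'.map π) = (Θ i)ᵀ * g'.map π + g'.map π * Θ i := by
    intro i
    have e1 : Dm (d i) (g'.map π) = ∑ p, J p i • (Dm (d' p) g').map π := by
      ext a b
      simp [hπ, Matrix.sum_apply]
    rw [e1]
    simp only [hΘ, transpose_sum, transpose_smul, Finset.sum_mul, Finset.mul_sum,
      smul_mul_assoc, mul_smul_comm, ← Finset.sum_add_distrib, ← smul_add, L'.compat]
    refine Finset.sum_congr rfl fun p _ => ?_
    congr 1
    ext a b
    simp [mul_apply]
  -- Uniqueness of the Levi-Civita connection: the transformed symbols are also torsion-free and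
  -- compatible with g.
  have key : ∀ i, Γ i - Ji * (Dm (d i) J + Θ i * J) = 0 := by
    refine skew_torsion_free_eq_zero L.symm hgi (fun i => ?_) fun i j k => ?_
    · have h1 := L.compat i
      have h2 : Dm (d i) g = (Dm (d i) J + Θ i * J)ᵀ * g'.map π * J
          + Jᵀ * g'.map π * (Dm (d i) J + Θ i * J) := by
        rw [hg]
        simp only [Dm_mul, Dm_transpose, hdg, transpose_add, transpose_mul, Matrix.add_mul,
          Matrix.mul_add, Matrix.mul_assoc]
        abel
      have h3 : g * (Ji * (Dm (d i) J + Θ i * J)) = Jᵀ * g'.map π * (Dm (d i) J + Θ i * J) := by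
        rw [hg, ← Matrix.mul_assoc, Matrix.mul_assoc _ J Ji, hJi, Matrix.mul_one]
      have h4 : (Ji * (Dm (d i) J + Θ i * J))ᵀ * g
          = (Dm (d i) J + Θ i * J)ᵀ * g'.map π * J := by
        rw [hg, transpose_mul, ← Matrix.mul_assoc, ← Matrix.mul_assoc,
          Matrix.mul_assoc _ Jiᵀ Jᵀ, ← transpose_mul, hJi, transpose_one, Matrix.mul_one]
      rw [transpose_sub, Matrix.sub_mul, Matrix.mul_sub, h3, h4]
      rw [h1] at h2
      rw [sub_add_sub_comm, h2, sub_self]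
    · rw [Matrix.sub_apply, Matrix.sub_apply, L.torsion i j k]
      congr 1
      simp only [mul_apply (M := Ji)]
      refine Finset.sum_congr rfl fun p _ => ?_
      congr 1
      simp only [Matrix.add_apply, Dm_apply, hJ i j]
      congr 1
      simp only [hΘ, mul_apply, Matrix.sum_apply, Matrix.smul_apply, smul_eq_mul, Finset.sum_mul,
        map_apply]
      rw [Finset.sum_comm]
      refine Finset.sum_congr rfl fun q _ => Finset.sum_congr rfl fun r _ => ?_
      rw [L'.torsion r q p]; ring
  have := sub_eq_zero.mp (key i)
  rw [this, ← Matrix.mul_assoc, hJi, Matrix.one_mul]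

end DiffRing

/-! ### The connection on TN ⊕ ℝ and covariant derivatives of h -/

section DiffRing

open Matrix

variable {A : Type*} [CommRing A] [Algebra ℝ A] {ι : Type*} [Fintype ι] [DecidableEq ι]

/-- The connection matrices on `TN ⊕ ℝ` determined by the connection `Γ` and the second fundamental
form `h`; its curvature comprises the defects in the Gauss and Codazzi equations. -/
def bundleConn (Γ : ι → Matrix ι ι A) (gi h : Matrix ι ι A) (i : ι) :
    Matrix (ι ⊕ Unit) (ι ⊕ Unit) A :=
  fromBlocks (Γ i) (of fun k _ => (gi * h) k i) (of fun _ j => h i j) 0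

/-- The Lorentzian form `g ⊕ (-1)` on `TN ⊕ ℝ`. -/
def bundleForm (g : Matrix ι ι A) : Matrix (ι ⊕ Unit) (ι ⊕ Unit) A := fromBlocks g 0 0 (-1)

/-- The matrix `(∇_i h_jk)_jk`. -/
def nabla (d : ι → Derivation ℝ A A) (Γ : ι → Matrix ι ι A) (h : Matrix ι ι A) (i : ι) :
    Matrix ι ι A :=
  Dm (d i) h - (Γ i)ᵀ * h - h * Γ i

/-- The matrix `(∇_l ∇_i h_jk)_jk`. -/
def nabla₂ (d : ι → Derivation ℝ A A) (Γ : ι → Matrix ι ι A) (h : Matrix ι ι A) (l i : ι) :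
    Matrix ι ι A :=
  Dm (d l) (nabla d Γ h i) - (Γ l)ᵀ * nabla d Γ h i - nabla d Γ h i * Γ l
    - ∑ p, Γ l p i • nabla d Γ h p

/-- The rough Laplacian of `h`. -/
def roughLap (d : ι → Derivation ℝ A A) (Γ : ι → Matrix ι ι A) (gi h : Matrix ι ι A) :
    Matrix ι ι A :=
  ∑ l, ∑ i, gi l i • nabla₂ d Γ h l i

/-- The Ricci tensor. -/
def ricciMat (d : ι → Derivation ℝ A A) (Γ : ι → Matrix ι ι A) (g gi : Matrix ι ι A) :
    Matrix ι ι A :=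
  of fun i j => ∑ k, ∑ l, gi k l * (g * curv d Γ i k) j l

/-- The divergence `g^{lk} ∇_l h_ki`. -/
def divergence (d : ι → Derivation ℝ A A) (Γ : ι → Matrix ι ι A) (gi h : Matrix ι ι A) (i : ι) :
    A :=
  ∑ l, (gi * nabla d Γ h l) l i

variable {d : ι → Derivation ℝ A A} {g gi h : Matrix ι ι A} {Γ : ι → Matrix ι ι A}

lemma nabla_symm (hh : hᵀ = h) (i : ι) : (nabla d Γ h i)ᵀ = nabla d Γ h i := by
  unfold nabla
  rw [transpose_sub, transpose_sub, transpose_mul, transpose_mul, transpose_transpose, hh,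
    ← Dm_transpose, hh]
  abel

lemma LeviCivita.inv_symm (L : LeviCivita d g Γ) (hgi : gi * g = 1) : giᵀ = gi := by
  have h1 : g * giᵀ = 1 := by
    rw [← L.symm, ← transpose_mul, hgi, transpose_one]
  calc giᵀ = gi * g * giᵀ := by rw [hgi, Matrix.one_mul]
    _ = gi := by rw [Matrix.mul_assoc, h1, Matrix.mul_one]

lemma LeviCivita.compat_inv (L : LeviCivita d g Γ) (hgi : gi * g = 1) (i : ι) :
    Dm (d i) gi = -(Γ i * gi) - gi * (Γ i)ᵀ := by
  have hgi' : g * gi = 1 := mul_eq_one_comm.mp hgi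
  rw [Dm_of_mul_eq_one _ hgi, L.compat, Matrix.mul_add, Matrix.add_mul, neg_add,
    ← Matrix.mul_assoc gi g, hgi, Matrix.one_mul, Matrix.mul_assoc gi _ gi,
    Matrix.mul_assoc _ g gi, hgi', Matrix.mul_one]
  abel

/-- The minus sign in g ⊕ (-1) makes the off-diagonal blocks adjoint up to sign: lowering h^k_i with
g gives h_ki, which cancels -h_ik. -/
lemma bundleConn_compat (L : LeviCivita d g Γ) (hgi : g * gi = 1) (hh : hᵀ = h) (i : ι) :
    Dm (d i) (bundleForm g) = (bundleConn Γ gi h i)ᵀ * bundleForm g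
      + bundleForm g * bundleConn Γ gi h i := by
  have h0 : giᵀ = gi := L.inv_symm (mul_eq_one_comm.mp hgi)
  have hb : g * (of fun k (_ : Unit) => (gi * h) k i) = of fun k (_ : Unit) => h k i := by
    ext a b
    have : (g * (gi * h)) a i = h a i := by rw [← Matrix.mul_assoc, hgi, Matrix.one_mul]
    simpa [mul_apply] using this
  have hb' : (of fun k (_ : Unit) => (gi * h) k i)ᵀ * g = of fun (_ : Unit) k => h k i := by
    rw [← transpose_transpose (_ * g), transpose_mul, transpose_transpose, L.symm, hb]; rfl
  have hs : ∀ a b, h a b = h b a := fun a b => congrFun (congrFun hh b) a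
  unfold bundleConn bundleForm
  rw [Dm_fromBlocks, fromBlocks_transpose, fromBlocks_multiply, fromBlocks_multiply,
    fromBlocks_add, L.compat, hb, hb', Dm_neg, Dm_one, Dm_zero, Dm_zero]
  congr 1
  · simp
  · ext a b; simp [hs a i]
  · ext a b; simp [hs b i]
  · simp

/-- The tangential block of F is the Gauss defect with one index raised. The bottom row, computed
next, is the Codazzi defect: the symbols acting on the differentiation index cancel by
torsion-freeness. -/
lemma curv_bundleConn_inl_inl (i j a c) :
    curv d (bundleConn Γ gi h) i j (Sum.inl a) (Sum.inl c) =
      curv d Γ i j a c + (gi * h) a i * h j c - (gi * h) a j * h i c := by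
  simp only [curv, bundleConn, Dm_fromBlocks, fromBlocks_multiply, Matrix.add_apply,
    Matrix.sub_apply, fromBlocks_apply₁₁, mul_apply, of_apply, Finset.univ_unique,
    Finset.sum_singleton]
  ring

lemma curv_bundleConn_inr_inl (L : LeviCivita d g Γ) (i j : ι) (u : Unit) (c : ι) :
    curv d (bundleConn Γ gi h) i j (Sum.inr u) (Sum.inl c) =
      nabla d Γ h i j c - nabla d Γ h j i c := by
  simp only [curv, bundleConn, Dm_fromBlocks, fromBlocks_multiply, Matrix.add_apply,
    Matrix.sub_apply, fromBlocks_apply₂₁, mul_apply, of_apply, nabla, transpose_apply, Dm_apply,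
    zero_mul, Finset.sum_const_zero, Matrix.zero_apply, add_zero, L.torsion i]
  ring

lemma curv_bundleConn_inl_inr (i j a : ι) (u : Unit) :
    curv d (bundleConn Γ gi h) i j (Sum.inl a) (Sum.inr u) =
      d i ((gi * h) a j) + (Γ i * (gi * h)) a j - (d j ((gi * h) a i) + (Γ j * (gi * h)) a i) := by
  simp only [curv, bundleConn, Dm_fromBlocks, fromBlocks_multiply, Matrix.add_apply,
    Matrix.sub_apply, fromBlocks_apply₁₂, mul_apply (M := Γ _), of_apply, Dm_apply,
    Matrix.mul_zero, Matrix.zero_apply, add_zero]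
  ring

/-- The first Bianchi identity. -/
lemma bundle_bianchi_first (L : LeviCivita d g Γ) (hh : hᵀ = h) (i j l a : ι) :
    curv d (bundleConn Γ gi h) l j (Sum.inl a) (Sum.inl i)
      - curv d (bundleConn Γ gi h) l i (Sum.inl a) (Sum.inl j)
      = -curv d (bundleConn Γ gi h) j i (Sum.inl a) (Sum.inl l) := by
  have hs : ∀ a b, h a b = h b a := fun a b => congrFun (congrFun hh b) a
  have t1 : ∀ p, Γ j p i = Γ i p j := fun p => L.torsion j i p
  have t2 : ∀ p, Γ l p i = Γ i p l := fun p => L.torsion l i p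
  have t3 : ∀ p, Γ l p j = Γ j p l := fun p => L.torsion l j p
  simp only [curv_bundleConn_inl_inl]
  simp only [curv, Matrix.add_apply, Matrix.sub_apply, Dm_apply,
    mul_apply (M := Γ _), t1, t2, t3, hs l i, hs l j, hs j i]
  ring

/-- The Ricci identity. -/
lemma nabla₂_comm (hd : ∀ i j x, d i (d j x) = d j (d i x)) (L : LeviCivita d g Γ) (l j : ι) :
    nabla₂ d Γ h l j - nabla₂ d Γ h j l = -((curv d Γ l j)ᵀ * h) - h * curv d Γ l j := by
  have h1 : ∀ p, Γ l p j = Γ j p l := fun p => L.torsion l j p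
  unfold nabla₂
  simp only [h1]
  unfold nabla curv
  simp only [Dm_sub, Dm_mul, Dm_transpose, transpose_add, transpose_sub, transpose_mul]
  rw [Dm_comm (hd l j)]
  noncomm_ring

/-- Contraction commutes with ∇_j because g⁻¹ is parallel: two of the correction terms of the second
covariant derivative come from differentiating g⁻¹, and the third is the correction for the covector
div h. -/
lemma derivation_divergence (L : LeviCivita d g Γ) (hgi : gi * g = 1) (j i : ι) :
    ∑ l, (gi * nabla₂ d Γ h j l) l i =
      d j (divergence d Γ gi h i) - ∑ p, divergence d Γ gi h p * Γ j p i := by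
  have e1 : d j (divergence d Γ gi h i) = ∑ l, ((gi * Dm (d j) (nabla d Γ h l)) l i
      - (Γ j * (gi * nabla d Γ h l)) l i - (gi * ((Γ j)ᵀ * nabla d Γ h l)) l i) := by
    simp only [divergence, map_sum]
    refine Finset.sum_congr rfl fun l _ => ?_
    rw [← Dm_apply, Dm_mul, L.compat_inv hgi, Matrix.sub_mul, Matrix.neg_mul, Matrix.mul_assoc,
      Matrix.mul_assoc, Matrix.add_apply, Matrix.sub_apply, Matrix.neg_apply]
    ring
  have e2 : ∑ p, divergence d Γ gi h p * Γ j p i = ∑ l, (gi * nabla d Γ h l * Γ j) l i := by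
    simp only [divergence, Finset.sum_mul, mul_apply (N := Γ j)]
    exact Finset.sum_comm
  have e3 : ∑ l, (gi * ∑ p, Γ j p l • nabla d Γ h p) l i
      = ∑ l, (Γ j * (gi * nabla d Γ h l)) l i := by
    simp only [Finset.mul_sum, Matrix.mul_smul, Matrix.sum_apply, Matrix.smul_apply, smul_eq_mul,
      mul_apply (M := Γ j)]
    exact Finset.sum_comm
  rw [e1, e2]
  simp only [nabla₂, Matrix.mul_sub, Matrix.sub_apply, Finset.sum_sub_distrib, e3,
    Matrix.mul_assoc]
  ring

lemma derivation_trace (L : LeviCivita d g Γ) (hgi : gi * g = 1) (i : ι) :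
    d i (gi * h).trace = (gi * nabla d Γ h i).trace := by
  rw [Dm_trace, Dm_mul, L.compat_inv hgi, nabla]
  simp only [Matrix.sub_mul, Matrix.mul_sub, trace_add, trace_sub, Matrix.neg_mul, trace_neg,
    ← Matrix.mul_assoc]
  rw [trace_mul_comm (gi * h), ← Matrix.mul_assoc]
  ring

end DiffRing

/-! ### The flow modulo the Gauss and Codazzi defects, and Simons' identity -/

section DiffRing

open Matrix

variable {A : Type*} [CommRing A] [Algebra ℝ A] {ι : Type*} [Fintype ι] [DecidableEq ι]
variable {d : ι → Derivation ℝ A A} {g gi h : Matrix ι ι A} {Γ : ι → Matrix ι ι A}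

/-- The right-hand side of the evolution equation of `h`. -/
def hVelocity (d : ι → Derivation ℝ A A) (Γ : ι → Matrix ι ι A) (g gi h : Matrix ι ι A) :
    Matrix ι ι A :=
  roughLap d Γ gi h - ricciMat d Γ g gi * (gi * h) - (ricciMat d Γ g gi * (gi * h))ᵀ
    + (2 : A) • (h * (gi * h) * (gi * h)) - (gi * h * (gi * h)).trace • h

/-- The right-hand side of the evolution equation of `g`. -/
def gVelocity (d : ι → Derivation ℝ A A) (Γ : ι → Matrix ι ι A) (g gi h : Matrix ι ι A) :
    Matrix ι ι A :=
  (-2 : A) • ricciMat d Γ g gi + (2 : A) • (h * (gi * h))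

/-- The gauge potential of the flow. -/
def gaugePotential (d : ι → Derivation ℝ A A) (Γ : ι → Matrix ι ι A) (g gi h : Matrix ι ι A) :
    Matrix (ι ⊕ Unit) (ι ⊕ Unit) A :=
  fromBlocks (gi * (h * (gi * h) - ricciMat d Γ g gi))
    (of fun a _ => ∑ c, gi a c * divergence d Γ gi h c)
    (of fun _ i => divergence d Γ gi h i) 0

section Quotient

variable {Q : Type*} [CommRing Q] [Algebra ℝ Q] {π : A →+* Q}

/-- In the following lemmas π is any homomorphism that kills every entry of F. Gauss and Codazzi may
thus be used after applying π, although the pair (g, h) is not yet known to satisfy them. -/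
lemma map_nabla_comm (L : LeviCivita d g Γ)
    (hF : ∀ i j a b, π (curv d (bundleConn Γ gi h) i j a b) = 0) (i j c : ι) :
    π (nabla d Γ h i j c) = π (nabla d Γ h j i c) := by
  rw [← sub_eq_zero, ← map_sub, ← curv_bundleConn_inr_inl (gi := gi) L i j () c, hF]

lemma map_curv (hF : ∀ i j a b, π (curv d (bundleConn Γ gi h) i j a b) = 0) (i j : ι) :
    π.mapMatrix (curv d Γ i j) = π.mapMatrix (-(vecMulVec (fun a => (gi * h) a i) (h j)
      - vecMulVec (fun a => (gi * h) a j) (h i))) := by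
  ext a c
  have := hF i j (Sum.inl a) (Sum.inl c)
  rw [curv_bundleConn_inl_inl] at this
  simp only [RingHom.mapMatrix_apply, map_apply]
  rw [← sub_eq_zero, ← map_sub, ← this]
  congr 1
  simp [vecMulVec_apply]
  ring

/-- The traced Codazzi equation dH = div h. -/
lemma map_derivation_trace (L : LeviCivita d g Γ) (hgi : gi * g = 1) (hh : hᵀ = h)
    (hF : ∀ i j a b, π (curv d (bundleConn Γ gi h) i j a b) = 0) (i : ι) :
    π (d i (gi * h).trace) = π (divergence d Γ gi h i) := by
  have hsym : ∀ l a b, nabla d Γ h l a b = nabla d Γ h l b a := fun l a b =>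
    congrFun (congrFun (nabla_symm hh l) b) a
  rw [derivation_trace L hgi]
  simp only [divergence, Matrix.trace, diag, mul_apply, map_sum, map_mul]
  refine Finset.sum_congr rfl fun l _ => Finset.sum_congr rfl fun k _ => ?_
  rw [map_nabla_comm L hF, hsym, map_nabla_comm L hF]

/-- The traced Gauss equation Ric = h² - Hh. -/
lemma map_ricciMat (hgi : g * gi = 1) (hgs : giᵀ = gi) (hh : hᵀ = h)
    (hF : ∀ i j a b, π (curv d (bundleConn Γ gi h) i j a b) = 0) :
    π.mapMatrix (ricciMat d Γ g gi)
      = π.mapMatrix (h * (gi * h) - (gi * h).trace • h) := by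
  have hs : ∀ a b, h a b = h b a := fun a b => congrFun (congrFun hh b) a
  have hgs' : ∀ a b, gi a b = gi b a := fun a b => congrFun (congrFun hgs b) a
  have hgb : g * (gi * h) = h := by rw [← Matrix.mul_assoc, hgi, Matrix.one_mul]
  have e1 : ∀ i k, π.mapMatrix (g * curv d Γ i k)
      = π.mapMatrix (-(vecMulVec (h i) (h k) - vecMulVec (h k) (h i))) := by
    intro i k
    have e2 : ∀ i, g *ᵥ (fun a => (gi * h) a i) = h i := by
      intro i; ext a
      have := congrFun (congrFun hgb a) i
      rw [hs i a, ← this]; simp [mulVec, dotProduct, mul_apply]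
    rw [map_mul, map_curv hF, ← map_mul, Matrix.mul_neg, Matrix.mul_sub, mul_vecMulVec,
      mul_vecMulVec, e2, e2]
  ext i j
  have e3 : ∀ k l, π ((g * curv d Γ i k) j l) = π (h k j * h i l - h i j * h k l) := by
    intro k l
    have := congrFun (congrFun (e1 i k) j) l
    simp only [RingHom.mapMatrix_apply, map_apply] at this
    rw [this]
    congr 1
    simp [vecMulVec_apply]
  simp only [RingHom.mapMatrix_apply, map_apply, ricciMat, of_apply, map_sum, map_mul, e3]
  simp only [← map_mul, ← map_sum]
  congr 1
  simp only [Matrix.sub_apply, mul_apply, Matrix.smul_apply, smul_eq_mul, Matrix.trace, diag,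
    mul_sub, Finset.sum_sub_distrib, Finset.sum_mul, Finset.mul_sum]
  congr 1
  · rw [Finset.sum_comm]
    refine Finset.sum_congr rfl fun k _ => Finset.sum_congr rfl fun l _ => ?_
    rw [hgs' k l]; ring
  · refine Finset.sum_congr rfl fun k _ => Finset.sum_congr rfl fun l _ => ?_
    rw [hs k l]; ring

/-- Simons' identity modulo the Gauss and Codazzi equations. -/
lemma map_roughLap (hd : ∀ i j x, d i (d j x) = d j (d i x)) (L : LeviCivita d g Γ)
    (hgi : gi * g = 1) (hh : hᵀ = h)
    (hF : ∀ i j a b, π (curv d (bundleConn Γ gi h) i j a b) = 0) (j i : ι) :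
    π (roughLap d Γ gi h j i) =
      π (∑ l, ∑ k, gi l k * d l (nabla d Γ h k j i - nabla d Γ h j k i)
        + (d j (divergence d Γ gi h i) - ∑ p, divergence d Γ gi h p * Γ j p i)
        + ((gi * h * (gi * h)).trace * h j i - (gi * h).trace * (h * (gi * h)) j i)) := by
  have hgs : giᵀ = gi := L.inv_symm hgi
  have hs : ∀ a b, h a b = h b a := fun a b => congrFun (congrFun hh b) a
  have hsym : ∀ l a b, nabla d Γ h l a b = nabla d Γ h l b a := fun l a b =>
    congrFun (congrFun (nabla_symm hh l) b) a
  have hc := fun i j c => map_nabla_comm (π := π) (gi := gi) L hF i j c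
  -- Interchanging k and j under ∇_l costs the plain derivative of the Codazzi defect. A derivative
  -- of F need not be killed by π, so it is kept; all undifferentiated defects drop out.
  have e1 : ∀ l k, π (nabla₂ d Γ h l k j i) = π (d l (nabla d Γ h k j i - nabla d Γ h j k i)
      + nabla₂ d Γ h l j k i) := by
    intro l k
    simp only [nabla₂, Matrix.sub_apply, Dm_apply, mul_apply, Matrix.sum_apply, Matrix.smul_apply,
      smul_eq_mul, transpose_apply, map_add, map_sub, map_sum, map_mul, hc j k]
    have e11 : ∀ p, π (nabla d Γ h k p i) = π (nabla d Γ h p k i) := fun p => hc _ _ _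
    have e12 : ∀ p, π (nabla d Γ h j p i) = π (nabla d Γ h p j i) := fun p => hc _ _ _
    simp only [e11, e12]
    ring
  have e2 : π (roughLap d Γ gi h j i) =
      π (∑ l, ∑ k, gi l k * d l (nabla d Γ h k j i - nabla d Γ h j k i))
        + π (∑ l, (gi * nabla₂ d Γ h l j) l i) := by
    simp only [roughLap, Matrix.sum_apply, Matrix.smul_apply, smul_eq_mul, map_sum, map_mul, e1,
      map_add, mul_add, Finset.sum_add_distrib, mul_apply]
  have e3 : ∀ l, nabla₂ d Γ h l j = nabla₂ d Γ h j l
      + (-((curv d Γ l j)ᵀ * h) - h * curv d Γ l j) := fun l => by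
    rw [← nabla₂_comm hd L]; abel
  -- The curvature terms of the Ricci identity, evaluated by Gauss. The two terms cubic in h without
  -- a trace cancel.
  have e4 : ∑ l, π ((gi * (-((curv d Γ l j)ᵀ * h) - h * curv d Γ l j)) l i)
      = π ((gi * h * (gi * h)).trace * h j i - (gi * h).trace * (h * (gi * h)) j i) := by
    have e5 : ∀ l, π ((gi * (-((curv d Γ l j)ᵀ * h) - h * curv d Γ l j)) l i) =
        π ((gi * h) l j * ((gi * h)ᵀ * h) l i - (gi * h) l l * ((gi * h)ᵀ * h) j i
          + (gi * h * (gi * h)) l l * h j i - (gi * h * (gi * h)) l j * h l i) := by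
      intro l
      have e6 : π.mapMatrix (gi * (-((curv d Γ l j)ᵀ * h) - h * curv d Γ l j)) =
          π.mapMatrix (gi * (-((-(vecMulVec (fun a => (gi * h) a l) (h j)
          - vecMulVec (fun a => (gi * h) a j) (h l)))ᵀ * h) - h * (-(vecMulVec
          (fun a => (gi * h) a l) (h j) - vecMulVec (fun a => (gi * h) a j) (h l))))) := by
        have e7 := map_curv hF l j
        have e8 : π.mapMatrix (curv d Γ l j)ᵀ = π.mapMatrix (-(vecMulVec (fun a => (gi * h) a l)
            (h j) - vecMulVec (fun a => (gi * h) a j) (h l)))ᵀ := by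
          ext a b; exact congrFun (congrFun e7 b) a
        rw [map_mul, map_sub, map_neg, map_mul, map_mul, e7, e8, ← map_mul, ← map_mul, ← map_neg,
          ← map_sub, ← map_mul]
      have e9 := congrFun (congrFun e6 l) i
      simp only [RingHom.mapMatrix_apply, map_apply] at e9
      rw [e9]
      congr 1
      have f1 : ∀ p, gi *ᵥ h p = fun a => (gi * h) a p := by
        intro p; ext a
        simp [mulVec, dotProduct, mul_apply, hs p]
      have f2 : ∀ p, (fun a => (gi * h) a p) ᵥ* h = ((gi * h)ᵀ * h) p := by
        intro p; ext a; rw [mul_apply]; rfl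
      have f3 : ∀ p, gi *ᵥ (h *ᵥ fun a => (gi * h) a p) = fun a => (gi * h * (gi * h)) a p := by
        intro p; rw [mulVec_mulVec]; ext a; simp [mulVec, dotProduct, mul_apply (M := gi * h)]
      rw [transpose_neg, transpose_sub, transpose_vecMulVec, transpose_vecMulVec]
      simp only [Matrix.neg_mul, Matrix.mul_neg, neg_neg, Matrix.sub_mul, Matrix.mul_sub, Matrix.mul_add,
        vecMulVec_mul, mul_vecMulVec, f1, f2, f3, sub_neg_eq_add]
      simp only [Matrix.add_apply, Matrix.sub_apply, vecMulVec_apply]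
      ring
    simp only [e5, ← map_sum]
    congr 1
    have g1 : (gi * h)ᵀ * h = h * (gi * h) := by rw [transpose_mul, hh, hgs, Matrix.mul_assoc]
    have g2 : ∑ l, (gi * h) l j * (h * (gi * h)) l i = ((gi * h)ᵀ * (h * (gi * h))) j i := by
      rw [mul_apply]; rfl
    have g3 : ∑ l, (gi * h * (gi * h)) l j * h l i = ((gi * h * (gi * h))ᵀ * h) j i := by
      rw [mul_apply]; rfl
    have g4 : (gi * h)ᵀ * (h * (gi * h)) = (gi * h * (gi * h))ᵀ * h := by
      rw [← g1, ← Matrix.mul_assoc, ← transpose_mul]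
    simp only [Finset.sum_sub_distrib, Finset.sum_add_distrib, g1, g2, g3, g4,
      ← Finset.sum_mul, Matrix.trace, diag]
    ring
  rw [e2, map_add, map_add, ← derivation_divergence L hgi, add_assoc]
  congr 1
  rw [← e4]
  simp only [e3, Matrix.mul_add, Matrix.add_apply, Finset.sum_add_distrib, map_add, map_sum]

end Quotient

end DiffRing

/-! ### Evolution of the bundle connection -/

section DiffRing

open Matrix

variable {A : Type*} [CommRing A] [Algebra ℝ A] {ι : Type*} [Fintype ι] [DecidableEq ι]
variable {d : ι → Derivation ℝ A A} {g gi h : Matrix ι ι A} {Γ : ι → Matrix ι ι A}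

/-- The difference of the two sides of the evolution equation of the bundle connection. -/
def connDefect (d : ι → Derivation ℝ A A) (τ : Derivation ℝ A A) (Γ : ι → Matrix ι ι A)
    (g gi h : Matrix ι ι A) (j : ι) : Matrix (ι ⊕ Unit) (ι ⊕ Unit) A :=
  Dm τ (bundleConn Γ gi h j)
    - ∑ k, ∑ l, gi k l • Dm (d k) (curv d (bundleConn Γ gi h) l j)
    - (Dm (d j) (gaugePotential d Γ g gi h) + bundleConn Γ gi h j * gaugePotential d Γ g gi h
      - gaugePotential d Γ g gi h * bundleConn Γ gi h j)

/-- Symmetry of the Ricci tensor is read off from the flow: every other term of ∂_t g is symmetric.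
The pair symmetry of the curvature is not needed. -/
lemma ricciMat_symm {τ : Derivation ℝ A A} (hg : gᵀ = g) (hgs : giᵀ = gi) (hh : hᵀ = h)
    (hgdot : Dm τ g = gVelocity d Γ g gi h) : (ricciMat d Γ g gi)ᵀ = ricciMat d Γ g gi := by
  have h1 : (gVelocity d Γ g gi h)ᵀ = gVelocity d Γ g gi h := by
    rw [← hgdot, ← Dm_transpose, hg]
  have h2 : (h * (gi * h))ᵀ = h * (gi * h) := by
    rw [transpose_mul, transpose_mul, hh, hgs, Matrix.mul_assoc]
  simp only [gVelocity, transpose_add, transpose_smul, h2, add_left_inj] at h1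
  ext a b
  have h3 := congrFun (congrFun h1 a) b
  simp only [Matrix.smul_apply, smul_eq_mul] at h3
  rw [← sub_eq_zero]
  apply double_cancel
  linear_combination -h3

/-- The form g ⊕ (-1) moves in time. The potential φ is normalised so that its symmetric part
accounts for this motion, which makes the corrected variation of the connection skew. -/
lemma gaugePotential_symm {τ : Derivation ℝ A A} (L : LeviCivita d g Γ) (hgi : gi * g = 1)
    (hh : hᵀ = h) (hgdot : Dm τ g = gVelocity d Γ g gi h) :
    bundleForm g * gaugePotential d Γ g gi h + (gaugePotential d Γ g gi h)ᵀ * bundleForm g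
      = Dm τ (bundleForm g) := by
  have hgs : giᵀ = gi := L.inv_symm hgi
  have hgi' : g * gi = 1 := mul_eq_one_comm.mp hgi
  have h2 : (h * (gi * h))ᵀ = h * (gi * h) := by
    rw [transpose_mul, transpose_mul, hh, hgs, Matrix.mul_assoc]
  have h3 : g * (of fun a (_ : Unit) => ∑ c, gi a c * divergence d Γ gi h c)
      = of fun a _ => divergence d Γ gi h a := by
    have : (of fun a (_ : Unit) => ∑ c, gi a c * divergence d Γ gi h c)
        = gi * of fun a (_ : Unit) => divergence d Γ gi h a := by
      ext a b; simp [mul_apply]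
    rw [this, ← Matrix.mul_assoc, hgi', Matrix.one_mul]
  have h3' : (of fun a (_ : Unit) => ∑ c, gi a c * divergence d Γ gi h c)ᵀ * g
      = of fun _ a => divergence d Γ gi h a := by
    rw [← transpose_transpose (_ * g), transpose_mul, transpose_transpose, L.symm, h3]; rfl
  unfold bundleForm gaugePotential
  rw [Dm_fromBlocks, fromBlocks_transpose, fromBlocks_multiply, fromBlocks_multiply,
    fromBlocks_add, hgdot, Dm_neg, Dm_one, Dm_zero, Dm_zero, h3, h3']
  congr 1
  · rw [transpose_mul, transpose_sub, h2, ricciMat_symm L.symm hgs hh hgdot, hgs,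
      ← Matrix.mul_assoc, hgi', Matrix.one_mul, gVelocity, Matrix.zero_mul, add_zero,
      Matrix.mul_zero, add_zero, Matrix.mul_assoc, hgi, Matrix.mul_one]
    ext a b
    simp only [Matrix.add_apply, Matrix.sub_apply, Matrix.smul_apply, smul_eq_mul]
    ring
  · ext a b; simp
  · ext a b; simp
  · simp

section Quotient

variable {Q : Type*} [CommRing Q] [Algebra ℝ Q] {π : A →+* Q}

/-- Both pieces of the defect are skew: the divergence of F because F is, up to undifferentiated F,
and ∂_t C_j - D_jφ because compatibility of C with the form holds at all times. -/
lemma map_connDefect_skew (hd : ∀ i j x, d i (d j x) = d j (d i x)) {τ : Derivation ℝ A A}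
    (hτ : ∀ i x, τ (d i x) = d i (τ x)) (L : LeviCivita d g Γ) (hgi : gi * g = 1) (hh : hᵀ = h)
    (hgdot : Dm τ g = gVelocity d Γ g gi h)
    (hF : ∀ i j a b, π (curv d (bundleConn Γ gi h) i j a b) = 0) (j : ι) :
    π.mapMatrix (bundleForm g * connDefect d τ Γ g gi h j
      + (connDefect d τ Γ g gi h j)ᵀ * bundleForm g) = 0 := by
  have hη := bundleConn_compat L (mul_eq_one_comm.mp hgi) hh
  have hF' : ∀ i j, π.mapMatrix (curv d (bundleConn Γ gi h) i j) = 0 := fun i j => by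
    ext a b; exact hF i j a b
  have hFT : ∀ i j, π.mapMatrix (curv d (bundleConn Γ gi h) i j)ᵀ = 0 := fun i j => by
    ext a b; exact hF i j b a
  have hφ := gaugePotential_symm L hgi hh hgdot
  generalize hφ' : gaugePotential d Γ g gi h = φ at hφ
  generalize hC : bundleConn Γ gi h = C at *
  generalize hηe : bundleForm g = η at *
  have hcurv : ∀ k l, π.mapMatrix (η * Dm (d k) (curv d C l j)
      + (Dm (d k) (curv d C l j))ᵀ * η) = 0 := by
    intro k l
    have h1 := congrArg (Dm (d k)) (curv_skew hd hη l j)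
    rw [Dm_add, Dm_mul, Dm_mul, Dm_zero, Dm_transpose] at h1
    have h2 : η * Dm (d k) (curv d C l j) + (Dm (d k) (curv d C l j))ᵀ * η
        = -(Dm (d k) η * curv d C l j + (curv d C l j)ᵀ * Dm (d k) η) := by
      rw [eq_neg_iff_add_eq_zero, ← h1]; abel
    rw [h2, map_neg, map_add, map_mul, map_mul, hF', hFT, Matrix.mul_zero, Matrix.zero_mul,
      add_zero, neg_zero]
  have hY : π.mapMatrix (η * (∑ k, ∑ l, gi k l • Dm (d k) (curv d C l j))
      + (∑ k, ∑ l, gi k l • Dm (d k) (curv d C l j))ᵀ * η) = 0 := by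
    simp only [transpose_sum, transpose_smul, Finset.mul_sum, Finset.sum_mul, mul_smul_comm,
      smul_mul_assoc, ← Finset.sum_add_distrib, ← smul_add, map_sum, mapMatrix_smul_eq, hcurv,
      smul_zero, Finset.sum_const_zero]
  -- The time derivative of the compatibility relation, with ∂_t η expressed through φ; this holds
  -- exactly and not only modulo F.
  have hG : η * (Dm τ (C j) - (Dm (d j) φ + C j * φ - φ * C j))
      + (Dm τ (C j) - (Dm (d j) φ + C j * φ - φ * C j))ᵀ * η = 0 := by
    have h1 := congrArg (Dm τ) (hη j)
    rw [Dm_comm (hτ j)] at h1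
    simp only [Dm_add, Dm_mul, Dm_transpose] at h1
    rw [← hφ] at h1
    simp only [Dm_add, Dm_mul, Dm_transpose, hη] at h1
    rw [← sub_eq_zero] at h1
    rw [← neg_eq_zero, ← h1]
    simp only [transpose_add, transpose_sub, transpose_mul]
    noncomm_ring
  have hsplit : connDefect d τ Γ g gi h j = (Dm τ (C j) - (Dm (d j) φ + C j * φ - φ * C j))
      - ∑ k, ∑ l, gi k l • Dm (d k) (curv d C l j) := by
    unfold connDefect; rw [hC, hφ']; abel
  have hfin : η * connDefect d τ Γ g gi h j + (connDefect d τ Γ g gi h j)ᵀ * η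
      = (η * (Dm τ (C j) - (Dm (d j) φ + C j * φ - φ * C j))
      + (Dm τ (C j) - (Dm (d j) φ + C j * φ - φ * C j))ᵀ * η)
      - (η * (∑ k, ∑ l, gi k l • Dm (d k) (curv d C l j))
      + (∑ k, ∑ l, gi k l • Dm (d k) (curv d C l j))ᵀ * η) := by
    rw [hsplit, transpose_sub, Matrix.mul_sub, Matrix.sub_mul]; abel
  rw [hfin, hG, map_sub, hY, map_zero, sub_zero]

/-- The tangential block of φ is H h minus a trace ρ of F. Modulo F only H h remains, but
derivatives of the block also involve ∂ρ, so the exact expression is required. -/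
lemma gauge_trace_eq (hgi : g * gi = 1) (hgs : giᵀ = gi) (hh : hᵀ = h)
    (hR : (ricciMat d Γ g gi)ᵀ = ricciMat d Γ g gi) (a i : ι) :
    (gi * (h * (gi * h) - ricciMat d Γ g gi)) a i = (gi * h).trace * (gi * h) a i
      - ∑ k, ∑ l, gi k l * curv d (bundleConn Γ gi h) i k (Sum.inl a) (Sum.inl l) := by
  have hgi' : gi * g = 1 := mul_eq_one_comm.mp hgi
  have hs : ∀ a b, h a b = h b a := fun a b => congrFun (congrFun hh b) a
  have hgs' : ∀ a b, gi a b = gi b a := fun a b => congrFun (congrFun hgs b) a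
  have e1 : (gi * ricciMat d Γ g gi) a i = ∑ k, ∑ l, gi k l * curv d Γ i k a l := by
    have e2 : ∀ k l, curv d Γ i k a l = ∑ b, gi a b * (g * curv d Γ i k) b l := by
      intro k l
      rw [← mul_apply, ← Matrix.mul_assoc, hgi', Matrix.one_mul]
    have e3 : ∀ b, ricciMat d Γ g gi b i = ricciMat d Γ g gi i b :=
      fun b => congrFun (congrFun hR i) b
    rw [mul_apply]
    simp only [e3, e2]
    simp only [ricciMat, of_apply, Finset.mul_sum]
    rw [Finset.sum_comm]
    refine Finset.sum_congr rfl fun k _ => ?_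
    rw [Finset.sum_comm]
    refine Finset.sum_congr rfl fun l _ => Finset.sum_congr rfl fun b _ => by ring
  have e4 : ∑ k, ∑ l, gi k l * ((gi * h) a i * h k l) = (gi * h).trace * (gi * h) a i := by
    rw [Matrix.trace, Finset.sum_mul]
    refine Finset.sum_congr rfl fun k _ => ?_
    rw [diag_apply, mul_apply (M := gi) (N := h) (i := k), Finset.sum_mul]
    refine Finset.sum_congr rfl fun l _ => ?_
    rw [hs k l]; ring
  have e5 : ∑ k, ∑ l, gi k l * ((gi * h) a k * h i l) = (gi * (h * (gi * h))) a i := by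
    rw [← Matrix.mul_assoc, mul_apply]
    refine Finset.sum_congr rfl fun k _ => ?_
    rw [mul_apply (M := gi) (N := h) (i := k), Finset.mul_sum]
    refine Finset.sum_congr rfl fun l _ => ?_
    rw [hs i l]; ring
  simp only [curv_bundleConn_inl_inl, mul_sub, mul_add, Finset.sum_sub_distrib,
    Finset.sum_add_distrib, e4, e5, ← e1, Matrix.mul_sub, Matrix.sub_apply]
  ring

/-- This is the equation of h. Simons' identity writes Δh as the divergence of the Codazzi defect
plus ∇ div h, which are the corresponding entries of div F and Dφ. The algebraic terms reduce to H
h² on both sides. -/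
lemma map_connDefect_row (hd : ∀ i j x, d i (d j x) = d j (d i x)) {τ : Derivation ℝ A A}
    (L : LeviCivita d g Γ) (hgi : gi * g = 1) (hh : hᵀ = h)
    (hhdot : Dm τ h = hVelocity d Γ g gi h)
    (hF : ∀ i j a b, π (curv d (bundleConn Γ gi h) i j a b) = 0) (j i : ι) :
    π (connDefect d τ Γ g gi h j (Sum.inr ()) (Sum.inl i)) = 0 := by
  have hgs : giᵀ = gi := L.inv_symm hgi
  have hgi' : g * gi = 1 := mul_eq_one_comm.mp hgi
  have hR := map_ricciMat (π := π) hgi' hgs hh hF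
  have hbT : (h * (gi * h))ᵀ = h * (gi * h) := by
    rw [transpose_mul, transpose_mul, hh, hgs, Matrix.mul_assoc]
  have hbbT : (h * (gi * h) * (gi * h))ᵀ = h * (gi * h) * (gi * h) := by
    rw [transpose_mul, hbT, transpose_mul, hh, hgs]; simp only [Matrix.mul_assoc]
  have hRb : π.mapMatrix (ricciMat d Γ g gi * (gi * h)) =
      π.mapMatrix (h * (gi * h) * (gi * h) - (gi * h).trace • (h * (gi * h))) := by
    rw [map_mul, hR, ← map_mul, Matrix.sub_mul, Matrix.smul_mul]
  have hRb1 : π ((ricciMat d Γ g gi * (gi * h)) j i) =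
      π ((h * (gi * h) * (gi * h)) j i - (gi * h).trace * (h * (gi * h)) j i) :=
    congrFun (congrFun hRb j) i
  have hRb2 : π ((ricciMat d Γ g gi * (gi * h)) i j) =
      π ((h * (gi * h) * (gi * h)) j i - (gi * h).trace * (h * (gi * h)) j i) := by
    have h1 : (h * (gi * h) * (gi * h)) j i = (h * (gi * h) * (gi * h)) i j :=
      congrFun (congrFun hbbT i) j
    have h2 : (h * (gi * h)) j i = (h * (gi * h)) i j := congrFun (congrFun hbT i) j
    rw [h1, h2]
    exact congrFun (congrFun hRb i) j
  have hRh : π ((h * (gi * (h * (gi * h) - ricciMat d Γ g gi))) j i) =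
      π ((gi * h).trace * (h * (gi * h)) j i) := by
    have h1 : π.mapMatrix (h * (gi * (h * (gi * h) - ricciMat d Γ g gi)))
        = π.mapMatrix ((gi * h).trace • (h * (gi * h))) := by
      rw [map_mul, map_mul, map_sub, hR, ← map_sub, ← map_mul, ← map_mul, sub_sub_cancel,
        Matrix.mul_smul, Matrix.mul_smul]
    exact congrFun (congrFun h1 j) i
  have e1 : connDefect d τ Γ g gi h j (Sum.inr ()) (Sum.inl i) =
      hVelocity d Γ g gi h j i
      - ∑ l, ∑ k, gi l k * d l (nabla d Γ h k j i - nabla d Γ h j k i)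
      - (d j (divergence d Γ gi h i) + (h * (gi * (h * (gi * h) - ricciMat d Γ g gi))) j i
        - ∑ p, divergence d Γ gi h p * Γ j p i) := by
    unfold connDefect
    simp only [Matrix.sub_apply, Matrix.add_apply, Matrix.sum_apply, Matrix.smul_apply,
      smul_eq_mul, Dm_apply, curv_bundleConn_inr_inl L, ← hhdot]
    simp only [bundleConn, gaugePotential, fromBlocks_multiply, fromBlocks_apply₂₁, of_apply,
      Matrix.add_apply, mul_apply (M := of _), Matrix.zero_mul, Matrix.zero_apply, add_zero]
    rw [mul_apply (M := h)]
  rw [e1]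
  simp only [map_sub, map_add, hRh]
  simp only [hVelocity, Matrix.sub_apply, Matrix.add_apply, map_sub, map_add, transpose_apply,
    map_roughLap hd L hgi hh hF, hRb1, hRb2, Matrix.smul_apply, smul_eq_mul, map_mul, map_ofNat]
  simp only [map_sum, map_sub, map_mul]
  ring

/-- The symbols Γ stay symmetric in time, so only div F and Dφ can contribute torsion. By the two
Bianchi identities the torsion of div F is ∂_jρ_i - ∂_iρ_j, with ρ the trace of F by which φ differs
from H h; the two contributions cancel. -/
lemma map_connDefect_torsion (hd : ∀ i j x, d i (d j x) = d j (d i x)) {τ : Derivation ℝ A A}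
    (L : LeviCivita d g Γ) (hgi : gi * g = 1) (hh : hᵀ = h)
    (hgdot : Dm τ g = gVelocity d Γ g gi h)
    (hF : ∀ i j a b, π (curv d (bundleConn Γ gi h) i j a b) = 0) (j a i : ι) :
    π (connDefect d τ Γ g gi h j (Sum.inl a) (Sum.inl i))
      = π (connDefect d τ Γ g gi h i (Sum.inl a) (Sum.inl j)) := by
  have hgs : giᵀ = gi := L.inv_symm hgi
  have hgi' : g * gi = 1 := mul_eq_one_comm.mp hgi
  have hs : ∀ a b, h a b = h b a := fun a b => congrFun (congrFun hh b) a
  have hR := ricciMat_symm L.symm hgs hh hgdot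
  set F := curv d (bundleConn Γ gi h) with hFdef
  set H := (gi * h).trace with hH
  set ρ : ι → A := fun i => ∑ k, ∑ l, gi k l * F i k (Sum.inl a) (Sum.inl l) with hρ
  have hφ : ∀ b i, (gi * (h * (gi * h) - ricciMat d Γ g gi)) b i = H * (gi * h) b i
      - ∑ k, ∑ l, gi k l * F i k (Sum.inl b) (Sum.inl l) := gauge_trace_eq hgi' hgs hh hR
  have hφπ : ∀ b i, π ((gi * (h * (gi * h) - ricciMat d Γ g gi)) b i)
      = π (H * (gi * h) b i) := fun b i => by
    rw [hφ, map_sub]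
    simp only [map_sum, map_mul, hF, mul_zero, Finset.sum_const_zero, sub_zero]
  have hdρ : ∀ j i, π (d j (ρ i)) = ∑ k, ∑ l, π (gi k l) * π (d j (F i k (Sum.inl a) (Sum.inl l))) := by
    intro j i
    simp only [hρ, map_sum, Derivation.leibniz, smul_eq_mul, map_add, map_mul, hF, zero_mul,
      add_zero]
  -- The first Bianchi identity moves the tangential index into the two-form slots, and the second
  -- one then exchanges ∂_k for ∂_j and ∂_i.
  have hbi : ∀ k l, π (d k (F l j (Sum.inl a) (Sum.inl i))) - π (d k (F l i (Sum.inl a) (Sum.inl j)))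
      = π (d j (F i k (Sum.inl a) (Sum.inl l))) - π (d i (F j k (Sum.inl a) (Sum.inl l))) := by
    intro k l
    have h1 := congrArg (d k) (bundle_bianchi_first (d := d) (gi := gi) L hh i j l a)
    have h2 := congrFun (congrFun (congrArg π.mapMatrix
      (curv_bianchi (C := bundleConn Γ gi h) hd j i k)) (Sum.inl a)) (Sum.inl l)
    have h3 : ∀ i j, π.mapMatrix (F i j) = 0 := fun i j => by ext a b; exact hF i j a b
    rw [← hFdef] at h1 h2
    rw [map_neg] at h2
    simp only [map_add, map_sub, map_mul, h3, Matrix.mul_zero, Matrix.zero_mul, sub_zero, add_zero,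
      neg_zero, Matrix.zero_apply] at h2
    simp only [Matrix.add_apply, RingHom.mapMatrix_apply, map_apply, Dm_apply] at h2
    have h4 : F k j = -F j k := curv_swap _ _
    have h5 := congrArg π h1
    simp only [map_sub, map_neg] at h5
    rw [h4, Matrix.neg_apply, map_neg, map_neg] at h2
    rw [h5]
    linear_combination -h2
  have hcol : π (d j ((gi * h) a i)) + π ((Γ j * (gi * h)) a i)
      = π (d i ((gi * h) a j)) + π ((Γ i * (gi * h)) a j) := by
    have := hF j i (Sum.inl a) (Sum.inr ())
    rw [hFdef, curv_bundleConn_inl_inr] at this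
    simp only [map_sub, map_add] at this
    exact sub_eq_zero.mp this
  have hw := fun i => map_derivation_trace (π := π) L hgi hh hF i
  have e1 : ∀ j i, π (connDefect d τ Γ g gi h j (Sum.inl a) (Sum.inl i)) =
      π (τ (Γ j a i))
      - ∑ k, ∑ l, π (gi k l) * π (d k (F l j (Sum.inl a) (Sum.inl i)))
      - (π H * (π (d j ((gi * h) a i)) + π ((Γ j * (gi * h)) a i))
        + π ((gi * h) a i) * π (divergence d Γ gi h j)
        + π ((gi * h) a j) * π (divergence d Γ gi h i) - π (d j (ρ i))
        - ∑ p, π (H * (gi * h) a p) * π (Γ j p i)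
        - π (∑ c, gi a c * divergence d Γ gi h c) * π (h j i)) := by
    intro j i
    unfold connDefect
    rw [← hFdef]
    simp only [Matrix.sub_apply, Matrix.add_apply, Matrix.sum_apply, Matrix.smul_apply,
      smul_eq_mul, Dm_apply]
    simp only [bundleConn, gaugePotential, fromBlocks_multiply, fromBlocks_apply₁₁, of_apply,
      Matrix.add_apply]
    rw [hφ a i, mul_apply (M := gi * (h * (gi * h) - ricciMat d Γ g gi)) (N := Γ j),
      mul_apply (M := Γ j) (N := gi * (h * (gi * h) - ricciMat d Γ g gi)),
      mul_apply (M := Γ j) (N := gi * h)]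
    simp only [mul_apply (M := of _), Finset.univ_unique, Finset.sum_singleton, of_apply]
    rw [← hw j]
    simp only [map_sub, map_add, map_sum, map_mul, hφπ, Derivation.leibniz, smul_eq_mul,
      mul_add, Finset.mul_sum, hρ]
    have e2 : ∀ x, π (Γ j a x) * (π H * π ((gi * h) x i))
      = π H * (π (Γ j a x) * π ((gi * h) x i)) := fun x => by ring
    simp only [e2]
    ring
  rw [e1, e1]
  have e3 := hdρ j i
  have e4 := hdρ i j
  have e5 : (∑ k, ∑ l, π (gi k l) * π (d k (F l j (Sum.inl a) (Sum.inl i))))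
      - (∑ k, ∑ l, π (gi k l) * π (d k (F l i (Sum.inl a) (Sum.inl j))))
      = π (d j (ρ i)) - π (d i (ρ j)) := by
    rw [e3, e4]
    simp only [← Finset.sum_sub_distrib, ← mul_sub, hbi]
  have t1 : ∀ p, Γ j p i = Γ i p j := fun p => L.torsion j i p
  simp only [t1, hs j i, hcol]
  linear_combination -e5

/-- Along the flow, the bundle connection moves by the divergence of its curvature, up to a gauge
transformation and modulo its curvature. -/
theorem map_connDefect (hd : ∀ i j x, d i (d j x) = d j (d i x)) {τ : Derivation ℝ A A}
    (hτ : ∀ i x, τ (d i x) = d i (τ x)) (L : LeviCivita d g Γ) (hgi : gi * g = 1) (hh : hᵀ = h)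
    (hgdot : Dm τ g = gVelocity d Γ g gi h) (hhdot : Dm τ h = hVelocity d Γ g gi h)
    (hF : ∀ i j a b, π (curv d (bundleConn Γ gi h) i j a b) = 0) (j : ι) :
    π.mapMatrix (connDefect d τ Γ g gi h j) = 0 := by
  have hsk := map_connDefect_skew hd hτ L hgi hh hgdot hF
  have hrow := map_connDefect_row hd L hgi hh hhdot hF
  have htor := map_connDefect_torsion hd L hgi hh hgdot hF
  have hsk' : ∀ j a b, π ((bundleForm g * connDefect d τ Γ g gi h j) a b)
      + π (((connDefect d τ Γ g gi h j)ᵀ * bundleForm g) a b) = 0 := fun j a b => by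
    rw [← map_add, ← Matrix.add_apply]; exact congrFun (congrFun (hsk j) a) b
  have hgiπ : π.mapMatrix gi * π.mapMatrix g = 1 := by rw [← map_mul, hgi, map_one]
  -- Skew and torsion-free, hence zero.
  have htan : ∀ j, (of fun a i => π (connDefect d τ Γ g gi h j (Sum.inl a) (Sum.inl i)) :
      Matrix ι ι Q) = 0 := by
    refine skew_torsion_free_eq_zero (g := π.mapMatrix g) (gi := π.mapMatrix gi) ?_ hgiπ
      (fun j => ?_) fun i j k => htor i k j
    · ext a b; exact congrArg π (congrFun (congrFun L.symm a) b)
    · ext a b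
      have := hsk' j (Sum.inl a) (Sum.inl b)
      rw [mul_apply, mul_apply] at this
      simp only [bundleForm, Fintype.sum_sum_type, fromBlocks_apply₁₁, fromBlocks_apply₁₂,
        fromBlocks_apply₂₁, Matrix.zero_apply, mul_zero, zero_mul, Finset.sum_const_zero,
        add_zero, transpose_apply, map_sum, map_mul] at this
      rw [add_comm] at this
      simpa [mul_apply] using this
  have htan' : ∀ a i, π (connDefect d τ Γ g gi h j (Sum.inl a) (Sum.inl i)) = 0 :=
    fun a i => congrFun (congrFun (htan j) a) i
  -- Skewness pairs the last column, lowered by g, with the bottom row, which is already zero; for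
  -- the corner entry it gives that twice the entry vanishes.
  have hcol : ∀ a, π (connDefect d τ Γ g gi h j (Sum.inl a) (Sum.inr ())) = 0 := by
    have h1 : π.mapMatrix g *ᵥ (fun a => π (connDefect d τ Γ g gi h j (Sum.inl a) (Sum.inr ())))
        = 0 := by
      ext c
      have := hsk' j (Sum.inl c) (Sum.inr ())
      rw [mul_apply, mul_apply] at this
      simp only [bundleForm, Fintype.sum_sum_type, fromBlocks_apply₁₁, fromBlocks_apply₁₂,
        fromBlocks_apply₂₂, Matrix.zero_apply, mul_zero, zero_mul, Finset.sum_const_zero,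
        add_zero, zero_add, transpose_apply, map_sum, map_mul, Finset.univ_unique,
        Finset.sum_singleton, PUnit.default_eq_unit, hrow] at this
      simpa [mulVec, dotProduct] using this
    intro a
    have h2 := congrArg (fun v => (π.mapMatrix gi *ᵥ v) a) h1
    simpa only [mulVec_mulVec, hgiπ, one_mulVec, mulVec_zero, Pi.zero_apply] using h2
  have hnn : π (connDefect d τ Γ g gi h j (Sum.inr ()) (Sum.inr ())) = 0 := by
    have := hsk' j (Sum.inr ()) (Sum.inr ())
    rw [mul_apply, mul_apply] at this
    simp [bundleForm, Fintype.sum_sum_type] at this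
    apply double_cancel
    linear_combination -this
  ext a b
  rcases a with a | a <;> rcases b with b | b
  · exact htan' a b
  · exact hcol a
  · exact hrow j b
  · exact hnn

end Quotient

end DiffRing

/-! ### Evolution of the scalar invariants of a space-like solution -/

section DiffRing

open Matrix

variable {A : Type*} [CommRing A] [Algebra ℝ A] {ι : Type*} [Fintype ι] [DecidableEq ι]
variable {d : ι → Derivation ℝ A A} {g gi h : Matrix ι ι A} {Γ : ι → Matrix ι ι A}

/-- The Laplacian `g^{lk} (∂_l ∂_k u - Γ^p_lk ∂_p u)` of a function. -/
def scalarLap (d : ι → Derivation ℝ A A) (Γ : ι → Matrix ι ι A) (gi : Matrix ι ι A) (u : A) : A :=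
  ∑ l, ∑ k, gi l k * (d l (d k u) - ∑ p, Γ l p k * d p u)

/-- The inner product `g^{lk} ∂_l u ∂_k v` of two gradients. -/
def gradInner (d : ι → Derivation ℝ A A) (gi : Matrix ι ι A) (u v : A) : A :=
  ∑ l, ∑ k, gi l k * (d l u * d k v)

/-- The squared norm of `∇h`. -/
def nablaSq (d : ι → Derivation ℝ A A) (Γ : ι → Matrix ι ι A) (gi h : Matrix ι ι A) : A :=
  ∑ l, ∑ k, gi l k * (gi * nabla d Γ h l * (gi * nabla d Γ h k)).trace

/-- The truncated exponents are harmless: the coefficients m and m(m - 1) vanish whenever a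
truncation takes effect. -/
lemma scalarLap_pow (u : A) (m : ℕ) :
    scalarLap d Γ gi (u ^ m) = m * u ^ (m - 1) * scalarLap d Γ gi u
      + m * ((m - 1 : ℕ) : A) * u ^ (m - 2) * gradInner d gi u u := by
  simp only [scalarLap, gradInner, Finset.mul_sum, ← Finset.sum_add_distrib]
  refine Finset.sum_congr rfl fun l _ => Finset.sum_congr rfl fun k _ => ?_
  have e1 : ∀ p, Γ l p k * d p (u ^ m) = m * u ^ (m - 1) * (Γ l p k * d p u) := fun p => by
    rw [Derivation.leibniz_pow]; simp only [nsmul_eq_mul, smul_eq_mul]; ring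
  have e2 : d l (d k (u ^ m)) = m * u ^ (m - 1) * d l (d k u)
      + m * ((m - 1 : ℕ) : A) * u ^ (m - 2) * (d l u * d k u) := by
    rw [Derivation.leibniz_pow]
    simp only [nsmul_eq_mul, smul_eq_mul, Derivation.leibniz, Derivation.leibniz_pow,
      Derivation.map_natCast, Nat.sub_sub, mul_zero, add_zero]
    ring
  simp only [e1, e2, ← Finset.mul_sum]
  ring

/-- The derivative of a determinant. -/
lemma derivation_det (D : Derivation ℝ A A) (hgi : gi * g = 1) :
    D g.det = g.det * (gi * Dm D g).trace := by
  -- The Leibniz rule says precisely that x ↦ x + ε D x is a ring homomorphism into the dual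
  -- numbers. It commutes with determinants, so D(det g) is the ε-part of det(g (1 + ε g⁻¹ Dg)).
  let φ : A →+* DualNumber A :=
    { toFun := fun x => TrivSqZeroExt.inl x + TrivSqZeroExt.inr (D x)
      map_one' := by simp
      map_zero' := by simp
      map_add' := fun x y => by ext <;> simp
      map_mul' := fun x y => by ext <;> simp [mul_comm] }
  let ψ : A →+* DualNumber A := TrivSqZeroExt.inlHom A A
  have hε : (DualNumber.eps : DualNumber A) ^ 2 = 0 := by rw [sq, DualNumber.eps_mul_eps]
  have h1 : φ.mapMatrix g = ψ.mapMatrix g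
      * (1 + (DualNumber.eps : DualNumber A) • ψ.mapMatrix (gi * Dm D g)) := by
    rw [Matrix.mul_add, Matrix.mul_one, Matrix.mul_smul, ← map_mul, ← Matrix.mul_assoc,
      mul_eq_one_comm.mp hgi, Matrix.one_mul]
    ext a b <;> simp [φ, ψ]
  have h2 := congrArg Matrix.det h1
  rw [det_mul, det_one_add_smul, hε, mul_zero, add_zero, ← RingHom.map_det, ← RingHom.map_det]
    at h2
  have h3 := congrArg TrivSqZeroExt.snd h2
  have h4 : (ψ.mapMatrix (gi * Dm D g)).trace = ψ (gi * Dm D g).trace := by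
    simp only [Matrix.trace, diag, map_sum, RingHom.mapMatrix_apply, map_apply]
  rw [h4] at h3
  simpa [φ, ψ] using h3

lemma derivation_sqrt_det (D : Derivation ℝ A A) (hgi : gi * g = 1) {w wi : A}
    (hw : w * w = g.det) (hwi : w * wi = 1) :
    2 * D w = w * (gi * Dm D g).trace := by
  have h1 := derivation_det D hgi
  rw [← hw, Derivation.leibniz] at h1
  simp only [smul_eq_mul] at h1
  linear_combination wi * h1 + (w * (gi * Dm D g).trace - 2 * D w) * hwi

lemma derivation_vol (L : LeviCivita d g Γ) (hgi : gi * g = 1) {w wi : A}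
    (hw : w * w = g.det) (hwi : w * wi = 1) (i : ι) : d i w = w * ∑ k, Γ i k k := by
  have h1 := derivation_sqrt_det (d i) hgi hw hwi
  rw [L.compat, Matrix.mul_add, trace_add, ← Matrix.mul_assoc gi g, hgi, Matrix.one_mul,
    ← Matrix.mul_assoc, trace_mul_comm, ← Matrix.mul_assoc, mul_eq_one_comm.mp hgi, Matrix.one_mul,
    trace_transpose] at h1
  rw [← sub_eq_zero]
  apply double_cancel
  simp only [Matrix.trace, diag] at h1
  linear_combination h1

/-- The Laplacian in divergence form. -/
lemma vol_mul_scalarLap (L : LeviCivita d g Γ) (hgi : gi * g = 1) {w wi : A}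
    (hw : w * w = g.det) (hwi : w * wi = 1) (u : A) :
    w * scalarLap d Γ gi u = ∑ l, d l (w * ∑ k, gi l k * d k u) := by
  have e1 : ∀ l k, d l (gi l k) = -∑ p, Γ l l p * gi p k - ∑ p, gi l p * Γ l k p := fun l k => by
    have := congrFun (congrFun (L.compat_inv hgi l) l) k
    simpa [mul_apply] using this
  -- Differentiating the density gives Γ^p_lp. By torsion-freeness its contraction cancels one of
  -- the two terms from the derivative of g⁻¹; the other is the first-order term of the Laplacian.
  have e2 : ∑ l, (∑ p, Γ l p p) * ∑ k, gi l k * d k u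
      = ∑ l, ∑ k, (∑ p, Γ l l p * gi p k) * d k u := by
    simp only [Finset.sum_mul, Finset.mul_sum]
    calc _ = ∑ l, ∑ p, ∑ k, Γ l p p * (gi l k * d k u) :=
        Finset.sum_congr rfl fun _ _ => Finset.sum_comm
      _ = ∑ p, ∑ l, ∑ k, Γ l p p * (gi l k * d k u) := Finset.sum_comm
      _ = ∑ p, ∑ k, ∑ l, Γ l p p * (gi l k * d k u) :=
        Finset.sum_congr rfl fun _ _ => Finset.sum_comm
      _ = _ := Finset.sum_congr rfl fun _ _ => Finset.sum_congr rfl fun _ _ =>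
        Finset.sum_congr rfl fun _ _ => by rw [L.torsion]; ring
  have e3 : ∀ l, d l (w * ∑ k, gi l k * d k u) = w * ((∑ p, Γ l p p) * ∑ k, gi l k * d k u
      - ∑ k, (∑ p, Γ l l p * gi p k) * d k u
      + (∑ k, gi l k * d l (d k u) - ∑ k, (∑ p, gi l p * Γ l k p) * d k u)) := by
    intro l
    rw [Derivation.leibniz, derivation_vol L hgi hw hwi]
    simp only [map_sum, Derivation.leibniz, smul_eq_mul, e1, Finset.sum_add_distrib]
    have : ∑ k, d k u * (-∑ p, Γ l l p * gi p k - ∑ p, gi l p * Γ l k p)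
        = -∑ k, (∑ p, Γ l l p * gi p k) * d k u - ∑ k, (∑ p, gi l p * Γ l k p) * d k u := by
      rw [← Finset.sum_neg_distrib, ← Finset.sum_sub_distrib]
      exact Finset.sum_congr rfl fun k _ => by ring
    rw [this]; ring
  have e4 : ∀ l, ∑ k, gi l k * (d l (d k u) - ∑ p, Γ l p k * d p u)
      = ∑ k, gi l k * d l (d k u) - ∑ k, (∑ p, gi l p * Γ l k p) * d k u := by
    intro l
    simp only [mul_sub, Finset.sum_sub_distrib, Finset.mul_sum, Finset.sum_mul]
    congr 1
    rw [Finset.sum_comm]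
    exact Finset.sum_congr rfl fun _ _ => Finset.sum_congr rfl fun _ _ => by ring
  simp only [e3, ← Finset.mul_sum, scalarLap, e4, Finset.sum_add_distrib, Finset.sum_sub_distrib,
    e2]
  ring

/-- On mixed tensors the connection acts by commutators, which drop out of the trace of a product.
-/
lemma derivation_trace₂ (L : LeviCivita d g Γ) (hgi : gi * g = 1) (X Y : Matrix ι ι A) (i : ι) :
    d i (gi * X * (gi * Y)).trace = (gi * nabla d Γ X i * (gi * Y)).trace
      + (gi * X * (gi * nabla d Γ Y i)).trace := by
  have e1 : ∀ X, Dm (d i) (gi * X) = gi * nabla d Γ X i + (gi * X * Γ i - Γ i * (gi * X)) := by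
    intro X
    rw [Dm_mul, L.compat_inv hgi, nabla]
    noncomm_ring
  rw [Dm_trace, Dm_mul, e1, e1, trace_add, Matrix.add_mul, Matrix.mul_add, trace_add, trace_add,
    Matrix.sub_mul, Matrix.mul_sub, trace_sub, trace_sub]
  have e2 : (Γ i * (gi * X) * (gi * Y)).trace = (gi * X * (gi * Y * Γ i)).trace := by
    rw [Matrix.mul_assoc, trace_mul_comm, Matrix.mul_assoc]
  have e3 : (gi * X * Γ i * (gi * Y)).trace = (gi * X * (Γ i * (gi * Y))).trace := by
    rw [Matrix.mul_assoc (gi * X)]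
  rw [e2, e3]; ring

lemma trace_roughLap (L : LeviCivita d g Γ) (hgi : gi * g = 1) :
    (gi * roughLap d Γ gi h).trace = scalarLap d Γ gi (gi * h).trace := by
  have e1 : ∀ l i, (gi * nabla₂ d Γ h l i).trace = d l (d i (gi * h).trace)
      - ∑ p, Γ l p i * d p (gi * h).trace := by
    intro l i
    simp only [derivation_trace L hgi]
    rw [nabla₂, ← nabla, Matrix.mul_sub, trace_sub, Finset.mul_sum, trace_sum]
    simp only [Matrix.mul_smul, trace_smul, smul_eq_mul]
  simp only [roughLap, scalarLap, Finset.mul_sum, trace_sum, Matrix.mul_smul, trace_smul, e1,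
    smul_eq_mul]

/-- The Bochner identity Δ|h|² = 2⟨h, Δh⟩ + 2|∇h|². -/
lemma scalarLap_normSq (L : LeviCivita d g Γ) (hgi : gi * g = 1) :
    scalarLap d Γ gi (gi * h * (gi * h)).trace
      = 2 * (gi * h * (gi * roughLap d Γ gi h)).trace + 2 * nablaSq d Γ gi h := by
  have e0 : ∀ i, d i (gi * h * (gi * h)).trace = 2 * (gi * h * (gi * nabla d Γ h i)).trace := by
    intro i
    rw [derivation_trace₂ L hgi, trace_mul_comm (gi * nabla d Γ h i)]; ring
  have e1 : ∀ l i, d l (d i (gi * h * (gi * h)).trace)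
      - ∑ p, Γ l p i * d p (gi * h * (gi * h)).trace
      = 2 * (gi * h * (gi * nabla₂ d Γ h l i)).trace
        + 2 * (gi * nabla d Γ h l * (gi * nabla d Γ h i)).trace := by
    intro l i
    simp only [e0, Derivation.leibniz, smul_eq_mul, derivation_trace₂ L hgi]
    have e2 : d l (2 : A) = 0 := (d l).map_natCast 2
    rw [nabla₂, ← nabla, Matrix.mul_sub, Matrix.mul_sub, trace_sub, Finset.mul_sum,
      Finset.mul_sum, trace_sum, e2]
    simp only [Matrix.mul_smul, trace_smul, smul_eq_mul, mul_sub, Finset.mul_sum]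
    have e3 : ∀ p, Γ l p i * (2 * (gi * h * (gi * nabla d Γ h p)).trace)
      = 2 * (Γ l p i * (gi * h * (gi * nabla d Γ h p)).trace) := fun p => by ring
    simp only [e3]
    ring
  simp only [scalarLap, e1, nablaSq, roughLap, Finset.mul_sum, trace_sum, Matrix.mul_smul,
    trace_smul, smul_eq_mul, ← Finset.sum_add_distrib]
  exact Finset.sum_congr rfl fun _ _ => Finset.sum_congr rfl fun _ _ => by ring

/-! ### Evolution equations when the bundle connection is flat -/

section Spacelike

variable {τ : Derivation ℝ A A}

/-- Since F is now zero in the ring itself, the congruences modulo F become equalities on taking the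
identity for the quotient map. -/
lemma gVelocity_spacelike (L : LeviCivita d g Γ) (hgi : gi * g = 1) (hh : hᵀ = h)
    (hF : ∀ i j, curv d (bundleConn Γ gi h) i j = 0) :
    gVelocity d Γ g gi h = (2 * (gi * h).trace) • h := by
  have hR : ricciMat d Γ g gi = h * (gi * h) - (gi * h).trace • h := by
    simpa using map_ricciMat (π := RingHom.id A) (mul_eq_one_comm.mp hgi) (L.inv_symm hgi) hh
      (fun i j a b => by rw [hF]; simp)
  rw [gVelocity, hR]
  ext a b
  simp only [Matrix.add_apply, Matrix.sub_apply, Matrix.smul_apply, smul_eq_mul]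
  ring

lemma hVelocity_spacelike (L : LeviCivita d g Γ) (hgi : gi * g = 1) (hh : hᵀ = h)
    (hF : ∀ i j, curv d (bundleConn Γ gi h) i j = 0) :
    hVelocity d Γ g gi h = roughLap d Γ gi h + (2 * (gi * h).trace) • (h * (gi * h))
      - (gi * h * (gi * h)).trace • h := by
  have hgs := L.inv_symm hgi
  have hR : ricciMat d Γ g gi = h * (gi * h) - (gi * h).trace • h := by
    simpa using map_ricciMat (π := RingHom.id A) (mul_eq_one_comm.mp hgi) hgs hh
      (fun i j a b => by rw [hF]; simp)
  have hbT : (h * (gi * h))ᵀ = h * (gi * h) := by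
    rw [transpose_mul, transpose_mul, hh, hgs, Matrix.mul_assoc]
  have hbbT : (h * (gi * h) * (gi * h))ᵀ = h * (gi * h) * (gi * h) := by
    rw [transpose_mul, hbT, transpose_mul, hh, hgs]; simp only [Matrix.mul_assoc]
  rw [hVelocity, hR, Matrix.sub_mul, Matrix.smul_mul, transpose_sub, transpose_smul, hbT, hbbT]
  ext a b
  simp only [Matrix.add_apply, Matrix.sub_apply, Matrix.smul_apply, smul_eq_mul]
  ring

lemma evolution_vol (L : LeviCivita d g Γ) (hgi : gi * g = 1) (hh : hᵀ = h)
    (hgdot : Dm τ g = gVelocity d Γ g gi h)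
    (hF : ∀ i j, curv d (bundleConn Γ gi h) i j = 0) {w wi : A}
    (hw : w * w = g.det) (hwi : w * wi = 1) :
    τ w = w * (gi * h).trace ^ 2 := by
  have h1 := derivation_sqrt_det τ hgi hw hwi
  rw [hgdot, gVelocity_spacelike L hgi hh hF, Matrix.mul_smul, trace_smul, smul_eq_mul] at h1
  rw [← sub_eq_zero]
  apply double_cancel
  linear_combination h1

/-- With one index raised the quadratic reaction term disappears: 2H h² in ∂_t h is compensated by
the derivative of g⁻¹. The equations for H and |A|² are traces of this one. -/
lemma evolution_mixed (L : LeviCivita d g Γ) (hgi : gi * g = 1) (hh : hᵀ = h)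
    (hgdot : Dm τ g = gVelocity d Γ g gi h) (hhdot : Dm τ h = hVelocity d Γ g gi h)
    (hF : ∀ i j, curv d (bundleConn Γ gi h) i j = 0) :
    Dm τ (gi * h) = gi * roughLap d Γ gi h - (gi * h * (gi * h)).trace • (gi * h) := by
  rw [Dm_mul, Dm_of_mul_eq_one _ hgi, hgdot, hhdot, gVelocity_spacelike L hgi hh hF,
    hVelocity_spacelike L hgi hh hF, Matrix.mul_sub, Matrix.mul_add, Matrix.mul_smul,
    Matrix.mul_smul, Matrix.mul_smul, Matrix.smul_mul, Matrix.neg_mul, Matrix.smul_mul,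
    Matrix.mul_assoc gi h gi, Matrix.mul_assoc gi (h * gi) h, Matrix.mul_assoc h gi h]
  abel

lemma evolution_meanCurv (L : LeviCivita d g Γ) (hgi : gi * g = 1) (hh : hᵀ = h)
    (hgdot : Dm τ g = gVelocity d Γ g gi h) (hhdot : Dm τ h = hVelocity d Γ g gi h)
    (hF : ∀ i j, curv d (bundleConn Γ gi h) i j = 0) :
    τ (gi * h).trace = scalarLap d Γ gi (gi * h).trace
      - (gi * h * (gi * h)).trace * (gi * h).trace := by
  rw [Dm_trace, evolution_mixed L hgi hh hgdot hhdot hF, trace_sub, trace_smul, smul_eq_mul,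
    trace_roughLap L hgi]

lemma evolution_normSq (L : LeviCivita d g Γ) (hgi : gi * g = 1) (hh : hᵀ = h)
    (hgdot : Dm τ g = gVelocity d Γ g gi h) (hhdot : Dm τ h = hVelocity d Γ g gi h)
    (hF : ∀ i j, curv d (bundleConn Γ gi h) i j = 0) :
    τ (gi * h * (gi * h)).trace = scalarLap d Γ gi (gi * h * (gi * h)).trace
      - 2 * nablaSq d Γ gi h - 2 * (gi * h * (gi * h)).trace ^ 2 := by
  rw [Dm_trace, Dm_mul, trace_add, trace_mul_comm (Dm τ (gi * h)),
    evolution_mixed L hgi hh hgdot hhdot hF, scalarLap_normSq L hgi, Matrix.mul_sub, trace_sub,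
    Matrix.mul_smul, trace_smul, smul_eq_mul]
  ring

/-- Evolution of the density `H ^ n dv`. -/
lemma evolution_meanCurv_pow_vol (L : LeviCivita d g Γ) (hgi : gi * g = 1) (hh : hᵀ = h)
    (hgdot : Dm τ g = gVelocity d Γ g gi h) (hhdot : Dm τ h = hVelocity d Γ g gi h)
    (hF : ∀ i j, curv d (bundleConn Γ gi h) i j = 0) {w wi : A}
    (hw : w * w = g.det) (hwi : w * wi = 1) {n : ℕ} (hn : 0 < n) :
    τ ((gi * h).trace ^ n * w) =
      ∑ l, d l (w * ∑ k, gi l k * d k ((gi * h).trace ^ n))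
      - w * (n * ((n - 1 : ℕ) : A) * (gradInner d gi (gi * h).trace (gi * h).trace
          * (gi * h).trace ^ (n - 2))
        + (gi * h).trace ^ n * (n * (gi * h * (gi * h)).trace - (gi * h).trace ^ 2)) := by
  rw [← vol_mul_scalarLap L hgi hw hwi, scalarLap_pow, Derivation.leibniz,
    Derivation.leibniz_pow, evolution_meanCurv L hgi hh hgdot hhdot hF,
    evolution_vol L hgi hh hgdot hF hw hwi]
  obtain ⟨m, rfl⟩ : ∃ m, n = m + 1 := ⟨n - 1, by omega⟩
  simp only [smul_eq_mul, nsmul_eq_mul, Nat.add_sub_cancel]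
  ring

/-- Evolution of the density `|A| ^ (2 m) dv`. -/
lemma evolution_normSq_pow_vol (L : LeviCivita d g Γ) (hgi : gi * g = 1) (hh : hᵀ = h)
    (hgdot : Dm τ g = gVelocity d Γ g gi h) (hhdot : Dm τ h = hVelocity d Γ g gi h)
    (hF : ∀ i j, curv d (bundleConn Γ gi h) i j = 0) {w wi : A}
    (hw : w * w = g.det) (hwi : w * wi = 1) {m : ℕ} (hm : 0 < m) :
    τ ((gi * h * (gi * h)).trace ^ m * w) =
      ∑ l, d l (w * ∑ k, gi l k * d k ((gi * h * (gi * h)).trace ^ m))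
      - w * (m * ((m - 1 : ℕ) : A) * ((gi * h * (gi * h)).trace ^ (m - 2)
          * gradInner d gi (gi * h * (gi * h)).trace (gi * h * (gi * h)).trace)
        + 2 * m * ((gi * h * (gi * h)).trace ^ (m - 1) * nablaSq d Γ gi h)
        + (gi * h * (gi * h)).trace ^ m
          * (2 * m * (gi * h * (gi * h)).trace - (gi * h).trace ^ 2)) := by
  rw [← vol_mul_scalarLap L hgi hw hwi, scalarLap_pow, Derivation.leibniz,
    Derivation.leibniz_pow, evolution_normSq L hgi hh hgdot hhdot hF,
    evolution_vol L hgi hh hgdot hF hw hwi]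
  obtain ⟨k, rfl⟩ : ∃ k, m = k + 1 := ⟨m - 1, by omega⟩
  simp only [smul_eq_mul, nsmul_eq_mul, Nat.add_sub_cancel]
  ring

end Spacelike

end DiffRing

/-! ### The differential ring of smooth functions on a set -/

section SmoothFn

open Matrix

variable {V : Type*} [NormedAddCommGroup V] [NormedSpace ℝ V] {S : Set V}

open Classical in
/-- Extension by zero of a function on a subset. -/
noncomputable def extend (f : S → ℝ) (p : V) : ℝ := if h : p ∈ S then f ⟨p, h⟩ else 0

lemma extend_of_mem (f : S → ℝ) {p : V} (hp : p ∈ S) : extend f p = f ⟨p, hp⟩ := by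
  simp [extend, hp]

/-- The algebra of functions on `S` that are smooth within `S`. -/
def smoothSubalgebra (S : Set V) : Subalgebra ℝ (S → ℝ) where
  carrier := {f | ContDiffOn ℝ ∞ (extend f) S}
  mul_mem' {f g} hf hg := (ContDiffOn.mul hf hg).congr fun p hp => by simp [extend_of_mem _ hp]
  add_mem' {f g} hf hg := (ContDiffOn.add hf hg).congr fun p hp => by simp [extend_of_mem _ hp]
  algebraMap_mem' r := (contDiffOn_const (c := r)).congr fun p hp => by simp [extend_of_mem _ hp]

/-- The ring of functions on `S` that are smooth within `S`. -/
def SmoothFn (S : Set V) : Type _ := smoothSubalgebra S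

namespace SmoothFn

noncomputable instance : CommRing (SmoothFn S) := inferInstanceAs (CommRing (smoothSubalgebra S))

noncomputable instance : Algebra ℝ (SmoothFn S) :=
  inferInstanceAs (Algebra ℝ (smoothSubalgebra S))

/-- The value at a point, zero off `S`. -/
noncomputable def ev (f : SmoothFn S) (p : V) : ℝ := extend f.1 p

lemma contDiffOn (f : SmoothFn S) : ContDiffOn ℝ ∞ f.ev S := f.2

/-- A function smooth within `S`, as an element of the ring. -/
def of (F : V → ℝ) (hF : ContDiffOn ℝ ∞ F S) : SmoothFn S :=
  ⟨fun p => F p, hF.congr fun p hp => by simp [extend_of_mem _ hp]⟩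

lemma ev_of {F : V → ℝ} (hF : ContDiffOn ℝ ∞ F S) {p : V} (hp : p ∈ S) : (of F hF).ev p = F p := by
  simp [ev, of, extend_of_mem _ hp]

lemma ext_ev {f g : SmoothFn S} (h : ∀ p ∈ S, f.ev p = g.ev p) : f = g := by
  apply Subtype.ext
  funext ⟨p, hp⟩
  have := h p hp
  simpa [ev, extend_of_mem _ hp] using this

/-- Evaluation at a point of `S`. -/
noncomputable def evalAt {p : V} (hp : p ∈ S) : SmoothFn S →ₐ[ℝ] ℝ :=
  (Pi.evalAlgHom ℝ (fun _ : S => ℝ) ⟨p, hp⟩).comp (smoothSubalgebra S).val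

lemma evalAt_eq {p : V} (hp : p ∈ S) (f : SmoothFn S) : evalAt hp f = f.ev p := by
  rw [ev, extend_of_mem _ hp]; rfl

/-- The derivative in the direction `v`. -/
noncomputable def der (hS : UniqueDiffOn ℝ S) (v : V) :
    Derivation ℝ (SmoothFn S) (SmoothFn S) where
  toFun f := of (fun p => fderivWithin ℝ f.ev S p v)
    ((f.contDiffOn.fderivWithin hS (m := ∞) (by norm_cast)).clm_apply contDiffOn_const)
  map_add' f g := by
    refine ext_ev fun p hp => ?_
    have h1 : fderivWithin ℝ (f + g).ev S p = fderivWithin ℝ (f.ev + g.ev) S p :=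
      fderivWithin_congr (fun q hq => by simp [← evalAt_eq hq])
        (by simp [← evalAt_eq hp])
    rw [← evalAt_eq hp (_ + _), map_add, evalAt_eq hp, evalAt_eq hp, ev_of _ hp, ev_of _ hp,
      ev_of _ hp, h1, fderivWithin_add (hS p hp)
        (f.contDiffOn.differentiableOn (by norm_num) p hp)
        (g.contDiffOn.differentiableOn (by norm_num) p hp)]
    rfl
  map_smul' c f := by
    refine ext_ev fun p hp => ?_
    have h1 : fderivWithin ℝ (c • f).ev S p = fderivWithin ℝ (c • f.ev) S p :=
      fderivWithin_congr (fun q hq => by simp [← evalAt_eq hq])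
        (by simp [← evalAt_eq hp])
    rw [RingHom.id_apply, ← evalAt_eq hp (_ • _), map_smul, evalAt_eq hp, ev_of _ hp, ev_of _ hp,
      h1, fderivWithin_const_smul (hS p hp)
        (f.contDiffOn.differentiableOn (by norm_num) p hp)]
    rfl
  map_one_eq_zero' := by
    refine ext_ev fun p hp => ?_
    have h1 : fderivWithin ℝ (1 : SmoothFn S).ev S p = fderivWithin ℝ (fun _ => (1 : ℝ)) S p :=
      fderivWithin_congr (fun q hq => by simp [← evalAt_eq hq])
        (by simp [← evalAt_eq hp])
    rw [← evalAt_eq hp 0, map_zero]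
    simp only [LinearMap.coe_mk, AddHom.coe_mk]
    rw [ev_of _ hp, h1]
    simp
  leibniz' f g := by
    refine ext_ev fun p hp => ?_
    have h1 : fderivWithin ℝ (f * g).ev S p = fderivWithin ℝ (f.ev * g.ev) S p :=
      fderivWithin_congr (fun q hq => by simp [← evalAt_eq hq])
        (by simp [← evalAt_eq hp])
    simp only [LinearMap.coe_mk, AddHom.coe_mk]
    rw [← evalAt_eq hp (_ + _), map_add, smul_eq_mul, smul_eq_mul, map_mul, map_mul,
      evalAt_eq hp, evalAt_eq hp, evalAt_eq hp, evalAt_eq hp,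
      ev_of _ hp, ev_of _ hp, ev_of _ hp, h1, fderivWithin_mul (hS p hp)
        (f.contDiffOn.differentiableOn (by norm_num) p hp)
        (g.contDiffOn.differentiableOn (by norm_num) p hp)]
    simp

variable {hS : UniqueDiffOn ℝ S}

lemma ev_der (v : V) (f : SmoothFn S) {p : V} (hp : p ∈ S) :
    (der hS v f).ev p = fderivWithin ℝ f.ev S p v := by
  change (of _ _).ev p = _
  rw [ev_of _ hp]

/-- At boundary times the derivatives are taken within S. Their symmetry follows by continuity from
interior points, hence the hypothesis that S lies in the closure of its interior. -/
lemma der_comm (hS' : S ⊆ closure (interior S)) (v w : V) (f : SmoothFn S) :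
    der hS v (der hS w f) = der hS w (der hS v f) := by
  refine ext_ev fun p hp => ?_
  have key : ∀ v w : V, (der hS v (der hS w f)).ev p
      = fderivWithin ℝ (fderivWithin ℝ f.ev S) S p v w := by
    intro v w
    have h1 : fderivWithin ℝ (der hS w f).ev S p
        = fderivWithin ℝ (fun q => fderivWithin ℝ f.ev S q w) S p :=
      fderivWithin_congr (fun q hq => ev_der w f hq) (ev_der w f hp)
    have h2 : DifferentiableWithinAt ℝ (fderivWithin ℝ f.ev S) S p :=
      (f.contDiffOn.fderivWithin hS (m := ∞) (by norm_cast)).differentiableOn (by norm_num) p hp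
    rw [ev_der v _ hp, h1, fderivWithin_clm_apply (hS p hp) h2 (differentiableWithinAt_const w)]
    simp
  rw [key, key]
  exact ((f.contDiffOn p hp).isSymmSndFDerivWithinAt (by simp; norm_cast) hS (hS' hp) hp) v w

lemma exists_inverse (f : SmoothFn S) (hf : ∀ p ∈ S, f.ev p ≠ 0) :
    ∃ f' : SmoothFn S, f * f' = 1 := by
  refine ⟨of (fun p => (f.ev p)⁻¹) (f.contDiffOn.inv hf), ext_ev fun p hp => ?_⟩
  rw [← evalAt_eq hp, ← evalAt_eq hp, map_mul, evalAt_eq hp, evalAt_eq hp, ev_of _ hp, map_one,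
    mul_inv_cancel₀ (hf p hp)]

/-- The square root of a positive function. -/
noncomputable def sqrt (f : SmoothFn S) (hf : ∀ p ∈ S, 0 < f.ev p) : SmoothFn S :=
  of (fun p => Real.sqrt (f.ev p)) (f.contDiffOn.sqrt fun p hp => (hf p hp).ne')

lemma sqrt_mul_sqrt (f : SmoothFn S) (hf : ∀ p ∈ S, 0 < f.ev p) : f.sqrt hf * f.sqrt hf = f := by
  refine ext_ev fun p hp => ?_
  rw [← evalAt_eq hp, map_mul, evalAt_eq hp, sqrt, ev_of _ hp, Real.mul_self_sqrt (hf p hp).le]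

end SmoothFn

end SmoothFn

/-! ### Time intervals that may contain end points -/

section Interval

lemma subset_closure_interior_of_ordConnected {J : Set ℝ} (hJ : J.OrdConnected)
    (hJn : J.Nontrivial) : J ⊆ closure (interior J) ∧ UniqueDiffOn ℝ J := by
  have hc : Convex ℝ J := hJ.convex
  obtain ⟨a, ha, b, hb, hab⟩ := hJn.exists_lt
  have hne : (interior J).Nonempty := by
    refine ⟨(a + b) / 2, interior_mono (hJ.out ha hb) ?_⟩
    rw [interior_Icc]; constructor <;> linarith
  refine ⟨?_, uniqueDiffOn_convex hc hne⟩
  rw [hc.closure_interior_eq_closure_of_nonempty_interior hne]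
  exact subset_closure

end Interval

namespace SmoothFn

variable {E : Type*} [NormedAddCommGroup E] [NormedSpace ℝ E] {J : Set ℝ} {U : Set E}
  {hS : UniqueDiffOn ℝ (J ×ˢ U)}

lemma hasFDerivWithinAt_ev (f : SmoothFn (J ×ˢ U)) {t : ℝ} {y : E} (ht : t ∈ J) (hy : y ∈ U) :
    HasFDerivWithinAt f.ev (fderivWithin ℝ f.ev (J ×ˢ U) (t, y)) (J ×ˢ U) (t, y) :=
  (f.contDiffOn.differentiableOn (by norm_num) _ ⟨ht, hy⟩).hasFDerivWithinAt

lemma hasFDerivAt_slice (hU : IsOpen U) (f : SmoothFn (J ×ˢ U)) {φ : E → ℝ} {t : ℝ}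
    (ht : t ∈ J) (hφ : ∀ z ∈ U, φ z = f.ev (t, z)) {y : E} (hy : y ∈ U) :
    HasFDerivAt φ ((fderivWithin ℝ f.ev (J ×ˢ U) (t, y)).comp (ContinuousLinearMap.inr ℝ ℝ E))
      y := by
  have h1 : HasFDerivWithinAt (fun z : E => (t, z)) (ContinuousLinearMap.inr ℝ ℝ E) U y :=
    (hasFDerivAt_prodMk_right t y).hasFDerivWithinAt
  have h2 := (hasFDerivWithinAt_ev f ht hy).comp y h1 fun z hz => ⟨ht, hz⟩
  refine (h2.hasFDerivAt (hU.mem_nhds hy)).congr_of_eventuallyEq ?_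
  filter_upwards [hU.mem_nhds hy] with z hz using hφ z hz

lemma fderiv_slice (hU : IsOpen U) (f : SmoothFn (J ×ˢ U)) {φ : E → ℝ} {t : ℝ}
    (ht : t ∈ J) (hφ : ∀ z ∈ U, φ z = f.ev (t, z)) {y : E} (hy : y ∈ U) (v : E) :
    fderiv ℝ φ y v = (der hS (0, v) f).ev (t, y) := by
  rw [(hasFDerivAt_slice hU f ht hφ hy).fderiv, ev_der _ _ (mk_mem_prod ht hy)]
  rfl

lemma hasDerivWithinAt_time (f : SmoothFn (J ×ˢ U)) {φ : ℝ → ℝ} {t : ℝ} {y : E}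
    (ht : t ∈ J) (hy : y ∈ U) (hφ : ∀ s ∈ J, φ s = f.ev (s, y)) :
    HasDerivWithinAt φ ((der hS (1, 0) f).ev (t, y)) J t := by
  have h1 : HasFDerivWithinAt (fun s : ℝ => (s, y)) (ContinuousLinearMap.inl ℝ ℝ E) J t :=
    (hasFDerivAt_prodMk_left t y).hasFDerivWithinAt
  have h2 := (hasFDerivWithinAt_ev f ht hy).comp t h1 fun s hs => mk_mem_prod hs hy
  have h3 := h2.hasDerivWithinAt
  rw [ev_der _ _ (mk_mem_prod ht hy)]
  exact h3.congr (fun s hs => hφ s hs) (hφ t ht)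

end SmoothFn

/-! ### Coordinate expressions as elements of the differential ring -/

section Bridge

open Matrix SmoothFn

variable {n : ℕ} {J : Set ℝ} {U : Set (EuclideanSpace ℝ (Fin n))}

/-- The coordinate derivations. -/
noncomputable def dd (hS : UniqueDiffOn ℝ (J ×ˢ U)) (i : Fin n) :
    Derivation ℝ (SmoothFn (J ×ˢ U)) (SmoothFn (J ×ˢ U)) :=
  der hS (0, EuclideanSpace.single i 1)

/-- The time derivation. -/
noncomputable def dt (hS : UniqueDiffOn ℝ (J ×ˢ U)) :
    Derivation ℝ (SmoothFn (J ×ˢ U)) (SmoothFn (J ×ˢ U)) :=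
  der hS (1, 0)

/-- Christoffel symbols in a differential ring. -/
noncomputable def koszul {A ι : Type*} [CommRing A] [Algebra ℝ A] [Fintype ι]
    (d : ι → Derivation ℝ A A) (g gi : Matrix ι ι A) (i : ι) : Matrix ι ι A :=
  of fun k j => (1 / 2 : ℝ) • ∑ l, gi k l * (d i (g j l) + d j (g i l) - d l (g i j))

lemma leviCivita_koszul {A ι : Type*} [CommRing A] [Algebra ℝ A] [Fintype ι] [DecidableEq ι]
    {d : ι → Derivation ℝ A A} {g gi : Matrix ι ι A} (hg : gᵀ = g) (hgi : gi * g = 1) :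
    LeviCivita d g (koszul d g gi) :=
  leviCivita_of_koszul hg (mul_eq_one_comm.mp hgi) fun _ _ _ => rfl

variable {hS : UniqueDiffOn ℝ (J ×ˢ U)} {t : ℝ}

/-- The matrix field `G` is the value at time `t` of the matrix `g` over the ring. -/
def IsSlice (t : ℝ) (G : MatrixField n) (g : Matrix (Fin n) (Fin n) (SmoothFn (J ×ˢ U))) : Prop :=
  ∀ z ∈ U, ∀ i j, G z i j = (g i j).ev (t, z)

lemma pd_eq (hU : IsOpen U) (ht : t ∈ J) {f : SmoothFn (J ×ˢ U)}
    {φ : EuclideanSpace ℝ (Fin n) → ℝ} (hφ : ∀ z ∈ U, φ z = f.ev (t, z))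
    {y : EuclideanSpace ℝ (Fin n)} (hy : y ∈ U) (i : Fin n) :
    pd i φ y = (dd hS i f).ev (t, y) :=
  fderiv_slice hU f ht hφ hy _

variable {G K : MatrixField n} {g gi h : Matrix (Fin n) (Fin n) (SmoothFn (J ×ˢ U))}

lemma inv_slice (ht : t ∈ J) (hgi : gi * g = 1) (hG : IsSlice t G g) :
    IsSlice t (fun z => (G z)⁻¹) gi := by
  intro z hz i j
  have hp : (t, z) ∈ J ×ˢ U := mk_mem_prod ht hz
  have h1 : G z = (evalAt hp).toRingHom.mapMatrix g := by
    ext i j; rw [hG z hz, ← evalAt_eq hp]; rfl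
  have h2 : (evalAt hp).toRingHom.mapMatrix gi * G z = 1 := by
    rw [h1, ← map_mul, hgi, map_one]
  change (G z)⁻¹ i j = _
  rw [Matrix.inv_eq_left_inv h2, ← evalAt_eq hp]; rfl

section

variable (hU : IsOpen U) (ht : t ∈ J) (hgi : gi * g = 1) (hG : IsSlice t G g) (hK : IsSlice t K h)
  {y : EuclideanSpace ℝ (Fin n)} (hy : y ∈ U)

include hU ht hgi hG hy

lemma christoffel_eq (k i j : Fin n) :
    christoffel G k i j y = (koszul (dd hS) g gi i k j).ev (t, y) := by
  have hp : (t, y) ∈ J ×ˢ U := mk_mem_prod ht hy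
  have h1 : ∀ i j l, pd i (fun z => G z j l) y = (dd hS i (g j l)).ev (t, y) :=
    fun i j l => pd_eq hU ht (fun z hz => hG z hz j l) hy i
  simp only [christoffel, h1, inv_slice ht hgi hG y hy, koszul, of_apply, ← evalAt_eq hp,
    map_smul, map_sum, map_mul, map_sub, map_add, smul_eq_mul]

lemma riemann_eq (i j k l : Fin n) :
    riemann G i j k l y = ((g * curv (dd hS) (koszul (dd hS) g gi) i j) k l).ev (t, y) := by
  have hp : (t, y) ∈ J ×ˢ U := mk_mem_prod ht hy
  have h1 : ∀ i m j l, pd i (christoffel G m j l) y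
      = (dd hS i (koszul (dd hS) g gi j m l)).ev (t, y) :=
    fun i m j l => pd_eq hU ht (fun z hz => christoffel_eq hU ht hgi hG hz m j l) hy i
  simp only [riemann, h1, christoffel_eq (hS := hS) hU ht hgi hG hy, hG y hy, mul_apply, curv,
    Matrix.add_apply, Matrix.sub_apply, Dm_apply, ← evalAt_eq hp, map_sum, map_mul, map_sub,
    map_add, Finset.sum_sub_distrib]
  exact Finset.sum_congr rfl fun _ _ => by ring

lemma ricci_eq (i j : Fin n) :
    ricci G i j y = (ricciMat (dd hS) (koszul (dd hS) g gi) g gi i j).ev (t, y) := by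
  have hp : (t, y) ∈ J ×ˢ U := mk_mem_prod ht hy
  simp only [ricci, riemann_eq (hS := hS) hU ht hgi hG hy, inv_slice ht hgi hG y hy, ricciMat,
    of_apply, ← evalAt_eq hp, map_sum, map_mul]

include hK

lemma covDeriv_eq (i j k : Fin n) :
    covDeriv G K i j k y = (nabla (dd hS) (koszul (dd hS) g gi) h i j k).ev (t, y) := by
  have hp : (t, y) ∈ J ×ˢ U := mk_mem_prod ht hy
  have h1 : pd i (fun z => K z j k) y = (dd hS i (h j k)).ev (t, y) :=
    pd_eq hU ht (fun z hz => hK z hz j k) hy i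
  simp only [covDeriv, h1, christoffel_eq (hS := hS) hU ht hgi hG hy, hK y hy, nabla,
    Matrix.sub_apply, mul_apply, transpose_apply, Dm_apply, ← evalAt_eq hp, map_sum, map_mul,
    map_sub, Finset.sum_add_distrib]
  rw [sub_add_eq_sub_sub]
  congr 1
  exact Finset.sum_congr rfl fun _ _ => mul_comm _ _

lemma covDeriv₂_eq (l i j k : Fin n) :
    covDeriv₂ G K l i j k y = (nabla₂ (dd hS) (koszul (dd hS) g gi) h l i j k).ev (t, y) := by
  have hp : (t, y) ∈ J ×ˢ U := mk_mem_prod ht hy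
  have h1 : pd l (covDeriv G K i j k) y
      = (dd hS l (nabla (dd hS) (koszul (dd hS) g gi) h i j k)).ev (t, y) :=
    pd_eq hU ht (fun z hz => covDeriv_eq hU ht hgi hG hK hz i j k) hy l
  simp only [covDeriv₂, h1, christoffel_eq (hS := hS) hU ht hgi hG hy,
    covDeriv_eq (hS := hS) hU ht hgi hG hK hy, nabla₂,
    Matrix.sub_apply, mul_apply, transpose_apply, Dm_apply, ← evalAt_eq hp, map_sum, map_mul,
    map_sub, Finset.sum_add_distrib, Matrix.sum_apply, Matrix.smul_apply, smul_eq_mul]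
  have e1 : ∀ p, evalAt hp (nabla (dd hS) (koszul (dd hS) g gi) h i j p)
      * evalAt hp (koszul (dd hS) g gi l p k) = evalAt hp (koszul (dd hS) g gi l p k)
      * evalAt hp (nabla (dd hS) (koszul (dd hS) g gi) h i j p) := fun p => mul_comm _ _
  simp only [e1]
  ring

lemma laplacian_eq (j k : Fin n) :
    laplacian G K j k y = (roughLap (dd hS) (koszul (dd hS) g gi) gi h j k).ev (t, y) := by
  have hp : (t, y) ∈ J ×ˢ U := mk_mem_prod ht hy
  simp only [laplacian, covDeriv₂_eq (hS := hS) hU ht hgi hG hK hy, inv_slice ht hgi hG y hy,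
    roughLap, Matrix.sum_apply, Matrix.smul_apply, smul_eq_mul, ← evalAt_eq hp, map_sum, map_mul]

omit hU in
lemma trace_eq (hh : hᵀ = h) : trace G K y = ((gi * h).trace).ev (t, y) := by
  have hp : (t, y) ∈ J ×ˢ U := mk_mem_prod ht hy
  have hs : ∀ a b, h a b = h b a := fun a b => congrFun (congrFun hh b) a
  simp only [trace, hK y hy, inv_slice ht hgi hG y hy, Matrix.trace, diag, mul_apply,
    ← evalAt_eq hp, map_sum, map_mul]
  exact Finset.sum_congr rfl fun i _ => Finset.sum_congr rfl fun j _ => by rw [hs i j]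

omit hU in
lemma normSq_eq (hh : hᵀ = h) (hg : gᵀ = g) :
    normSq G K y = ((gi * h * (gi * h)).trace).ev (t, y) := by
  have hp : (t, y) ∈ J ×ˢ U := mk_mem_prod ht hy
  have hs : ∀ a b, h a b = h b a := fun a b => congrFun (congrFun hh b) a
  have hgs : ∀ a b, gi a b = gi b a := fun a b => by
    have h1 : g * giᵀ = 1 := by rw [← hg, ← transpose_mul, hgi, transpose_one]
    have h2 : giᵀ = gi := by
      calc giᵀ = gi * g * giᵀ := by rw [hgi, Matrix.one_mul]
        _ = gi := by rw [Matrix.mul_assoc, h1, Matrix.mul_one]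
    exact congrFun (congrFun h2 b) a
  simp only [normSq, hK y hy, inv_slice ht hgi hG y hy, Matrix.trace, diag, mul_apply,
    ← evalAt_eq hp, map_sum, map_mul, Finset.sum_mul, Finset.mul_sum]
  refine Finset.sum_congr rfl fun i _ => ?_
  calc _ = ∑ j, ∑ l, ∑ k, evalAt hp (gi i j) * evalAt hp (gi k l) * evalAt hp (h i k)
        * evalAt hp (h j l) := Finset.sum_congr rfl fun _ _ => Finset.sum_comm
    _ = ∑ l, ∑ j, ∑ k, evalAt hp (gi i j) * evalAt hp (gi k l) * evalAt hp (h i k)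
        * evalAt hp (h j l) := Finset.sum_comm
    _ = ∑ l, ∑ k, ∑ j, evalAt hp (gi i j) * evalAt hp (gi k l) * evalAt hp (h i k)
        * evalAt hp (h j l) := Finset.sum_congr rfl fun _ _ => Finset.sum_comm
    _ = _ := Finset.sum_congr rfl fun l _ => Finset.sum_congr rfl fun k _ =>
        Finset.sum_congr rfl fun j _ => by
          rw [hgs k l, hs i k]; ring

lemma metricVelocity_eq (hh : hᵀ = h) (i j : Fin n) :
    metricVelocity G K i j y
      = (gVelocity (dd hS) (koszul (dd hS) g gi) g gi h i j).ev (t, y) := by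
  have hp : (t, y) ∈ J ×ˢ U := mk_mem_prod ht hy
  have hs : ∀ a b, h a b = h b a := fun a b => congrFun (congrFun hh b) a
  simp only [metricVelocity, ricci_eq (hS := hS) hU ht hgi hG hy, hK y hy,
    inv_slice ht hgi hG y hy, gVelocity, Matrix.add_apply, Matrix.smul_apply, smul_eq_mul,
    mul_apply, ← evalAt_eq hp, map_sum, map_mul, map_add, map_neg, map_ofNat, Finset.mul_sum]
  congr 1
  exact Finset.sum_congr rfl fun k _ => Finset.sum_congr rfl fun l _ => by
    rw [hs j l]; ring

lemma tensorVelocity_eq (hh : hᵀ = h) (hg : gᵀ = g) (i j : Fin n) :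
    tensorVelocity G K i j y
      = (hVelocity (dd hS) (koszul (dd hS) g gi) g gi h i j).ev (t, y) := by
  have hp : (t, y) ∈ J ×ˢ U := mk_mem_prod ht hy
  have hs : ∀ a b, h a b = h b a := fun a b => congrFun (congrFun hh b) a
  have h1 : ∀ i j, ∑ m, ∑ q, ricci G i m y * K y q j * (G y)⁻¹ m q
      = ((ricciMat (dd hS) (koszul (dd hS) g gi) g gi * (gi * h)) i j).ev (t, y) := by
    intro i j
    simp only [ricci_eq (hS := hS) hU ht hgi hG hy, hK y hy, inv_slice ht hgi hG y hy,
      mul_apply (M := ricciMat _ _ _ _), mul_apply (M := gi), ← evalAt_eq hp, map_sum, map_mul,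
      Finset.mul_sum]
    exact Finset.sum_congr rfl fun k _ => Finset.sum_congr rfl fun l _ => by ring
  have h2 : ∑ m, ∑ q, ∑ k, ∑ l, K y m q * K y k l * (G y)⁻¹ m k * (G y)⁻¹ q l
      = normSq G K y := by
    simp only [normSq]
    calc _ = ∑ m, ∑ k, ∑ q, ∑ l, K y m q * K y k l * (G y)⁻¹ m k * (G y)⁻¹ q l :=
          Finset.sum_congr rfl fun _ _ => Finset.sum_comm
      _ = _ := Finset.sum_congr rfl fun k _ => Finset.sum_congr rfl fun l _ =>
          Finset.sum_congr rfl fun k _ => Finset.sum_congr rfl fun l _ => by ring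
  have h3 : ∑ m, ∑ q, ∑ k, ∑ l, K y i m * K y j q * K y k l * (G y)⁻¹ m k * (G y)⁻¹ l q
      = ((h * (gi * h) * (gi * h)) i j).ev (t, y) := by
    rw [Matrix.mul_assoc, Matrix.mul_assoc]
    simp only [hK y hy, inv_slice ht hgi hG y hy, mul_apply, ← evalAt_eq hp, map_sum, map_mul,
      Finset.mul_sum]
    refine Finset.sum_congr rfl fun m _ => ?_
    rw [Finset.sum_comm]
    refine Finset.sum_congr rfl fun k _ => ?_
    rw [Finset.sum_comm]
    exact Finset.sum_congr rfl fun l _ => Finset.sum_congr rfl fun q _ => by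
      rw [hs j q]; ring
  rw [tensorVelocity, laplacian_eq (hS := hS) hU ht hgi hG hK hy, h1, h1, h2, h3,
    normSq_eq ht hgi hG hK hy hh hg, hK y hy]
  simp only [hVelocity, Matrix.add_apply, Matrix.sub_apply, Matrix.smul_apply, smul_eq_mul,
    transpose_apply, ← evalAt_eq hp, map_sub, map_add, map_mul, map_ofNat]

end

end Bridge

/-! ### Quadratic expressions in solutions of linear heat equations -/

section DiffRing

open Matrix

variable {A : Type*} [CommRing A] [Algebra ℝ A] {ι : Type*} [Fintype ι] [DecidableEq ι]

section Jet

variable {𝕀 : Type*} [Fintype 𝕀] (d : ι → Derivation ℝ A A) (v : 𝕀 → A)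

/-- The ideal generated by a family and its first derivatives. -/
def jetIdeal : Ideal A := Ideal.span (range (Sum.elim v fun p : ι × 𝕀 => d p.1 (v p.2)))

variable {d v}

lemma mem_jetIdeal (x : 𝕀) : v x ∈ jetIdeal d v := Ideal.subset_span ⟨Sum.inl x, rfl⟩

lemma der_mem_jetIdeal (k : ι) (x : 𝕀) : d k (v x) ∈ jetIdeal d v :=
  Ideal.subset_span ⟨Sum.inr (k, x), rfl⟩

lemma span_le_jetIdeal : Ideal.span (range v) ≤ jetIdeal d v := by
  rw [Ideal.span_le]; rintro _ ⟨x, rfl⟩; exact mem_jetIdeal x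

lemma der_mem_jetIdeal_of_mem_span {x : A} (hx : x ∈ Ideal.span (range v)) (k : ι) :
    d k x ∈ jetIdeal d v := by
  obtain ⟨c, rfl⟩ := Ideal.mem_span_range_iff_exists_fun.mp hx
  rw [map_sum]
  refine Ideal.sum_mem _ fun i _ => ?_
  rw [Derivation.leibniz]
  refine Ideal.add_mem _ (Ideal.mul_mem_left _ _ (der_mem_jetIdeal _ _)) ?_
  rw [smul_eq_mul, mul_comm]
  exact Ideal.mul_mem_left _ _ (mem_jetIdeal _)

/-- Membership in the ideal provides smooth coefficients, and smooth coefficients are locally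
bounded; this is how an algebraic congruence becomes an estimate. -/
lemma exists_of_mem_jetIdeal {x : A} (hx : x ∈ jetIdeal d v) :
    ∃ (c : 𝕀 → A) (e : ι × 𝕀 → A), x = ∑ y, c y * v y + ∑ p, e p * d p.1 (v p.2) := by
  obtain ⟨c, rfl⟩ := Ideal.mem_span_range_iff_exists_fun.mp hx
  exact ⟨fun y => c (Sum.inl y), fun p => c (Sum.inr p), by simp [Fintype.sum_sum_type]⟩

/-- A quadratic form in the components of a solution of a linear heat equation. -/
lemma heat_quadratic {gi : Matrix ι ι A} {τ : Derivation ℝ A A} {K : Matrix 𝕀 𝕀 A}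
    (hK : Kᵀ = K)
    (hv : ∀ x, τ (v x) - ∑ k, ∑ l, gi k l * d k (d l (v x)) ∈ jetIdeal d v) :
    ∃ z : 𝕀 → A, (∀ x, z x ∈ jetIdeal d v) ∧
      τ (∑ x, ∑ y, K x y * (v x * v y)) =
        ∑ k, ∑ l, gi k l * d k (d l (∑ x, ∑ y, K x y * (v x * v y)))
        - 2 * (∑ k, ∑ l, gi k l * ∑ x, ∑ y, K x y * (d k (v x) * d l (v y)))
        + ∑ x, v x * z x := by
  have hs : ∀ x y, K x y = K y x := fun x y => congrFun (congrFun hK y) x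
  have first : ∀ D : Derivation ℝ A A, D (∑ x, ∑ y, K x y * (v x * v y))
      = ∑ x, v x * ∑ y, (D (K x y) * v y + 2 * (K x y * D (v y))) := by
    intro D
    have e1 : ∑ x, ∑ y, K x y * (v y * D (v x)) = ∑ x, ∑ y, K x y * (v x * D (v y)) := by
      rw [Finset.sum_comm]
      exact Finset.sum_congr rfl fun x _ => Finset.sum_congr rfl fun y _ => by rw [hs x y]
    have e2 : ∀ x y, D (K x y * (v x * v y)) = K x y * (v x * D (v y)) + K x y * (v y * D (v x))
        + v x * v y * D (K x y) := by
      intro x y; simp only [Derivation.leibniz, smul_eq_mul]; ring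
    simp only [map_sum, e2, Finset.sum_add_distrib, e1, Finset.mul_sum, mul_add]
    rw [add_comm (_ + _), ← two_mul]
    simp only [Finset.mul_sum]
    refine congrArg₂ _ ?_ ?_ <;>
    exact Finset.sum_congr rfl fun x _ => Finset.sum_congr rfl fun y _ => by ring
  have e0 : ∀ D : Derivation ℝ A A, D (2 : A) = 0 := fun D => D.map_natCast 2
  have second : ∀ k l, d k (d l (∑ x, ∑ y, K x y * (v x * v y)))
      = 2 * (∑ x, ∑ y, K x y * (d k (v x) * d l (v y)))
        + ∑ x, v x * ∑ y, (d k (d l (K x y)) * v y + 2 * (d l (K x y) * d k (v y))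
          + 2 * (d k (K x y) * d l (v y)) + 2 * (K x y * d k (d l (v y)))) := by
    intro k l
    have e1 : ∑ x, ∑ y, d l (K x y) * (v y * d k (v x))
        = ∑ x, ∑ y, d l (K x y) * (v x * d k (v y)) := by
      rw [Finset.sum_comm]
      exact Finset.sum_congr rfl fun x _ => Finset.sum_congr rfl fun y _ => by rw [hs x y]
    have e2 : ∀ x y, d k (v x * (d l (K x y) * v y + 2 * (K x y * d l (v y))))
        = d l (K x y) * (v y * d k (v x)) + 2 * (K x y * (d k (v x) * d l (v y)))
          + v x * (d k (d l (K x y)) * v y + d l (K x y) * d k (v y)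
          + 2 * (d k (K x y) * d l (v y)) + 2 * (K x y * d k (d l (v y)))) := by
      intro x y
      simp only [map_add, Derivation.leibniz, smul_eq_mul, e0, mul_zero, add_zero]; ring
    rw [first]
    simp only [Finset.mul_sum]
    simp only [map_sum, e2]
    simp only [Finset.sum_add_distrib, e1]
    rw [add_comm (∑ x, ∑ y, d l (K x y) * (v x * d k (v y))), add_assoc, add_right_inj]
    simp only [← Finset.sum_add_distrib]
    exact Finset.sum_congr rfl fun x _ => Finset.sum_congr rfl fun y _ => by ring
  -- Apart from the Laplacian of the form and the good term quadratic in ∂v, everything carries an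
  -- undifferentiated factor v x. The witness collects the cofactors: derivatives of K times v or
  -- ∂v, and K times the heat defect of v.
  refine ⟨fun x => ∑ y, (τ (K x y) - ∑ k, ∑ l, gi k l * d k (d l (K x y))) * v y
    - ∑ k, ∑ l, ∑ y, (2 * gi k l * d l (K x y)) * d k (v y)
    - ∑ k, ∑ l, ∑ y, (2 * gi k l * d k (K x y)) * d l (v y)
    + ∑ y, 2 * K x y * (τ (v y) - ∑ k, ∑ l, gi k l * d k (d l (v y))), fun x => ?_, ?_⟩
  · refine Ideal.add_mem _ (Ideal.sub_mem _ (Ideal.sub_mem _ ?_ ?_) ?_) ?_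
    · exact Ideal.sum_mem _ fun y _ => Ideal.mul_mem_left _ _ (mem_jetIdeal _)
    · exact Ideal.sum_mem _ fun k _ => Ideal.sum_mem _ fun l _ => Ideal.sum_mem _ fun y _ =>
        Ideal.mul_mem_left _ _ (der_mem_jetIdeal _ _)
    · exact Ideal.sum_mem _ fun k _ => Ideal.sum_mem _ fun l _ => Ideal.sum_mem _ fun y _ =>
        Ideal.mul_mem_left _ _ (der_mem_jetIdeal _ _)
    · exact Ideal.sum_mem _ fun y _ => Ideal.mul_mem_left _ _ (hv y)
  · rw [first τ]
    simp only [second]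
    have e3 : ∑ k, ∑ l, gi k l * (2 * (∑ x, ∑ y, K x y * (d k (v x) * d l (v y)))
        + ∑ x, v x * ∑ y, (d k (d l (K x y)) * v y + 2 * (d l (K x y) * d k (v y))
          + 2 * (d k (K x y) * d l (v y)) + 2 * (K x y * d k (d l (v y)))))
        = 2 * (∑ k, ∑ l, gi k l * ∑ x, ∑ y, K x y * (d k (v x) * d l (v y)))
          + ∑ x, v x * ∑ y, ∑ k, ∑ l, gi k l * (d k (d l (K x y)) * v y
            + 2 * (d l (K x y) * d k (v y))
            + 2 * (d k (K x y) * d l (v y)) + 2 * (K x y * d k (d l (v y)))) := by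
      simp only [mul_add (gi _ _), Finset.sum_add_distrib]
      congr 1
      · simp only [mul_left_comm _ (2 : A), ← Finset.mul_sum]
      · simp only [← Finset.sum_add_distrib, ← mul_add]
        simp only [Finset.mul_sum]
        calc _ = ∑ k, ∑ x, ∑ l, ∑ y, gi k l * (v x * (d k (d l (K x y)) * v y
                + 2 * (d l (K x y) * d k (v y)) + 2 * (d k (K x y) * d l (v y))
                + 2 * (K x y * d k (d l (v y))))) :=
              Finset.sum_congr rfl fun _ _ => Finset.sum_comm
          _ = ∑ x, ∑ k, ∑ l, ∑ y, gi k l * (v x * (d k (d l (K x y)) * v y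
                + 2 * (d l (K x y) * d k (v y)) + 2 * (d k (K x y) * d l (v y))
                + 2 * (K x y * d k (d l (v y))))) := Finset.sum_comm
          _ = ∑ x, ∑ k, ∑ y, ∑ l, gi k l * (v x * (d k (d l (K x y)) * v y
                + 2 * (d l (K x y) * d k (v y)) + 2 * (d k (K x y) * d l (v y))
                + 2 * (K x y * d k (d l (v y))))) :=
              Finset.sum_congr rfl fun _ _ => Finset.sum_congr rfl fun _ _ => Finset.sum_comm
          _ = ∑ x, ∑ y, ∑ k, ∑ l, gi k l * (v x * (d k (d l (K x y)) * v y
                + 2 * (d l (K x y) * d k (v y)) + 2 * (d k (K x y) * d l (v y))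
                + 2 * (K x y * d k (d l (v y))))) :=
              Finset.sum_congr rfl fun _ _ => Finset.sum_comm
          _ = _ := Finset.sum_congr rfl fun _ _ => Finset.sum_congr rfl fun _ _ =>
              Finset.sum_congr rfl fun _ _ => Finset.sum_congr rfl fun _ _ => by ring
    rw [e3, add_sub_cancel_left, ← Finset.sum_add_distrib]
    refine Finset.sum_congr rfl fun x _ => ?_
    rw [← mul_add]
    congr 1
    have e4 : ∀ f : ι → ι → 𝕀 → A, ∑ k, ∑ l, ∑ y, f k l y = ∑ y, ∑ k, ∑ l, f k l y := by
      intro f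
      calc _ = ∑ k, ∑ y, ∑ l, f k l y := Finset.sum_congr rfl fun _ _ => Finset.sum_comm
        _ = _ := Finset.sum_comm
    rw [e4, e4, ← Finset.sum_sub_distrib, ← Finset.sum_sub_distrib, ← Finset.sum_add_distrib,
      ← Finset.sum_add_distrib]
    refine Finset.sum_congr rfl fun y _ => ?_
    simp only [mul_add (gi _ _), Finset.sum_add_distrib, sub_mul, mul_sub, Finset.sum_mul,
      Finset.mul_sum]
    have f1 : ∀ k l, gi k l * (d k (d l (K x y)) * v y) = gi k l * d k (d l (K x y)) * v y :=
      fun k l => by ring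
    have f2 : ∀ k l, gi k l * (2 * (d l (K x y) * d k (v y)))
        = 2 * gi k l * d l (K x y) * d k (v y) := fun k l => by ring
    have f3 : ∀ k l, gi k l * (2 * (d k (K x y) * d l (v y)))
        = 2 * gi k l * d k (K x y) * d l (v y) := fun k l => by ring
    have f4 : ∀ k l, gi k l * (2 * (K x y * d k (d l (v y))))
        = 2 * K x y * (gi k l * d k (d l (v y))) := fun k l => by ring
    simp only [f1, f2, f3, f4]
    ring

end Jet

/-- The components of the curvature of the bundle connection. -/
def bundleCurv (d : ι → Derivation ℝ A A) (Γ : ι → Matrix ι ι A) (gi h : Matrix ι ι A)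
    (x : (ι × ι) × ((ι ⊕ Unit) × (ι ⊕ Unit))) : A :=
  curv d (bundleConn Γ gi h) x.1.1 x.1.2 x.2.1 x.2.2

variable {d : ι → Derivation ℝ A A} {g gi h : Matrix ι ι A} {Γ : ι → Matrix ι ι A}

/-- The Gauss-Codazzi tensor satisfies a linear heat equation along the flow. -/
theorem bundleCurv_heat (hd : ∀ i j x, d i (d j x) = d j (d i x)) {τ : Derivation ℝ A A}
    (hτ : ∀ i x, τ (d i x) = d i (τ x)) (L : LeviCivita d g Γ) (hgi : gi * g = 1) (hh : hᵀ = h)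
    (hgdot : Dm τ g = gVelocity d Γ g gi h) (hhdot : Dm τ h = hVelocity d Γ g gi h)
    (x : (ι × ι) × ((ι ⊕ Unit) × (ι ⊕ Unit))) :
    τ (bundleCurv d Γ gi h x) - ∑ k, ∑ l, gi k l * d k (d l (bundleCurv d Γ gi h x))
      ∈ jetIdeal d (bundleCurv d Γ gi h) := by
  set v := bundleCurv d Γ gi h with hv
  have hF : ∀ i j a b, Ideal.Quotient.mk (Ideal.span (range v))
      (curv d (bundleConn Γ gi h) i j a b) = 0 := fun i j a b =>
    Ideal.Quotient.eq_zero_iff_mem.mpr (Ideal.subset_span ⟨((i, j), (a, b)), rfl⟩)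
  have key := curv_heat (C := bundleConn Γ gi h) (τ := τ)
    (π₀ := Ideal.Quotient.mk (Ideal.span (range v)))
    (π₁ := Ideal.Quotient.mk (jetIdeal d v))
    (fun x hx => Ideal.Quotient.eq_zero_iff_mem.mpr
      (span_le_jetIdeal (Ideal.Quotient.eq_zero_iff_mem.mp hx)))
    (fun i x hx => Ideal.Quotient.eq_zero_iff_mem.mpr
      (der_mem_jetIdeal_of_mem_span (Ideal.Quotient.eq_zero_iff_mem.mp hx) i))
    hd hτ (fun i j => by ext a b; exact hF i j a b) gi (gaugePotential d Γ g gi h)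
    (fun j => map_connDefect hd hτ L hgi hh hgdot hhdot hF j) x.1.1 x.1.2
  have h2 := congrFun (congrFun key x.2.1) x.2.2
  have e : ∀ (M : Matrix (ι ⊕ Unit) (ι ⊕ Unit) A) a b,
      (∑ k, ∑ l, gi k l • Dm (d k) (Dm (d l) M)) a b = ∑ k, ∑ l, gi k l * d k (d l (M a b)) := by
    intro M a b; simp [Matrix.sum_apply]
  rw [RingHom.mapMatrix_apply, RingHom.mapMatrix_apply, map_apply, map_apply,
    Ideal.Quotient.eq, e] at h2
  exact h2

end DiffRing

/-! ### The maximum principle -/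

section Estimates

open Matrix Filter Topology
open scoped MatrixOrder

/-- Cauchy-Schwarz for a matrix acting on a vector. -/
lemma sum_sq_mulVec_le {m k : Type*} [Fintype m] [Fintype k] (M : Matrix m k ℝ) (w : k → ℝ) :
    ∑ i, (M *ᵥ w) i ^ 2 ≤ (∑ i, ∑ j, M i j ^ 2) * ∑ j, w j ^ 2 := by
  rw [Finset.sum_mul]
  exact Finset.sum_le_sum fun i _ => Finset.sum_mul_sq_le_sq_mul_sq _ _ _

/-- Writing N = BᵀB, the form is |Ba|², and |a| is at most the norm of B⁻¹ times |Ba|. -/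
lemma posDef_lower_bound {m : Type*} [Fintype m] [DecidableEq m] {N : Matrix m m ℝ}
    (hN : N.PosDef) : ∃ ε > 0, ∀ a : m → ℝ, ε * ∑ i, a i ^ 2 ≤ a ⬝ᵥ N *ᵥ a := by
  obtain ⟨B, hB⟩ := CStarAlgebra.nonneg_iff_eq_star_mul_self.mp hN.posSemidef.nonneg
  rw [star_eq_conjTranspose] at hB
  have hBu : IsUnit B.det := by
    have h1 := (Matrix.isUnit_iff_isUnit_det _).mp hN.isUnit
    rw [hB, det_mul] at h1
    exact isUnit_of_mul_isUnit_right h1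
  set R := ∑ i, ∑ j, B⁻¹ i j ^ 2 with hR
  have hR0 : 0 ≤ R := Finset.sum_nonneg fun i _ => Finset.sum_nonneg fun j _ => sq_nonneg _
  -- R + 1 in place of R keeps the bound meaningful for an empty index type, where R = 0.
  refine ⟨1 / (R + 1), by positivity, fun a => ?_⟩
  have h2 : a ⬝ᵥ N *ᵥ a = ∑ i, (B *ᵥ a) i ^ 2 := by
    rw [hB, ← mulVec_mulVec, dotProduct_mulVec, ← mulVec_transpose, conjTranspose_eq_transpose_of_trivial,
      transpose_transpose]
    simp [dotProduct, sq]
  have h3 := sum_sq_mulVec_le B⁻¹ (B *ᵥ a)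
  rw [mulVec_mulVec, Matrix.nonsing_inv_mul _ hBu, one_mulVec] at h3
  have h4 : 0 ≤ ∑ i, (B *ᵥ a) i ^ 2 := Finset.sum_nonneg fun i _ => sq_nonneg _
  rw [h2, one_div, inv_mul_le_iff₀ (by positivity)]
  nlinarith

/-- Positive definite matrices depending continuously on a point are locally uniformly so. -/
lemma eventually_posDef_lower_bound {X m : Type*} [Fintype m] [DecidableEq m] {l : Filter X}
    {N : X → Matrix m m ℝ} {N₀ : Matrix m m ℝ} (hN : N₀.PosDef)
    (hl : ∀ i j, Tendsto (fun p => N p i j) l (𝓝 (N₀ i j))) :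
    ∃ ε > 0, ∀ᶠ p in l, ∀ a : m → ℝ, ε * ∑ i, a i ^ 2 ≤ a ⬝ᵥ N p *ᵥ a := by
  obtain ⟨ε, hε, h⟩ := posDef_lower_bound hN
  have h1 : Tendsto (fun p => ∑ i, ∑ j, (N p i j - N₀ i j) ^ 2) l (𝓝 0) := by
    have : Tendsto (fun p => ∑ i, ∑ j, (N p i j - N₀ i j) ^ 2) l
        (𝓝 (∑ i, ∑ j, (N₀ i j - N₀ i j) ^ 2)) :=
      tendsto_finsetSum _ fun i _ => tendsto_finsetSum _ fun j _ =>
        ((hl i j).sub tendsto_const_nhds).pow 2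
    simpa using this
  refine ⟨ε / 2, by positivity, ?_⟩
  -- Entries of N p within ε²/4 in square sum change the form by at most ε/2 times |a|², which
  -- preserves half of the lower bound.
  filter_upwards [h1.eventually (gt_mem_nhds (show 0 < ε ^ 2 / 4 by positivity))] with p hp a
  have h2 : a ⬝ᵥ N p *ᵥ a = a ⬝ᵥ N₀ *ᵥ a + a ⬝ᵥ (N p - N₀) *ᵥ a := by
    rw [← dotProduct_add, ← add_mulVec, add_sub_cancel]
  have h3 := sum_sq_mulVec_le (N p - N₀) a
  set w := (N p - N₀) *ᵥ a with hw
  have h4 : (∑ i, a i * w i) ^ 2 ≤ (∑ i, a i ^ 2) * ∑ i, w i ^ 2 :=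
    Finset.sum_mul_sq_le_sq_mul_sq _ _ _
  have h5 : 0 ≤ ∑ i, a i ^ 2 := Finset.sum_nonneg fun i _ => sq_nonneg _
  have h6 : (∑ i, a i * w i) ^ 2 ≤ (ε / 2 * ∑ i, a i ^ 2) ^ 2 := by
    calc _ ≤ _ := h4
      _ ≤ (∑ i, a i ^ 2) * (ε ^ 2 / 4 * ∑ i, a i ^ 2) := by
          refine mul_le_mul_of_nonneg_left (h3.trans ?_) h5
          exact mul_le_mul_of_nonneg_right (by simpa using hp.le) h5
      _ = _ := by ring
  have h7 := (abs_le_of_sq_le_sq' h6 (by positivity)).1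
  have h8 := h a
  rw [h2]
  simp only [dotProduct] at h8 ⊢
  linarith

/-- Absorption of the gradient terms. -/
lemma quadratic_absorb {m k : Type*} [Fintype m] [Fintype k] {R ε : ℝ} (hε : 0 < ε) (hR : 0 ≤ R)
    {K : Matrix m m ℝ} {N : Matrix k k ℝ} {c : Matrix m m ℝ} {e : Matrix m k ℝ}
    (hK : ∀ a : m → ℝ, ε * ∑ i, a i ^ 2 ≤ a ⬝ᵥ K *ᵥ a)
    (hN : ∀ a : k → ℝ, ε * ∑ i, a i ^ 2 ≤ a ⬝ᵥ N *ᵥ a)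
    (hc : ∑ i, ∑ j, c i j ^ 2 ≤ R) (he : ∑ i, ∑ j, e i j ^ 2 ≤ R) (a : m → ℝ) (b : k → ℝ) :
    -2 * (b ⬝ᵥ N *ᵥ b) + a ⬝ᵥ (c *ᵥ a + e *ᵥ b)
      ≤ ((1 + R) / 2 + (R + 1) / (4 * ε)) / ε * (a ⬝ᵥ K *ᵥ a) := by
  have ha : 0 ≤ ∑ i, a i ^ 2 := Finset.sum_nonneg fun i _ => sq_nonneg _
  have hb : 0 ≤ ∑ i, b i ^ 2 := Finset.sum_nonneg fun i _ => sq_nonneg _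
  have h1 : a ⬝ᵥ c *ᵥ a ≤ (1 + R) / 2 * ∑ i, a i ^ 2 := by
    have h2 := (sum_sq_mulVec_le c a).trans (mul_le_mul_of_nonneg_right hc ha)
    have h3 : a ⬝ᵥ c *ᵥ a ≤ ∑ i, (a i ^ 2 / 2 + (c *ᵥ a) i ^ 2 / 2) :=
      Finset.sum_le_sum fun i _ => by nlinarith [sq_nonneg (a i - (c *ᵥ a) i)]
    rw [Finset.sum_add_distrib, ← Finset.sum_div, ← Finset.sum_div] at h3
    linarith
  -- Young's inequality, weighted so that the b-part costs only ε|b|². The good term supplies 2ε|b|²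
  -- to absorb it.
  have h4 : a ⬝ᵥ e *ᵥ b ≤ (R + 1) / (4 * ε) * ∑ i, a i ^ 2 + ε * ∑ i, b i ^ 2 := by
    have h2 := (sum_sq_mulVec_le e b).trans (mul_le_mul_of_nonneg_right he hb)
    have h3 : a ⬝ᵥ e *ᵥ b ≤ ∑ i, ((R + 1) / (4 * ε) * a i ^ 2 + ε / (R + 1) * (e *ᵥ b) i ^ 2) := by
      refine Finset.sum_le_sum fun i _ => ?_
      have h5 : (R + 1) / (4 * ε) * a i ^ 2 + ε / (R + 1) * (e *ᵥ b) i ^ 2 - a i * (e *ᵥ b) i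
          = (R + 1) / (4 * ε) * (a i - 2 * ε / (R + 1) * (e *ᵥ b) i) ^ 2 := by
        field_simp
        ring
      have h6 : 0 ≤ (R + 1) / (4 * ε) * (a i - 2 * ε / (R + 1) * (e *ᵥ b) i) ^ 2 := by positivity
      linarith
    rw [Finset.sum_add_distrib, ← Finset.mul_sum, ← Finset.mul_sum] at h3
    have h7 : ε / (R + 1) * ∑ i, (e *ᵥ b) i ^ 2 ≤ ε * ∑ i, b i ^ 2 := by
      calc _ ≤ ε / (R + 1) * (R * ∑ i, b i ^ 2) := mul_le_mul_of_nonneg_left h2 (by positivity)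
        _ = ε * ((∑ i, b i ^ 2) * (R / (R + 1))) := by ring
        _ ≤ ε * (∑ i, b i ^ 2) := by
          refine mul_le_mul_of_nonneg_left ?_ hε.le
          exact mul_le_of_le_one_right hb (by rw [div_le_one (by linarith)]; linarith)
    linarith
  have h8 := hN b
  have h9 : ((1 + R) / 2 + (R + 1) / (4 * ε)) * ∑ i, a i ^ 2
      ≤ ((1 + R) / 2 + (R + 1) / (4 * ε)) / ε * (a ⬝ᵥ K *ᵥ a) := by
    rw [div_mul_eq_mul_div, le_div_iff₀ hε, mul_assoc]
    refine mul_le_mul_of_nonneg_left ?_ (by positivity)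
    linarith [hK a]
  have h10 : 0 ≤ ε * ∑ i, b i ^ 2 := by positivity
  rw [dotProduct_add]
  linarith

end Estimates

/-! ### Scalar maximum principle on a compact space -/

section MaxPrinciple

open Filter Topology

/-- A parabolic maximum principle: a nonnegative function that vanishes initially and whose time
derivative at spatial maxima is bounded by a multiple of its value vanishes. -/
theorem eq_zero_of_deriv_le_at_max {X : Type*} [TopologicalSpace X] [CompactSpace X] {J : Set ℝ}
    (hJ : J.OrdConnected) (hJ0 : IsLeast J 0) {u : ℝ → X → ℝ}
    (hc : ContinuousOn (fun p : ℝ × X => u p.1 p.2) (J ×ˢ univ))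
    (h0 : ∀ x, u 0 x = 0) (hpos : ∀ t ∈ J, ∀ x, 0 ≤ u t x)
    (hloc : ∀ t ∈ J, ∀ x, ∃ C : ℝ, ∀ᶠ p : ℝ × X in 𝓝[J ×ˢ univ] (t, x),
      ∃ u', HasDerivWithinAt (fun r => u r p.2) u' J p.1 ∧
        (IsMaxOn (u p.1) univ p.2 → u' ≤ C * u p.1 p.2)) {t : ℝ} (ht : t ∈ J) (x : X) :
    u t x = 0 := by
  by_contra hne
  have hux : 0 < u t x := lt_of_le_of_ne (hpos t ht x) (Ne.symm hne)
  have hsub : Icc 0 t ⊆ J := hJ.out hJ0.1 ht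
  have ht0 : 0 ≤ t := hJ0.2 ht
  have hcomp : IsCompact (Icc 0 t ×ˢ (univ : Set X)) := isCompact_Icc.prod isCompact_univ
  -- Only local constants are given; compactness of [0, t] × X yields one constant. Enlarging it is
  -- allowed because u is nonnegative.
  obtain ⟨C, hC⟩ : ∃ C : ℝ, ∀ p ∈ Icc 0 t ×ˢ (univ : Set X),
      ∃ u', HasDerivWithinAt (fun r => u r p.2) u' J p.1 ∧
        (IsMaxOn (u p.1) univ p.2 → u' ≤ C * u p.1 p.2) := by
    refine hcomp.induction_on (p := fun s => ∃ C : ℝ, ∀ p ∈ s ∩ (J ×ˢ univ),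
      ∃ u', HasDerivWithinAt (fun r => u r p.2) u' J p.1 ∧
        (IsMaxOn (u p.1) univ p.2 → u' ≤ C * u p.1 p.2)) ⟨0, by simp⟩ ?_ ?_ ?_ |>.imp ?_
    · rintro s s' hss ⟨C, hC⟩
      exact ⟨C, fun p hp => hC p ⟨hss hp.1, hp.2⟩⟩
    · rintro s s' ⟨C, hC⟩ ⟨C', hC'⟩
      refine ⟨max C C', ?_⟩
      rintro p ⟨hp | hp, hpJ⟩
      · obtain ⟨u', h1, h2⟩ := hC p ⟨hp, hpJ⟩
        exact ⟨u', h1, fun hm => (h2 hm).trans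
          (mul_le_mul_of_nonneg_right (le_max_left _ _) (hpos _ hpJ.1 _))⟩
      · obtain ⟨u', h1, h2⟩ := hC' p ⟨hp, hpJ⟩
        exact ⟨u', h1, fun hm => (h2 hm).trans
          (mul_le_mul_of_nonneg_right (le_max_right _ _) (hpos _ hpJ.1 _))⟩
    · rintro ⟨s, y⟩ hs
      obtain ⟨C, hC⟩ := hloc s (hsub hs.1) y
      rw [eventually_nhdsWithin_iff] at hC
      exact ⟨_, mem_nhdsWithin_of_mem_nhds hC, C, fun p hp => hp.1 hp.2⟩
    · exact fun C hC p hp => hC p ⟨hp, hsub hp.1, trivial⟩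
  -- The rate C + 1 rather than C makes the time derivative strictly negative at a positive maximum
  -- of v.
  set v : ℝ × X → ℝ := fun p => Real.exp (-(C + 1) * p.1) * u p.1 p.2 with hv
  have hvc : ContinuousOn v (Icc 0 t ×ˢ (univ : Set X)) := by
    refine ContinuousOn.mul ?_ (hc.mono (prod_mono hsub le_rfl))
    exact (by fun_prop : Continuous fun p : ℝ × X => Real.exp (-(C + 1) * p.1)).continuousOn
  obtain ⟨⟨s, y⟩, hsy, hmax⟩ := hcomp.exists_isMaxOn ⟨(t, x), ⟨⟨ht0, le_rfl⟩, trivial⟩⟩ hvc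
  have hvpos : 0 < v (s, y) :=
    lt_of_lt_of_le (mul_pos (Real.exp_pos _) hux) (hmax (show (t, x) ∈ _ from ⟨⟨ht0, le_rfl⟩, trivial⟩))
  have hupos : 0 < u s y := (mul_pos_iff_of_pos_left (Real.exp_pos _)).mp hvpos
  have hs0 : 0 < s := by
    rcases hsy.1.1.eq_or_lt with h | h
    · simp only at h; rw [← h, h0] at hupos; exact absurd hupos (lt_irrefl _)
    · exact h
  obtain ⟨u', hu', hle⟩ := hC (s, y) hsy
  have hle' := hle fun z _ => by
    have : v (s, z) ≤ v (s, y) := hmax (show (s, z) ∈ _ from ⟨hsy.1, trivial⟩)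
    exact le_of_mul_le_mul_left this (Real.exp_pos _)
  simp only at hu' hle'
  have hder : HasDerivWithinAt (fun r => v (r, y))
      (Real.exp (-(C + 1) * s) * (u' - (C + 1) * u s y)) (Icc 0 s) s := by
    have h1 : HasDerivAt (fun r => Real.exp (-(C + 1) * r)) (Real.exp (-(C + 1) * s) * (-(C + 1)))
        s := by
      simpa using ((hasDerivAt_id s).const_mul (-(C + 1))).exp
    have h2 := h1.hasDerivWithinAt.mul (hu'.mono ((Icc_subset_Icc_right hsy.1.2).trans hsub))
    exact h2.congr_deriv (by ring)
  have hneg : Real.exp (-(C + 1) * s) * (u' - (C + 1) * u s y) < 0 :=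
    mul_neg_of_pos_of_neg (Real.exp_pos _) (by linarith)
  -- The maximum over [0, t] × X is also a maximum over earlier times at the same point, so left
  -- difference quotients are nonnegative. This also covers s = t.
  have hnonneg : 0 ≤ Real.exp (-(C + 1) * s) * (u' - (C + 1) * u s y) := by
    have h3 := hasDerivWithinAt_iff_tendsto_slope.mp hder
    have : (𝓝[Icc 0 s \ {s}] s).NeBot := by
      rw [Icc_sdiff_right]
      exact right_nhdsWithin_Ico_neBot hs0
    refine ge_of_tendsto h3 ?_
    filter_upwards [self_mem_nhdsWithin] with r hr
    have hrs : r < s := lt_of_le_of_ne hr.1.2 hr.2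
    have h4 : v (r, y) ≤ v (s, y) :=
      hmax (show (r, y) ∈ _ from ⟨⟨hr.1.1, hr.1.2.trans hsy.1.2⟩, trivial⟩)
    rw [slope_def_field]
    exact div_nonneg_of_nonpos (by linarith) (by linarith)
  linarith

end MaxPrinciple

/-! ### The differential inequality at a spatial maximum -/

section LocalInequality

open Matrix Filter Topology SmoothFn
open scoped MatrixOrder Kronecker

/-- A positive second derivative would make 0 a local minimum as well, so f would be locally
constant and c would be 0. -/
lemma second_deriv_nonpos_of_isLocalMax {f f' : ℝ → ℝ} {c : ℝ} (h : IsLocalMax f 0)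
    (hf : ∀ᶠ r in 𝓝 0, HasDerivAt f (f' r) r) (hf' : HasDerivAt f' c 0) : c ≤ 0 := by
  by_contra! hc
  have h1 : deriv f =ᶠ[𝓝 0] f' := hf.mono fun r hr => hr.deriv
  have h2 : deriv (deriv f) 0 = c := by rw [h1.deriv_eq, hf'.deriv]
  have h3 : IsLocalMin f 0 := isLocalMin_of_deriv_deriv_pos (by rw [h2]; exact hc)
    h.deriv_eq_zero hf.self_of_nhds.continuousAt
  have h4 : f =ᶠ[𝓝 0] fun _ => f 0 := by
    filter_upwards [h, h3] with r hr hr' using le_antisymm hr hr'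
  have h5 : deriv f =ᶠ[𝓝 0] fun _ => 0 := by
    filter_upwards [h4.eventuallyEq_nhds] with r hr
    rw [hr.deriv_eq]; simp
  rw [h5.deriv_eq] at h2
  simp at h2
  linarith

variable {n : ℕ} {J : Set ℝ} {U : Set (EuclideanSpace ℝ (Fin n))}
  {hS : UniqueDiffOn ℝ (J ×ˢ U)}

lemma der_eq_sum_dd (w : Fin n → ℝ) (f : SmoothFn (J ×ˢ U)) :
    der hS (0, WithLp.toLp 2 w) f = ∑ i, w i • dd hS i f := by
  refine ext_ev fun p hp => ?_
  have h1 : ((0 : ℝ), (WithLp.toLp 2 w : EuclideanSpace ℝ (Fin n)))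
      = ∑ i, w i • ((0 : ℝ), (EuclideanSpace.single i (1 : ℝ))) := by
    refine Prod.ext ?_ ?_
    · simp [Prod.fst_sum]
    · ext j; simp [Prod.snd_sum, Pi.single_apply]
  rw [ev_der _ _ hp, h1, map_sum, ← evalAt_eq hp, map_sum]
  refine Finset.sum_congr rfl fun i _ => ?_
  rw [map_smul, map_smul, evalAt_eq hp, dd, ev_der _ _ hp]

/-- The Hessian is nonpositive at a spatial maximum. -/
lemma hessian_nonpos (hU : IsOpen U) (f : SmoothFn (J ×ˢ U)) {t : ℝ} (ht : t ∈ J)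
    {y : EuclideanSpace ℝ (Fin n)} (hy : y ∈ U) (hmax : ∀ z ∈ U, f.ev (t, z) ≤ f.ev (t, y))
    (w : Fin n → ℝ) :
    ∑ k, ∑ l, w k * w l * (dd hS k (dd hS l f)).ev (t, y) ≤ 0 := by
  set v : EuclideanSpace ℝ (Fin n) := WithLp.toLp 2 w with hv
  have hline : ∀ r : ℝ, HasDerivAt (fun r : ℝ => y + r • v) v r := fun r => by
    simpa using ((hasDerivAt_id r).smul_const v).const_add y
  have hnhds : ∀ᶠ r : ℝ in 𝓝 0, y + r • v ∈ U := by
    refine (hline 0).continuousAt.eventually_mem ?_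
    simpa using hU.mem_nhds hy
  have hd : ∀ f : SmoothFn (J ×ˢ U), ∀ r : ℝ, y + r • v ∈ U →
      HasDerivAt (fun r => f.ev (t, y + r • v)) ((der hS (0, v) f).ev (t, y + r • v)) r := by
    intro f r hr
    have h1 := (hasFDerivAt_slice hU f (φ := fun z => f.ev (t, z)) ht (fun _ _ => rfl) hr).comp_hasDerivAt
      r (hline r)
    rw [ev_der _ _ (mk_mem_prod ht hr)]
    exact h1
  have h1 : (der hS (0, v) (der hS (0, v) f)).ev (t, y) ≤ 0 := by
    refine second_deriv_nonpos_of_isLocalMax (f := fun r => f.ev (t, y + r • v))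
      (f' := fun r => (der hS (0, v) f).ev (t, y + r • v)) ?_ (hnhds.mono fun r hr => hd f r hr) ?_
    · filter_upwards [hnhds] with r hr
      simpa using hmax _ hr
    · simpa using hd (der hS (0, v) f) 0 (by simpa using hy)
  have hp : (t, y) ∈ J ×ˢ U := mk_mem_prod ht hy
  rw [hv, der_eq_sum_dd, der_eq_sum_dd, ← evalAt_eq hp] at h1
  simp only [map_sum, map_smul, smul_eq_mul, Derivation.map_smul, Finset.smul_sum] at h1
  simp only [evalAt_eq hp] at h1
  refine le_of_eq_of_le ?_ h1
  exact Finset.sum_congr rfl fun _ _ => Finset.sum_congr rfl fun _ _ => by ring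

/-- Factoring N = BᵀB turns the trace into a sum of second derivatives along the rows of B. -/
lemma trace_hessian_nonpos (hU : IsOpen U) (f : SmoothFn (J ×ˢ U)) {t : ℝ} (ht : t ∈ J)
    {y : EuclideanSpace ℝ (Fin n)} (hy : y ∈ U) (hmax : ∀ z ∈ U, f.ev (t, z) ≤ f.ev (t, y))
    {N : Matrix (Fin n) (Fin n) ℝ} (hN : N.PosSemidef) :
    ∑ k, ∑ l, N k l * (dd hS k (dd hS l f)).ev (t, y) ≤ 0 := by
  obtain ⟨B, rfl⟩ := CStarAlgebra.nonneg_iff_eq_star_mul_self.mp hN.nonneg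
  have h1 : ∑ m, ∑ k, ∑ l, B m k * B m l * (dd hS k (dd hS l f)).ev (t, y) ≤ 0 :=
    Finset.sum_nonpos fun m _ => hessian_nonpos hU f ht hy hmax (B m)
  refine le_of_eq_of_le ?_ h1
  simp only [star_eq_conjTranspose, mul_apply, conjTranspose_apply, star_trivial, Finset.sum_mul]
  calc _ = ∑ k, ∑ m, ∑ l, B m k * B m l * (dd hS k (dd hS l f)).ev (t, y) :=
        Finset.sum_congr rfl fun _ _ => Finset.sum_comm
    _ = _ := Finset.sum_comm

lemma continuousWithinAt_ev (f : SmoothFn (J ×ˢ U)) {p : ℝ × EuclideanSpace ℝ (Fin n)}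
    (hp : p ∈ J ×ˢ U) : ContinuousWithinAt f.ev (J ×ˢ U) p :=
  f.contDiffOn.continuousOn p hp

/-- The value of a matrix over the ring at a point. -/
noncomputable def evM {m k : Type*} (N : Matrix m k (SmoothFn (J ×ˢ U)))
    (p : ℝ × EuclideanSpace ℝ (Fin n)) : Matrix m k ℝ := of fun a b => (N a b).ev p

/-- Differential inequality for a positive quadratic form in the components of a solution of a
linear heat equation. -/
theorem eventually_heat_quadratic_le {𝕀 : Type*} [Fintype 𝕀] [DecidableEq 𝕀] (hU : IsOpen U)
    {v : 𝕀 → SmoothFn (J ×ˢ U)} {K : Matrix 𝕀 𝕀 (SmoothFn (J ×ˢ U))}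
    {gi : Matrix (Fin n) (Fin n) (SmoothFn (J ×ˢ U))} (hKT : Kᵀ = K)
    (hv : ∀ x, dt hS (v x) - ∑ k, ∑ l, gi k l * dd hS k (dd hS l (v x)) ∈ jetIdeal (dd hS) v)
    (hK : ∀ p ∈ J ×ˢ U, (evM K p).PosDef) (hgi : ∀ p ∈ J ×ˢ U, (evM gi p).PosDef)
    {p₀ : ℝ × EuclideanSpace ℝ (Fin n)} (hp₀ : p₀ ∈ J ×ˢ U) :
    ∃ C : ℝ, ∀ᶠ p in 𝓝[J ×ˢ U] p₀,
      (∀ z ∈ U, (∑ x, ∑ y, K x y * (v x * v y)).ev (p.1, z)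
        ≤ (∑ x, ∑ y, K x y * (v x * v y)).ev p) →
      (dt hS (∑ x, ∑ y, K x y * (v x * v y))).ev p
        ≤ C * (∑ x, ∑ y, K x y * (v x * v y)).ev p := by
  obtain ⟨z, hz, hu⟩ := heat_quadratic hKT hv
  choose c e hce using fun x => exists_of_mem_jetIdeal (hz x)
  have hlim : ∀ f : SmoothFn (J ×ˢ U), Tendsto f.ev (𝓝[J ×ˢ U] p₀) (𝓝 (f.ev p₀)) :=
    fun f => continuousWithinAt_ev f hp₀
  obtain ⟨ε₁, hε₁, h1⟩ := eventually_posDef_lower_bound (hK p₀ hp₀) (l := 𝓝[J ×ˢ U] p₀)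
    (N := evM K) fun i j => hlim (K i j)
  -- The good gradient term is a quadratic form in the pairs (k, x), with matrix the Kronecker
  -- product of g⁻¹ and K.
  obtain ⟨ε₂, hε₂, h2⟩ := eventually_posDef_lower_bound ((hgi p₀ hp₀).kronecker (hK p₀ hp₀))
    (l := 𝓝[J ×ˢ U] p₀) (N := fun p => evM gi p ⊗ₖ evM K p)
    fun i j => (hlim (gi i.1 j.1)).mul (hlim (K i.2 j.2))
  have hsum : ∀ {m k : Type _} [Fintype m] [Fintype k] (f : m → k → SmoothFn (J ×ˢ U)),
      ∃ R : ℝ, 0 ≤ R ∧ ∀ᶠ p in 𝓝[J ×ˢ U] p₀, ∑ i, ∑ j, (f i j).ev p ^ 2 ≤ R := by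
    intro m k _ _ f
    have h3 : Tendsto (fun p => ∑ i, ∑ j, (f i j).ev p ^ 2) (𝓝[J ×ˢ U] p₀)
        (𝓝 (∑ i, ∑ j, (f i j).ev p₀ ^ 2)) :=
      tendsto_finsetSum _ fun i _ => tendsto_finsetSum _ fun j _ => (hlim (f i j)).pow 2
    refine ⟨∑ i, ∑ j, (f i j).ev p₀ ^ 2 + 1, ?_, ?_⟩
    · have : 0 ≤ ∑ i, ∑ j, (f i j).ev p₀ ^ 2 :=
        Finset.sum_nonneg fun i _ => Finset.sum_nonneg fun j _ => sq_nonneg _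
      linarith
    · exact (h3.eventually (gt_mem_nhds (lt_add_one _))).mono fun p hp => hp.le
  obtain ⟨R₁, hR₁, h3⟩ := hsum c
  obtain ⟨R₂, hR₂, h4⟩ := hsum e
  set ε := min ε₁ ε₂ with hε
  set R := max R₁ R₂ with hR
  have hε0 : 0 < ε := lt_min hε₁ hε₂
  refine ⟨((1 + R) / 2 + (R + 1) / (4 * ε)) / ε, ?_⟩
  filter_upwards [h1, h2, h3, h4, self_mem_nhdsWithin] with p h1 h2 h3 h4 hp hmax
  obtain ⟨s, y⟩ := p
  have hlap := trace_hessian_nonpos (hS := hS) hU _ hp.1 hp.2 hmax (hgi _ hp).posSemidef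
  have habs := quadratic_absorb hε0 (hR₁.trans (le_max_left R₁ R₂))
    (K := evM K (s, y)) (N := evM gi (s, y) ⊗ₖ evM K (s, y))
    (c := of fun i j => (c i j).ev (s, y)) (e := of fun i j => (e i j).ev (s, y))
    (fun a => (mul_le_mul_of_nonneg_right (min_le_left _ _)
      (Finset.sum_nonneg fun i _ => sq_nonneg _)).trans (h1 a))
    (fun a => (mul_le_mul_of_nonneg_right (min_le_right _ _)
      (Finset.sum_nonneg fun i _ => sq_nonneg _)).trans (h2 a))
    (h3.trans (le_max_left _ _)) (h4.trans (le_max_right _ _))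
    (fun x => (v x).ev (s, y)) (fun q => (dd hS q.1 (v q.2)).ev (s, y))
  have e1 : (∑ x, ∑ y, K x y * (v x * v y)).ev (s, y)
      = (fun x => (v x).ev (s, y)) ⬝ᵥ evM K (s, y) *ᵥ (fun x => (v x).ev (s, y)) := by
    simp only [← evalAt_eq hp, map_sum, map_mul, dotProduct, mulVec, evM, of_apply,
      Finset.mul_sum]
    exact Finset.sum_congr rfl fun _ _ => Finset.sum_congr rfl fun _ _ => by ring
  rw [hu, e1]
  refine le_trans ?_ habs
  rw [← evalAt_eq hp, map_add, map_sub]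
  have e3 : evalAt hp (∑ x, v x * z x) = (fun x => (v x).ev (s, y)) ⬝ᵥ
      ((of fun i j => (c i j).ev (s, y)) *ᵥ (fun x => (v x).ev (s, y))
        + (of fun i j => (e i j).ev (s, y)) *ᵥ fun q => (dd hS q.1 (v q.2)).ev (s, y)) := by
    simp only [hce, dotProduct, mulVec, Pi.add_apply, of_apply, ← evalAt_eq hp, map_sum, map_mul,
      map_add]
  have e4 : evalAt hp (2 * ∑ k, ∑ l, gi k l * ∑ x, ∑ y, K x y * (dd hS k (v x) * dd hS l (v y)))
      = 2 * ((fun q : Fin n × 𝕀 => (dd hS q.1 (v q.2)).ev (s, y)) ⬝ᵥ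
        (evM gi (s, y) ⊗ₖ evM K (s, y)) *ᵥ fun q => (dd hS q.1 (v q.2)).ev (s, y)) := by
    simp only [dotProduct, mulVec, kroneckerMap_apply, evM, of_apply, ← evalAt_eq hp, map_sum,
      map_mul, map_ofNat, Fintype.sum_prod_type, Finset.mul_sum]
    refine Finset.sum_congr rfl fun k _ => ?_
    rw [Finset.sum_comm]
    exact Finset.sum_congr rfl fun _ _ => Finset.sum_congr rfl fun _ _ =>
      Finset.sum_congr rfl fun _ _ => by ring
  have e5 : evalAt hp (∑ k, ∑ l, gi k l * dd hS k (dd hS l (∑ x, ∑ y, K x y * (v x * v y)))) ≤ 0 := by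
    rw [map_sum]
    simp only [map_sum (evalAt hp), map_mul (evalAt hp), evalAt_eq hp]
    exact hlap
  rw [e3, e4]
  linarith

end LocalInequality

/-! ### Invariance under changes of coordinates -/

section CoordChange

open Matrix

variable {A B : Type*} [CommRing A] [Algebra ℝ A] [CommRing B] [Algebra ℝ B] {ι : Type*}
  [Fintype ι] [DecidableEq ι]

lemma trace_map_ringHom {κ : Type*} [Fintype κ] (π : B →+* A) (M : Matrix κ κ B) :
    (M.map π).trace = π M.trace := by
  simp [Matrix.trace]

/-- The data `(g, h)` over the differential ring `A` are the pull-back of `(g', h')` over `B` under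
a change of coordinates with Jacobian matrix `J`. -/
structure CoordChange (d : ι → Derivation ℝ A A) (d' : ι → Derivation ℝ B B) (π : B →+* A)
    (J Ji g gi h : Matrix ι ι A) (g' gi' h' : Matrix ι ι B) (Γ : ι → Matrix ι ι A)
    (Γ' : ι → Matrix ι ι B) : Prop where
  chain : ∀ i f, d i (π f) = ∑ p, J p i * π (d' p f)
  jac_comm : ∀ i j p, d i (J p j) = d j (J p i)
  comm : ∀ i j x, d i (d j x) = d j (d i x)
  inv : J * Ji = 1
  lc : LeviCivita d g Γ
  lc' : LeviCivita d' g' Γ'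
  metric_inv : gi * g = 1
  metric_inv' : gi' * g' = 1
  metric : g = Jᵀ * g'.map π * J
  tensor : h = Jᵀ * h'.map π * J

namespace CoordChange

variable {d : ι → Derivation ℝ A A} {d' : ι → Derivation ℝ B B} {π : B →+* A}
  {J Ji g gi h : Matrix ι ι A} {g' gi' h' : Matrix ι ι B} {Γ : ι → Matrix ι ι A}
  {Γ' : ι → Matrix ι ι B} (T : CoordChange d d' π J Ji g gi h g' gi' h' Γ Γ')

include T

lemma inv' : Ji * J = 1 := mul_eq_one_comm.mp T.inv

lemma map_inv : gi'.map π * g'.map π = 1 := by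
  rw [← Matrix.map_mul, T.metric_inv', Matrix.map_one _ (map_zero _) (map_one _)]

lemma inv_metric : gi = Ji * gi'.map π * Jiᵀ := by
  have h1 : Ji * gi'.map π * Jiᵀ * g = 1 := by
    rw [T.metric]
    calc _ = Ji * (gi'.map π * ((J * Ji)ᵀ * g'.map π)) * J := by
          rw [transpose_mul]; simp only [Matrix.mul_assoc]
      _ = 1 := by rw [T.inv, transpose_one, Matrix.one_mul, T.map_inv, Matrix.mul_one, T.inv']
  have h2 : g * gi = 1 := mul_eq_one_comm.mp T.metric_inv
  calc gi = Ji * gi'.map π * Jiᵀ * g * gi := by rw [h1, Matrix.one_mul]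
    _ = _ := by rw [Matrix.mul_assoc, h2, Matrix.mul_one]

lemma jac_inv_jac : J * gi * Jᵀ = gi'.map π := by
  rw [T.inv_metric]
  calc _ = (J * Ji) * gi'.map π * (J * Ji)ᵀ := by
        rw [transpose_mul]; simp only [Matrix.mul_assoc]
    _ = _ := by rw [T.inv]; simp

/-- Raising an index turns congruence by the Jacobian into conjugation, so traces of products of
mixed tensors are invariant. -/
lemma inv_mul_pullback (N : Matrix ι ι A) : gi * (Jᵀ * N * J) = Ji * (gi'.map π * N) * J := by
  rw [T.inv_metric]
  calc _ = Ji * (gi'.map π * ((J * Ji)ᵀ * N)) * J := by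
        rw [transpose_mul]; simp only [Matrix.mul_assoc]
    _ = _ := by rw [T.inv]; simp

lemma conj_mul (M N : Matrix ι ι A) : Ji * M * J * (Ji * N * J) = Ji * (M * N) * J := by
  calc _ = Ji * (M * ((J * Ji) * N)) * J := by simp only [Matrix.mul_assoc]
    _ = _ := by rw [T.inv]; simp

lemma conj_trace (M : Matrix ι ι A) : (Ji * M * J).trace = M.trace := by
  rw [trace_mul_comm, ← Matrix.mul_assoc, T.inv, Matrix.one_mul]

lemma meanCurv_eq : (gi * h).trace = π (gi' * h').trace := by
  rw [T.tensor, T.inv_mul_pullback, T.conj_trace, ← Matrix.map_mul, trace_map_ringHom]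

lemma normSq_eq : (gi * h * (gi * h)).trace = π (gi' * h' * (gi' * h')).trace := by
  rw [T.tensor, T.inv_mul_pullback, T.conj_mul, T.conj_trace, ← Matrix.map_mul, ← Matrix.map_mul,
    trace_map_ringHom]

/-- The components F' need not come from the ring B, so that contractions over several pairs of
indices can be nested. -/
lemma contract {F : ι → ι → A} {F' : ι → ι → A}
    (hF : ∀ i k, F i k = ∑ p, ∑ r, J p i * J r k * F' p r) :
    ∑ i, ∑ k, gi i k * F i k = ∑ p, ∑ r, π (gi' p r) * F' p r := by
  have h1 : ∀ p r, π (gi' p r) = ∑ i, ∑ k, J p i * gi i k * J r k := by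
    intro p r
    have := congrFun (congrFun T.jac_inv_jac p) r
    rw [map_apply] at this
    rw [← this]
    simp only [mul_apply, transpose_apply, Finset.sum_mul]
    exact Finset.sum_comm
  simp only [hF, h1, Finset.mul_sum, Finset.sum_mul]
  calc _ = ∑ i, ∑ p, ∑ k, ∑ r, gi i k * (J p i * J r k * F' p r) :=
        Finset.sum_congr rfl fun _ _ => Finset.sum_comm
    _ = ∑ p, ∑ i, ∑ k, ∑ r, gi i k * (J p i * J r k * F' p r) := Finset.sum_comm
    _ = ∑ p, ∑ i, ∑ r, ∑ k, gi i k * (J p i * J r k * F' p r) :=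
        Finset.sum_congr rfl fun _ _ => Finset.sum_congr rfl fun _ _ => Finset.sum_comm
    _ = ∑ p, ∑ r, ∑ i, ∑ k, gi i k * (J p i * J r k * F' p r) :=
        Finset.sum_congr rfl fun _ _ => Finset.sum_comm
    _ = _ := Finset.sum_congr rfl fun _ _ => Finset.sum_congr rfl fun _ _ =>
        Finset.sum_congr rfl fun _ _ => Finset.sum_congr rfl fun _ _ => by ring

lemma gradInner_eq (u v : B) : gradInner d gi (π u) (π v) = π (gradInner d' gi' u v) := by
  simp only [gradInner, map_sum, map_mul]
  refine T.contract fun i k => ?_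
  rw [T.chain, T.chain, Finset.sum_mul_sum]
  exact Finset.sum_congr rfl fun _ _ => Finset.sum_congr rfl fun _ _ => by ring

lemma conn_eq (i : ι) : J * Γ i = Dm (d i) J + (∑ p, J p i • (Γ' p).map π) * J :=
  leviCivita_pullback T.inv T.chain T.jac_comm T.metric_inv T.lc T.lc' T.metric i

/-- The derivatives of the Jacobian produced by h = Jᵀh'J cancel the inhomogeneous terms in the
transformation of Γ. -/
lemma nabla_eq (i : ι) :
    nabla d Γ h i = Jᵀ * (∑ p, J p i • (nabla d' Γ' h' p).map π) * J := by
  set Θ : Matrix ι ι A := ∑ p, J p i • (Γ' p).map π with hΘ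
  have h1 : Dm (d i) (h'.map π) = ∑ p, J p i • (Dm (d' p) h').map π := by
    ext a b
    simp [T.chain, Matrix.sum_apply]
  have h2 : ∑ p, J p i • (nabla d' Γ' h' p).map π
      = Dm (d i) (h'.map π) - Θᵀ * h'.map π - h'.map π * Θ := by
    rw [h1, hΘ, transpose_sum, Finset.sum_mul, Finset.mul_sum, ← Finset.sum_sub_distrib,
      ← Finset.sum_sub_distrib]
    refine Finset.sum_congr rfl fun p _ => ?_
    rw [transpose_smul, Matrix.smul_mul, Matrix.mul_smul, ← smul_sub, ← smul_sub]
    congr 1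
    ext a b
    simp [nabla, mul_apply]
  have h3 : Dm (d i) J = J * Γ i - Θ * J := by rw [T.conn_eq]; abel
  rw [h2, nabla, T.tensor]
  simp only [Dm_mul, Dm_transpose, h3, transpose_sub, transpose_mul, Matrix.sub_mul,
    Matrix.mul_sub, Matrix.mul_add, Matrix.add_mul, Matrix.mul_assoc]
  abel

lemma nablaSq_eq : nablaSq d Γ gi h = π (nablaSq d' Γ' gi' h') := by
  simp only [nablaSq, map_sum, map_mul]
  refine T.contract fun i k => ?_
  rw [T.nabla_eq, T.nabla_eq, T.inv_mul_pullback, T.inv_mul_pullback, T.conj_mul, T.conj_trace]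
  simp only [Finset.mul_sum, Finset.sum_mul, Matrix.mul_smul, Matrix.smul_mul, smul_smul,
    trace_sum, trace_smul, smul_eq_mul, ← Matrix.map_mul, trace_map_ringHom]
  rw [Finset.sum_comm]
  exact Finset.sum_congr rfl fun p _ => Finset.sum_congr rfl fun r _ => by ring

end CoordChange

/-- The positive definite form `g ⊕ 1` on `TN ⊕ ℝ`. -/
def frameForm (g : Matrix ι ι A) : Matrix (ι ⊕ Unit) (ι ⊕ Unit) A := fromBlocks g 0 0 1

/-- The squared norm of the curvature of the bundle connection. -/
def curvSq (d : ι → Derivation ℝ A A) (Γ : ι → Matrix ι ι A) (g gi h : Matrix ι ι A) : A :=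
  ∑ i, ∑ k, gi i k * ∑ j, ∑ l, gi j l *
    ((curv d (bundleConn Γ gi h) i j)ᵀ * frameForm g * curv d (bundleConn Γ gi h) k l
      * frameForm gi).trace

namespace CoordChange

variable {d : ι → Derivation ℝ A A} {d' : ι → Derivation ℝ B B} {π : B →+* A}
  {J Ji g gi h : Matrix ι ι A} {g' gi' h' : Matrix ι ι B} {Γ : ι → Matrix ι ι A}
  {Γ' : ι → Matrix ι ι B} (T : CoordChange d d' π J Ji g gi h g' gi' h' Γ Γ')

include T

/-- The frame of TN ⊕ ℝ changes by J ⊕ 1: the trivial summand does not see the coordinates. -/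
lemma bundleConn_eq (i : ι) : frameForm J * bundleConn Γ gi h i = Dm (d i) (frameForm J)
    + (∑ p, J p i • (bundleConn Γ' gi' h' p).map π) * frameForm J := by
  have e : ∑ p, J p i • (bundleConn Γ' gi' h' p).map π
      = fromBlocks (∑ p, J p i • (Γ' p).map π) (of fun k _ => ∑ p, J p i * π ((gi' * h') k p))
        (of fun _ j => ∑ p, J p i * π (h' p j)) 0 := by
    ext (a | a) (b | b) <;> simp [bundleConn, Matrix.sum_apply]
  have h1 : gi * h = Ji * ((gi' * h').map π) * J := by
    rw [T.tensor, T.inv_mul_pullback, Matrix.map_mul]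
  rw [e, frameForm, bundleConn, fromBlocks_multiply, fromBlocks_multiply, Dm_fromBlocks,
    fromBlocks_add]
  congr 1
  · simpa using T.conn_eq i
  · rw [Dm_zero, h1]
    ext k c
    have : J * (Ji * (gi' * h').map π * J) = (gi' * h').map π * J := by
      rw [← Matrix.mul_assoc, ← Matrix.mul_assoc, T.inv, Matrix.one_mul]
    have h2 := congrFun (congrFun this k) i
    rw [mul_apply] at h2
    simp only [Matrix.mul_zero, Matrix.zero_mul, add_zero, zero_add, Matrix.mul_one,
      Matrix.add_apply, Matrix.zero_apply]
    rw [mul_apply]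
    simp only [of_apply]
    rw [h2, mul_apply]
    simp [mul_comm]
  · rw [Dm_zero, T.tensor]
    ext c j
    simp only [Matrix.mul_zero, Matrix.zero_mul, add_zero, zero_add, Matrix.one_mul,
      Matrix.add_apply, Matrix.zero_apply, of_apply, mul_apply, transpose_apply, map_apply]
  · simp [Dm_one]

/-- F is a two-form with values in endomorphisms of TN ⊕ ℝ. Its norm is taken with g ⊕ 1 instead of
the Lorentzian form: chart changes J ⊕ 1 respect both, but only the former is definite, so that a
vanishing norm forces F = 0. -/
lemma curvSq_eq : curvSq d Γ g gi h = π (curvSq d' Γ' g' gi' h') := by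
  set S := frameForm J with hS
  set Si := frameForm Ji with hSi
  have hSS : S * Si = 1 := by
    rw [hS, hSi, frameForm, frameForm, fromBlocks_multiply]
    simp [T.inv]
  have hSS' : Si * S = 1 := mul_eq_one_comm.mp hSS
  have hg : frameForm g = Sᵀ * (frameForm g').map π * S := by
    rw [hS, T.metric]
    simp [frameForm, fromBlocks_transpose, fromBlocks_map, fromBlocks_multiply, Matrix.map_zero,
      Matrix.map_one]
  have hgi : frameForm gi = Si * (frameForm gi').map π * Siᵀ := by
    rw [hSi, T.inv_metric]
    simp [frameForm, fromBlocks_transpose, fromBlocks_map, fromBlocks_multiply, Matrix.map_zero,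
      Matrix.map_one]
  set F := curv d (bundleConn Γ gi h) with hF
  set F' := curv d' (bundleConn Γ' gi' h') with hF'
  have hC : ∀ i j, S * F i j = (∑ p, ∑ q, (J p i * J q j) • (F' p q).map π) * S :=
    fun i j => curv_pullback T.chain T.comm T.jac_comm T.bundleConn_eq i j
  have h1 : ∀ i j k l, ((F i j)ᵀ * frameForm g * F k l * frameForm gi).trace
      = ∑ p, ∑ r, J p i * J r k * ∑ q, ∑ s, J q j * J s l *
        π (((F' p q)ᵀ * frameForm g' * F' r s * frameForm gi').trace) := by
    intro i j k l
    set X := ∑ p, ∑ q, (J p i * J q j) • (F' p q).map π with hX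
    set Y := ∑ p, ∑ q, (J p k * J q l) • (F' p q).map π with hY
    have e1 : (F i j)ᵀ * frameForm g * F k l * frameForm gi
        = Sᵀ * (Xᵀ * (frameForm g').map π * Y * (frameForm gi').map π) * Siᵀ := by
      rw [hg, hgi]
      calc _ = (S * F i j)ᵀ * (frameForm g').map π * (S * F k l) * Si
            * (frameForm gi').map π * Siᵀ := by
            rw [transpose_mul]; simp only [Matrix.mul_assoc]
        _ = Sᵀ * Xᵀ * (frameForm g').map π * Y * (S * Si) * (frameForm gi').map π * Siᵀ := by
            rw [hC, hC, ← hX, ← hY, transpose_mul]; simp only [Matrix.mul_assoc]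
        _ = _ := by rw [hSS, Matrix.mul_one]; simp only [Matrix.mul_assoc]
    rw [e1, trace_mul_comm, ← Matrix.mul_assoc, ← transpose_mul, hSS, transpose_one,
      Matrix.one_mul, hX, hY]
    have e2 : ∀ p q r s, π (((F' p q)ᵀ * frameForm g' * F' r s * frameForm gi').trace)
        = (((F' p q).map π)ᵀ * (frameForm g').map π * (F' r s).map π
          * (frameForm gi').map π).trace := by
      intro p q r s
      rw [← transpose_map, ← Matrix.map_mul, ← Matrix.map_mul, ← Matrix.map_mul, trace_map_ringHom]
    simp only [e2, transpose_sum, transpose_smul, Finset.sum_mul, Finset.mul_sum,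
      Matrix.smul_mul, Matrix.mul_smul, trace_sum, trace_smul, smul_eq_mul]
    have e3 : ∀ f : ι → ι → ι → ι → A, ∑ r, ∑ s, ∑ p, ∑ q, f r s p q
        = ∑ p, ∑ r, ∑ q, ∑ s, f r s p q := by
      intro f
      calc _ = ∑ r, ∑ p, ∑ s, ∑ q, f r s p q :=
            Finset.sum_congr rfl fun _ _ => Finset.sum_comm
        _ = ∑ p, ∑ r, ∑ s, ∑ q, f r s p q := Finset.sum_comm
        _ = _ := Finset.sum_congr rfl fun _ _ => Finset.sum_congr rfl fun _ _ => Finset.sum_comm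
    rw [e3]
    exact Finset.sum_congr rfl fun _ _ => Finset.sum_congr rfl fun _ _ =>
        Finset.sum_congr rfl fun _ _ => Finset.sum_congr rfl fun _ _ => by ring
  simp only [curvSq, map_sum, map_mul]
  rw [T.contract (F' := fun p r => ∑ j, ∑ l, gi j l * ∑ q, ∑ s, J q j * J s l *
        π (((F' p q)ᵀ * frameForm g' * F' r s * frameForm gi').trace))]
  · refine Finset.sum_congr rfl fun p _ => Finset.sum_congr rfl fun r _ => ?_
    congr 1
    exact T.contract fun j l => rfl
  · intro i k
    simp only [← hF, h1, Finset.mul_sum]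
    have e4 : ∀ f : ι → ι → ι → ι → A, ∑ j, ∑ l, ∑ p, ∑ r, f j l p r
        = ∑ p, ∑ r, ∑ j, ∑ l, f j l p r := by
      intro f
      calc _ = ∑ j, ∑ p, ∑ l, ∑ r, f j l p r :=
            Finset.sum_congr rfl fun _ _ => Finset.sum_comm
        _ = ∑ p, ∑ j, ∑ l, ∑ r, f j l p r := Finset.sum_comm
        _ = ∑ p, ∑ j, ∑ r, ∑ l, f j l p r :=
            Finset.sum_congr rfl fun _ _ => Finset.sum_congr rfl fun _ _ => Finset.sum_comm
        _ = _ := Finset.sum_congr rfl fun _ _ => Finset.sum_comm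
    rw [e4]
    exact Finset.sum_congr rfl fun _ _ => Finset.sum_congr rfl fun _ _ =>
        Finset.sum_congr rfl fun _ _ => Finset.sum_congr rfl fun _ _ =>
        Finset.sum_congr rfl fun _ _ => Finset.sum_congr rfl fun _ _ => by ring

end CoordChange

end CoordChange

/-! ### Pull-back of smooth functions under a map of coordinate domains -/

section PullBack

open Matrix SmoothFn

variable {n : ℕ} {J : Set ℝ} {U W : Set (EuclideanSpace ℝ (Fin n))}
  {φ : EuclideanSpace ℝ (Fin n) → EuclideanSpace ℝ (Fin n)}

lemma ext_evalAt {V : Type*} [NormedAddCommGroup V] [NormedSpace ℝ V] {S : Set V}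
    {f g : SmoothFn S} (h : ∀ p (hp : p ∈ S), evalAt hp f = evalAt hp g) : f = g :=
  ext_ev fun p hp => by rw [← evalAt_eq hp, ← evalAt_eq hp, h p hp]

/-- Composition with the spatial map `φ`. -/
noncomputable def pull (J : Set ℝ) (hφ : ContDiffOn ℝ ∞ φ W) (hm : MapsTo φ W U) :
    SmoothFn (J ×ˢ U) →+* SmoothFn (J ×ˢ W) where
  toFun f := of (fun p => f.ev (p.1, φ p.2)) (f.contDiffOn.comp
    (contDiffOn_fst.prodMk (hφ.comp contDiffOn_snd fun _ hp => hp.2))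
    fun _ hp => mk_mem_prod hp.1 (hm hp.2))
  map_one' := ext_evalAt fun p hp => by
    rw [evalAt_eq, ev_of _ hp, map_one, ← evalAt_eq (mk_mem_prod hp.1 (hm hp.2)), map_one]
  map_mul' f g := ext_evalAt fun p hp => by
    rw [map_mul, evalAt_eq, evalAt_eq, evalAt_eq, ev_of _ hp, ev_of _ hp, ev_of _ hp,
      ← evalAt_eq (mk_mem_prod hp.1 (hm hp.2)), ← evalAt_eq (mk_mem_prod hp.1 (hm hp.2)),
      ← evalAt_eq (mk_mem_prod hp.1 (hm hp.2)), map_mul]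
  map_zero' := ext_evalAt fun p hp => by
    rw [evalAt_eq, ev_of _ hp, map_zero, ← evalAt_eq (mk_mem_prod hp.1 (hm hp.2)), map_zero]
  map_add' f g := ext_evalAt fun p hp => by
    rw [map_add, evalAt_eq, evalAt_eq, evalAt_eq, ev_of _ hp, ev_of _ hp, ev_of _ hp,
      ← evalAt_eq (mk_mem_prod hp.1 (hm hp.2)), ← evalAt_eq (mk_mem_prod hp.1 (hm hp.2)),
      ← evalAt_eq (mk_mem_prod hp.1 (hm hp.2)), map_add]

lemma ev_pull (hφ : ContDiffOn ℝ ∞ φ W) (hm : MapsTo φ W U) (f : SmoothFn (J ×ˢ U))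
    {t : ℝ} {y : EuclideanSpace ℝ (Fin n)} (ht : t ∈ J) (hy : y ∈ W) :
    (pull J hφ hm f).ev (t, y) = f.ev (t, φ y) :=
  ev_of _ (mk_mem_prod ht hy)

/-- The Jacobian matrix of `φ`. -/
noncomputable def jac (hS : UniqueDiffOn ℝ (J ×ˢ W)) (hφ : ContDiffOn ℝ ∞ φ W) :
    Matrix (Fin n) (Fin n) (SmoothFn (J ×ˢ W)) :=
  Matrix.of fun p i => dd hS i (SmoothFn.of (fun q => φ q.2 p)
    (((contDiff_piLp_apply (𝕜 := ℝ) (n := ∞) (E := fun _ : Fin n => ℝ) 2 (i := p)).contDiffOn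
      (s := univ)).comp (hφ.comp contDiffOn_snd fun _ hp => hp.2) fun _ _ => mem_univ _))

variable {hS : UniqueDiffOn ℝ (J ×ˢ W)} {hS' : UniqueDiffOn ℝ (J ×ˢ U)}

lemma ev_jac (hW : IsOpen W) (hφ : ContDiffOn ℝ ∞ φ W) {t : ℝ} {y : EuclideanSpace ℝ (Fin n)}
    (ht : t ∈ J) (hy : y ∈ W) (p i : Fin n) :
    (jac hS hφ p i).ev (t, y) = fderiv ℝ φ y (EuclideanSpace.single i 1) p := by
  have h1 : pd i (fun z => φ z p) y = (jac hS hφ p i).ev (t, y) :=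
    pd_eq (hS := hS) hW ht (fun z hz => by rw [ev_of _ (mk_mem_prod ht hz)]) hy i
  rw [← h1, pd]
  have h2 : HasFDerivAt φ (fderiv ℝ φ y) y :=
    ((hφ.contDiffAt (hW.mem_nhds hy)).differentiableAt (by norm_num)).hasFDerivAt
  have h3 := (PiLp.hasFDerivAt_apply (𝕜 := ℝ) 2 (E := fun _ : Fin n => ℝ) (φ y) p).comp y h2
  rw [show (fun z => φ z p) = (fun f : EuclideanSpace ℝ (Fin n) => f p) ∘ φ from rfl, h3.fderiv]
  rfl

lemma fderiv_eq_sum_jac (hW : IsOpen W) (hφ : ContDiffOn ℝ ∞ φ W) {t : ℝ}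
    {y : EuclideanSpace ℝ (Fin n)} (ht : t ∈ J) (hy : y ∈ W) (i : Fin n) :
    fderiv ℝ φ y (EuclideanSpace.single i 1)
      = ∑ p, (jac hS hφ p i).ev (t, y) • EuclideanSpace.single p (1 : ℝ) := by
  simp only [ev_jac hW hφ ht hy]
  ext j
  simp [Pi.single_apply]

lemma dd_pull (hW : IsOpen W) (hU : IsOpen U) (hφ : ContDiffOn ℝ ∞ φ W) (hm : MapsTo φ W U)
    (i : Fin n) (f : SmoothFn (J ×ˢ U)) :
    dd hS i (pull J hφ hm f) = ∑ p, jac hS hφ p i * pull J hφ hm (dd hS' p f) := by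
  refine ext_ev ?_
  rintro ⟨t, y⟩ ⟨ht, hy⟩
  have hp : (t, y) ∈ J ×ˢ W := mk_mem_prod ht hy
  have h1 : pd i (fun z => f.ev (t, φ z)) y = (dd hS i (pull J hφ hm f)).ev (t, y) :=
    pd_eq hW ht (fun z hz => (ev_pull hφ hm f ht hz).symm) hy i
  have h2 : HasFDerivAt φ (fderiv ℝ φ y) y :=
    ((hφ.contDiffAt (hW.mem_nhds hy)).differentiableAt (by norm_num)).hasFDerivAt
  have h3 := hasFDerivAt_slice hU f (φ := fun z => f.ev (t, z)) ht (fun _ _ => rfl) (hm hy)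
  have h4 : pd i (fun z => f.ev (t, φ z)) y
      = fderiv ℝ (fun z => f.ev (t, z)) (φ y) (fderiv ℝ φ y (EuclideanSpace.single i 1)) := by
    rw [h3.fderiv]
    exact congrArg (fun L => L (EuclideanSpace.single i 1)) (h3.comp y h2).fderiv
  rw [← h1, h4, fderiv_eq_sum_jac (hS := hS) hW hφ ht hy, map_sum, ← evalAt_eq hp, map_sum]
  refine Finset.sum_congr rfl fun p _ => ?_
  rw [map_smul, map_mul, evalAt_eq hp, evalAt_eq hp, ev_pull hφ hm _ ht hy, smul_eq_mul]
  congr 1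
  exact pd_eq hU ht (fun _ _ => rfl) (hm hy) p

lemma subset_closure_interior_prod (hJ : J ⊆ closure (interior J)) (hU : IsOpen U) :
    J ×ˢ U ⊆ closure (interior (J ×ˢ U)) := by
  rw [interior_prod_eq, closure_prod_eq, hU.interior_eq]
  exact prod_mono hJ subset_closure

lemma uniqueDiffOn_prod (hJ : UniqueDiffOn ℝ J) (hU : IsOpen U) : UniqueDiffOn ℝ (J ×ˢ U) :=
  hJ.prod hU.uniqueDiffOn

lemma dd_comm (hJ : J ⊆ closure (interior J)) (hU : IsOpen U) (i j : Fin n)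
    (f : SmoothFn (J ×ˢ U)) : dd hS' i (dd hS' j f) = dd hS' j (dd hS' i f) :=
  der_comm (subset_closure_interior_prod hJ hU) _ _ f

lemma dt_dd_comm (hJ : J ⊆ closure (interior J)) (hU : IsOpen U) (i : Fin n)
    (f : SmoothFn (J ×ˢ U)) : dt hS' (dd hS' i f) = dd hS' i (dt hS' f) :=
  der_comm (subset_closure_interior_prod hJ hU) _ _ f

lemma coordChange_pull (hJ : J ⊆ closure (interior J)) (hW : IsOpen W) (hU : IsOpen U)
    (hφ : ContDiffOn ℝ ∞ φ W) (hm : MapsTo φ W U)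
    {g gi h : Matrix (Fin n) (Fin n) (SmoothFn (J ×ˢ W))}
    {g' gi' h' : Matrix (Fin n) (Fin n) (SmoothFn (J ×ˢ U))}
    (hgT : gᵀ = g) (hgT' : g'ᵀ = g') (hgi : gi * g = 1) (hgi' : gi' * g' = 1)
    (hg : g = (jac hS hφ)ᵀ * g'.map (pull J hφ hm) * jac hS hφ)
    (hh : h = (jac hS hφ)ᵀ * h'.map (pull J hφ hm) * jac hS hφ) :
    CoordChange (dd hS) (dd hS') (pull J hφ hm) (jac hS hφ) (jac hS hφ)⁻¹ g gi h g' gi' h'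
      (koszul (dd hS) g gi) (koszul (dd hS') g' gi') where
  chain := dd_pull hW hU hφ hm
  jac_comm i j p := dd_comm hJ hW i j _
  comm := dd_comm hJ hW
  -- Invertibility of the Jacobian is read off from g = Jᵀg'J, since det g is a unit.
  inv := by
    apply Matrix.mul_nonsing_inv
    have h1 : gi.det * g.det = 1 := by rw [← det_mul, hgi, det_one]
    rw [hg, det_mul, ← mul_assoc] at h1
    exact IsUnit.of_mul_eq_one _ ((mul_comm _ _).trans h1)
  lc := leviCivita_koszul hgT hgi
  lc' := leviCivita_koszul hgT' hgi'
  metric_inv := hgi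
  metric_inv' := hgi'
  metric := hg
  tensor := hh

end PullBack

/-! ### Charts -/

section Charts

open Matrix SmoothFn

variable {n : ℕ} {M : Type*} [TopologicalSpace M] [ChartedSpace (EuclideanSpace ℝ (Fin n)) M]

variable (n) in
/-- The coordinate domain of the preferred chart at `α`. -/
abbrev chartDom (α : M) : Set (EuclideanSpace ℝ (Fin n)) := (extChartAt (𝓡 n) α).target

variable (n) in
/-- The part of the coordinate domain at `α` that lies in the chart at `β`. -/
def overlap (α β : M) : Set (EuclideanSpace ℝ (Fin n)) :=
  (extChartAt (𝓡 n) α).target ∩ (extChartAt (𝓡 n) α).symm ⁻¹' (extChartAt (𝓡 n) β).source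

variable (n) in
/-- The transition map from the chart at `α` to the chart at `β`. -/
noncomputable def transition (α β : M) (y : EuclideanSpace ℝ (Fin n)) :
    EuclideanSpace ℝ (Fin n) :=
  extChartAt (𝓡 n) β ((extChartAt (𝓡 n) α).symm y)

variable {α β : M}

lemma isOpen_chartDom (α : M) : IsOpen (chartDom n α) := isOpen_extChartAt_target α

lemma isOpen_overlap (α β : M) : IsOpen (overlap n α β) :=
  (continuousOn_extChartAt_symm α).isOpen_inter_preimage (isOpen_chartDom α)
    (isOpen_extChartAt_source β)

lemma overlap_subset (α β : M) : overlap n α β ⊆ chartDom n α := inter_subset_left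

lemma mapsTo_transition (α β : M) : MapsTo (transition n α β) (overlap n α β) (chartDom n β) :=
  fun _ hy => (extChartAt (𝓡 n) β).map_source hy.2

lemma symm_transition {y : EuclideanSpace ℝ (Fin n)} (hy : y ∈ overlap n α β) :
    (extChartAt (𝓡 n) β).symm (transition n α β y) = (extChartAt (𝓡 n) α).symm y :=
  (extChartAt (𝓡 n) β).left_inv hy.2

lemma transition_mem_overlap {y : EuclideanSpace ℝ (Fin n)} (hy : y ∈ overlap n α β) :
    transition n α β y ∈ overlap n β α := by
  refine ⟨mapsTo_transition α β hy, ?_⟩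
  rw [mem_preimage, symm_transition hy]
  exact (extChartAt (𝓡 n) α).map_target hy.1

lemma transition_transition {y : EuclideanSpace ℝ (Fin n)} (hy : y ∈ overlap n α β) :
    transition n β α (transition n α β y) = y := by
  rw [transition, symm_transition hy]
  exact (extChartAt (𝓡 n) α).right_inv hy.1

variable [IsManifold (𝓡 n) ∞ M]

lemma contDiffOn_transition (α β : M) : ContDiffOn ℝ ∞ (transition n α β) (overlap n α β) := by
  have := contDiffOn_ext_coord_change (I := 𝓡 n) (n := ∞) β α
  refine this.mono fun y hy => ?_
  rw [PartialEquiv.trans_source]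
  exact hy

lemma mdifferentiableAt_symm {y : EuclideanSpace ℝ (Fin n)} (hy : y ∈ chartDom n α) :
    MDifferentiableAt 𝓘(ℝ, EuclideanSpace ℝ (Fin n)) (𝓡 n) (extChartAt (𝓡 n) α).symm y :=
  ((contMDiffOn_extChartAt_symm (I := 𝓡 n) (n := ∞) α).contMDiffAt
    ((isOpen_chartDom α).mem_nhds hy)).mdifferentiableAt (by norm_num)

/-- The differential of the inverse of the chart at `α`, as a map of the model space. -/
noncomputable def symmDeriv (α : M) (y : EuclideanSpace ℝ (Fin n)) :
    EuclideanSpace ℝ (Fin n) →L[ℝ] EuclideanSpace ℝ (Fin n) :=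
  show TangentSpace 𝓘(ℝ, EuclideanSpace ℝ (Fin n)) y →L[ℝ]
    TangentSpace (𝓡 n) ((extChartAt (𝓡 n) α).symm y) from
  mfderiv 𝓘(ℝ, EuclideanSpace ℝ (Fin n)) (𝓡 n) (extChartAt (𝓡 n) α).symm y

/-- The value of a 2-tensor at a point, as a bilinear form on the model space. -/
def toBilin (B : TwoTensor n M) (x : M) :
    EuclideanSpace ℝ (Fin n) →L[ℝ] EuclideanSpace ℝ (Fin n) →L[ℝ] ℝ :=
  show TangentSpace (𝓡 n) x →L[ℝ] TangentSpace (𝓡 n) x →L[ℝ] ℝ from B x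

lemma comp_eq_toBilin (B : TwoTensor n M) (y : EuclideanSpace ℝ (Fin n)) (i j : Fin n) :
    comp B α y i j = toBilin B ((extChartAt (𝓡 n) α).symm y)
      (symmDeriv α y (EuclideanSpace.single i 1)) (symmDeriv α y (EuclideanSpace.single j 1)) :=
  rfl

lemma symmDeriv_transition {y : EuclideanSpace ℝ (Fin n)} (hy : y ∈ overlap n α β) :
    symmDeriv α y
      = (symmDeriv β (transition n α β y)).comp (fderiv ℝ (transition n α β) y) := by
  have h1 : MDifferentiableAt 𝓘(ℝ, EuclideanSpace ℝ (Fin n)) 𝓘(ℝ, EuclideanSpace ℝ (Fin n))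
      (transition n α β) y :=
    ((contDiffOn_transition α β).contDiffAt ((isOpen_overlap α β).mem_nhds hy)
      |>.differentiableAt (by norm_num)).mdifferentiableAt
  have h2 : (extChartAt (𝓡 n) α).symm
      =ᶠ[nhds y] (extChartAt (𝓡 n) β).symm ∘ transition n α β := by
    filter_upwards [(isOpen_overlap α β).mem_nhds hy] with z hz using (symm_transition hz).symm
  have h3 := mfderiv_comp y (mdifferentiableAt_symm (mapsTo_transition α β hy)) h1
  change mfderiv 𝓘(ℝ, EuclideanSpace ℝ (Fin n)) (𝓡 n) (extChartAt (𝓡 n) α).symm y = _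
  rw [h2.mfderiv_eq, h3, mfderiv_eq_fderiv]
  rfl

lemma fderiv_eq_sum_single {φ : EuclideanSpace ℝ (Fin n) → EuclideanSpace ℝ (Fin n)}
    (y v : EuclideanSpace ℝ (Fin n)) :
    fderiv ℝ φ y v = ∑ p, (fderiv ℝ φ y v p) • EuclideanSpace.single p (1 : ℝ) := by
  ext j
  simp [Pi.single_apply]

lemma comp_transition (B : TwoTensor n M) {y : EuclideanSpace ℝ (Fin n)}
    (hy : y ∈ overlap n α β) (i j : Fin n) :
    comp B α y i j = ∑ q, (∑ p, fderiv ℝ (transition n α β) y (EuclideanSpace.single i 1) p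
      * comp B β (transition n α β y) p q)
      * fderiv ℝ (transition n α β) y (EuclideanSpace.single j 1) q := by
  simp only [comp_eq_toBilin, symm_transition hy]
  rw [symmDeriv_transition hy, ContinuousLinearMap.comp_apply, ContinuousLinearMap.comp_apply,
    fderiv_eq_sum_single y (EuclideanSpace.single i 1),
    fderiv_eq_sum_single y (EuclideanSpace.single j 1)]
  simp only [map_sum, map_smul, _root_.sum_apply, _root_.smul_apply,
    smul_eq_mul, Finset.mul_sum, Finset.sum_mul]
  simp only [← fderiv_eq_sum_single]
  exact Finset.sum_congr rfl fun _ _ => Finset.sum_congr rfl fun _ _ => by ring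

/-- The components of a 2-tensor that is positive definite at every point. -/
lemma posDef_comp {B : TwoTensor n M} (hs : ∀ x v w, B x v w = B x w v)
    (hpos : ∀ x v, v ≠ 0 → 0 < B x v v) {y : EuclideanSpace ℝ (Fin n)} (hy : y ∈ chartDom n α) :
    (comp B α y).PosDef := by
  have hinj : Function.Injective (symmDeriv α y) := by
    have h1 := (isInvertible_mfderivWithin_extChartAt_symm (I := 𝓡 n) hy).injective
    rw [ModelWithCorners.Boundaryless.range_eq_univ, mfderivWithin_univ] at h1
    exact h1
  refine Matrix.PosDef.of_dotProduct_mulVec_pos ?_ fun v hv => ?_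
  · ext i j
    exact hs _ _ _
  · set w : EuclideanSpace ℝ (Fin n) := ∑ i, v i • EuclideanSpace.single i (1 : ℝ) with hw
    have hw0 : w ≠ 0 := by
      intro h0
      apply hv
      ext j
      have := congrArg (fun z : EuclideanSpace ℝ (Fin n) => z j) h0
      simpa [hw, Pi.single_apply] using this
    have h2 : 0 < toBilin B ((extChartAt (𝓡 n) α).symm y) (symmDeriv α y w) (symmDeriv α y w) :=
      hpos _ _ fun h0 => hw0 (hinj (h0.trans (map_zero _).symm))
    refine lt_of_lt_of_eq h2 ?_
    simp only [hw, map_sum, map_smul, _root_.sum_apply,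
      _root_.smul_apply, smul_eq_mul, dotProduct, mulVec, comp_eq_toBilin,
      Finset.mul_sum, star_trivial]
    rw [Finset.sum_comm]
    exact Finset.sum_congr rfl fun _ _ => Finset.sum_congr rfl fun _ _ => by
      simp [mul_comm, mul_left_comm]

end Charts

/-! ### The flow in the differential rings of the charts -/

section Rings

open Matrix SmoothFn

variable {n : ℕ} {J : Set ℝ} {U : Set (EuclideanSpace ℝ (Fin n))}

lemma evM_eq_mapMatrix {m : Type*} [Fintype m] [DecidableEq m]
    (N : Matrix m m (SmoothFn (J ×ˢ U))) {p : ℝ × EuclideanSpace ℝ (Fin n)}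
    (hp : p ∈ J ×ˢ U) : evM N p = (evalAt hp).toRingHom.mapMatrix N := by
  ext i j
  exact (evalAt_eq hp _).symm

lemma ev_det (N : Matrix (Fin n) (Fin n) (SmoothFn (J ×ˢ U)))
    {p : ℝ × EuclideanSpace ℝ (Fin n)} (hp : p ∈ J ×ˢ U) : N.det.ev p = (evM N p).det := by
  rw [evM_eq_mapMatrix N hp, ← RingHom.map_det]
  exact (evalAt_eq hp _).symm

lemma isUnit_det_of_posDef {N : Matrix (Fin n) (Fin n) (SmoothFn (J ×ˢ U))}
    (hN : ∀ p ∈ J ×ˢ U, (evM N p).PosDef) : IsUnit N.det := by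
  obtain ⟨f, hf⟩ := exists_inverse N.det fun p hp => by
    rw [ev_det N hp]; exact (hN p hp).det_pos.ne'
  exact IsUnit.of_mul_eq_one _ hf

lemma evM_inv {N Ni : Matrix (Fin n) (Fin n) (SmoothFn (J ×ˢ U))} (h : Ni * N = 1)
    {p : ℝ × EuclideanSpace ℝ (Fin n)} (hp : p ∈ J ×ˢ U) : evM Ni p = (evM N p)⁻¹ := by
  refine (Matrix.inv_eq_left_inv ?_).symm
  rw [evM_eq_mapMatrix _ hp, evM_eq_mapMatrix _ hp, ← map_mul, h, map_one]

lemma posDef_evM_inv {N Ni : Matrix (Fin n) (Fin n) (SmoothFn (J ×ˢ U))} (h : Ni * N = 1)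
    (hN : ∀ p ∈ J ×ˢ U, (evM N p).PosDef) {p : ℝ × EuclideanSpace ℝ (Fin n)}
    (hp : p ∈ J ×ˢ U) : (evM Ni p).PosDef := by
  rw [evM_inv h hp]; exact (hN p hp).inv

end Rings

/-! ### Functions on the manifold with compatible chart expressions -/

section Scalars

open Matrix SmoothFn

variable {n : ℕ} {M : Type*} [TopologicalSpace M] [ChartedSpace (EuclideanSpace ℝ (Fin n)) M]
  [IsManifold (𝓡 n) ∞ M] {J : Set ℝ}

lemma mapsTo_id_overlap (α β : M) : MapsTo id (overlap n α β) (chartDom n α) := fun _ hy => hy.1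

/-- Restriction from the chart at `α` to the overlap with the chart at `β`. -/
noncomputable def restrictHom (J : Set ℝ) (α β : M) :
    SmoothFn (J ×ˢ chartDom n α) →+* SmoothFn (J ×ˢ overlap n α β) :=
  pull J contDiffOn_id (mapsTo_id_overlap α β)

/-- Pull-back from the chart at `β` to the overlap in the chart at `α`. -/
noncomputable def transitionHom (J : Set ℝ) (α β : M) :
    SmoothFn (J ×ˢ chartDom n β) →+* SmoothFn (J ×ˢ overlap n α β) :=
  pull J (contDiffOn_transition α β) (mapsTo_transition α β)

lemma ev_restrictHom {α β : M} (f : SmoothFn (J ×ˢ chartDom n α)) {t : ℝ}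
    {y : EuclideanSpace ℝ (Fin n)} (ht : t ∈ J) (hy : y ∈ overlap n α β) :
    (restrictHom J α β f).ev (t, y) = f.ev (t, y) :=
  ev_pull _ _ _ ht hy

lemma ev_transitionHom {α β : M} (f : SmoothFn (J ×ˢ chartDom n β)) {t : ℝ}
    {y : EuclideanSpace ℝ (Fin n)} (ht : t ∈ J) (hy : y ∈ overlap n α β) :
    (transitionHom J α β f).ev (t, y) = f.ev (t, transition n α β y) :=
  ev_pull _ _ _ ht hy

/-- The local functions `u α` define a function on the manifold. -/
def Compat (u : ∀ α : M, SmoothFn (J ×ˢ chartDom n α)) : Prop :=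
  ∀ α β, restrictHom J α β (u α) = transitionHom J α β (u β)

/-- The function `f` on the manifold is given by `u α` in the chart at `α`. -/
def Represents (f : ℝ → M → ℝ) (u : ∀ α : M, SmoothFn (J ×ˢ chartDom n α)) : Prop :=
  ∀ t ∈ J, ∀ α, ∀ y ∈ chartDom n α, f t ((extChartAt (𝓡 n) α).symm y) = (u α).ev (t, y)

variable {u v : ∀ α : M, SmoothFn (J ×ˢ chartDom n α)} {f f' : ℝ → M → ℝ}

lemma Compat.ev_eq (hu : Compat u) {α β : M} {t : ℝ} (ht : t ∈ J)
    {y : EuclideanSpace ℝ (Fin n)} (hy : y ∈ overlap n α β) :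
    (u α).ev (t, y) = (u β).ev (t, transition n α β y) := by
  have h := congrArg (fun q => q.ev (t, y)) (hu α β)
  simp only [ev_restrictHom _ ht hy, ev_transitionHom _ ht hy] at h
  exact h

/-- The scalar invariants at x are defined in the preferred chart at x, and this choice need not
depend continuously on x. Compatibility makes the same formula valid in every chart. -/
lemma Compat.represents (hu : Compat u)
    (h : ∀ t ∈ J, ∀ x, f t x = (u x).ev (t, extChartAt (𝓡 n) x x)) : Represents f u := by
  intro t ht α y hy
  rw [h t ht]
  refine (hu.ev_eq ht (α := α) ⟨hy, ?_⟩).symm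
  exact mem_extChartAt_source _

lemma Represents.apply (h : Represents f u) {t : ℝ} (ht : t ∈ J) {α x : M}
    (hx : x ∈ (extChartAt (𝓡 n) α).source) : f t x = (u α).ev (t, extChartAt (𝓡 n) α x) := by
  have := h t ht α _ ((extChartAt (𝓡 n) α).map_source hx)
  rwa [(extChartAt (𝓡 n) α).left_inv hx] at this

lemma Compat.mul (hu : Compat u) (hv : Compat v) : Compat fun α => u α * v α := fun α β => by
  rw [map_mul, map_mul, hu, hv]

lemma Compat.add (hu : Compat u) (hv : Compat v) : Compat fun α => u α + v α := fun α β => by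
  rw [map_add, map_add, hu, hv]

lemma Compat.pow (hu : Compat u) (k : ℕ) : Compat fun α => u α ^ k := fun α β => by
  rw [map_pow, map_pow, hu]

lemma Represents.mul (h : Represents f u) (h' : Represents f' v) :
    Represents (fun t x => f t x * f' t x) fun α => u α * v α := fun t ht α y hy => by
  have hp : (t, y) ∈ J ×ˢ chartDom n α := mk_mem_prod ht hy
  simp only [h t ht α y hy, h' t ht α y hy, ← evalAt_eq hp, map_mul]

lemma Represents.add (h : Represents f u) (h' : Represents f' v) :
    Represents (fun t x => f t x + f' t x) fun α => u α + v α := fun t ht α y hy => by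
  have hp : (t, y) ∈ J ×ˢ chartDom n α := mk_mem_prod ht hy
  simp only [h t ht α y hy, h' t ht α y hy, ← evalAt_eq hp, map_add]

lemma Represents.smul (h : Represents f u) (c : ℝ) :
    Represents (fun t x => c * f t x) fun α => c • u α := fun t ht α y hy => by
  have hp : (t, y) ∈ J ×ˢ chartDom n α := mk_mem_prod ht hy
  simp only [h t ht α y hy, ← evalAt_eq hp, map_smul, smul_eq_mul]

lemma Represents.pow (h : Represents f u) (k : ℕ) :
    Represents (fun t x => f t x ^ k) fun α => u α ^ k := fun t ht α y hy => by
  have hp : (t, y) ∈ J ×ˢ chartDom n α := mk_mem_prod ht hy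
  simp only [h t ht α y hy, ← evalAt_eq hp, map_pow]

lemma Represents.continuousOn (h : Represents f u) :
    ContinuousOn (fun p : ℝ × M => f p.1 p.2) (J ×ˢ univ) := by
  rintro ⟨t, x⟩ ⟨ht, -⟩
  have hx : x ∈ (extChartAt (𝓡 n) x).source := mem_extChartAt_source x
  have h1 : ContinuousWithinAt (fun p : ℝ × M => (u x).ev (p.1, extChartAt (𝓡 n) x p.2))
      (J ×ˢ (extChartAt (𝓡 n) x).source) (t, x) := by
    have h2 : ContinuousWithinAt (fun p : ℝ × M => (p.1, extChartAt (𝓡 n) x p.2))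
        (J ×ˢ (extChartAt (𝓡 n) x).source) (t, x) :=
      continuousWithinAt_fst.prodMk (((continuousAt_extChartAt x).comp
        (f := fun p : ℝ × M => p.2) (x := (t, x)) continuousAt_snd).continuousWithinAt)
    have h3 : ContinuousWithinAt (u x).ev (J ×ˢ chartDom n x) (t, extChartAt (𝓡 n) x x) :=
      (u x).contDiffOn.continuousOn _ (mk_mem_prod ht ((extChartAt (𝓡 n) x).map_source hx))
    exact ContinuousWithinAt.comp (f := fun p : ℝ × M => (p.1, extChartAt (𝓡 n) x p.2)) h3 h2
      fun p hp => mk_mem_prod hp.1 ((extChartAt (𝓡 n) x).map_source hp.2)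
  have h3 : ContinuousWithinAt (fun p : ℝ × M => f p.1 p.2)
      (J ×ˢ (extChartAt (𝓡 n) x).source) (t, x) :=
    h1.congr (fun p hp => h.apply hp.1 hp.2) (h.apply ht hx)
  refine h3.mono_of_mem_nhdsWithin ?_
  refine mem_nhdsWithin.mpr ⟨univ ×ˢ (extChartAt (𝓡 n) x).source,
    isOpen_univ.prod (isOpen_extChartAt_source x), ⟨mem_univ _, hx⟩, ?_⟩
  rintro p ⟨hp1, hp2⟩
  exact ⟨hp2.1, hp1.2⟩

lemma Represents.continuous (h : Represents f u) {t : ℝ} (ht : t ∈ J) : Continuous (f t) := by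
  have h1 : Continuous fun x : M => (t, x) := by fun_prop
  exact h.continuousOn.comp_continuous h1 fun x => ⟨ht, mem_univ _⟩

end Scalars

/-! ### The flow in a chart and chart independence of its scalar invariants -/

namespace IsFlow

open Matrix SmoothFn

variable {n : ℕ} {M : Type*} [TopologicalSpace M] [ChartedSpace (EuclideanSpace ℝ (Fin n)) M]
  [IsManifold (𝓡 n) ∞ M] {J : Set ℝ} {g : ℝ → Metric n M} {h : ℝ → TwoTensor n M}
  (F : IsFlow g h J)

/-- The matrix of the metric in the chart at `α`. -/
noncomputable def gM (α : M) : Matrix (Fin n) (Fin n) (SmoothFn (J ×ˢ chartDom n α)) :=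
  Matrix.of fun i j => SmoothFn.of _ (F.smooth_g α i j)

/-- The matrix of the tensor in the chart at `α`. -/
noncomputable def hM (α : M) : Matrix (Fin n) (Fin n) (SmoothFn (J ×ˢ chartDom n α)) :=
  Matrix.of fun i j => SmoothFn.of _ (F.smooth_h α i j)

/-- The inverse of the matrix of the metric. -/
noncomputable def giM (α : M) : Matrix (Fin n) (Fin n) (SmoothFn (J ×ˢ chartDom n α)) :=
  (F.gM α)⁻¹

lemma ev_gM (α : M) {t : ℝ} (ht : t ∈ J) {y : EuclideanSpace ℝ (Fin n)}
    (hy : y ∈ chartDom n α) (i j : Fin n) :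
    (F.gM α i j).ev (t, y) = comp (g t).inner α y i j :=
  ev_of (F.smooth_g α i j) (mk_mem_prod ht hy)

lemma ev_hM (α : M) {t : ℝ} (ht : t ∈ J) {y : EuclideanSpace ℝ (Fin n)}
    (hy : y ∈ chartDom n α) (i j : Fin n) :
    (F.hM α i j).ev (t, y) = comp (h t) α y i j :=
  ev_of (F.smooth_h α i j) (mk_mem_prod ht hy)

lemma isSlice_gM (α : M) {t : ℝ} (ht : t ∈ J) : IsSlice t (comp (g t).inner α) (F.gM α) :=
  fun _ hz _ _ => (F.ev_gM α ht hz _ _).symm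

lemma isSlice_hM (α : M) {t : ℝ} (ht : t ∈ J) : IsSlice t (comp (h t) α) (F.hM α) :=
  fun _ hz _ _ => (F.ev_hM α ht hz _ _).symm

lemma gM_symm (α : M) : (F.gM α)ᵀ = F.gM α := by
  ext i j
  refine ext_ev ?_
  rintro ⟨t, y⟩ ⟨ht, hy⟩
  rw [transpose_apply, ← F.isSlice_gM α ht y hy, ← F.isSlice_gM α ht y hy]
  exact (g t).symm _ _ _

lemma hM_symm (α : M) : (F.hM α)ᵀ = F.hM α := by
  ext i j
  refine ext_ev ?_
  rintro ⟨t, y⟩ ⟨ht, hy⟩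
  rw [transpose_apply, ← F.isSlice_hM α ht y hy, ← F.isSlice_hM α ht y hy]
  exact F.symm_h t ht _ _ _

lemma evM_gM (α : M) {p : ℝ × EuclideanSpace ℝ (Fin n)} (hp : p ∈ J ×ˢ chartDom n α) :
    evM (F.gM α) p = comp (g p.1).inner α p.2 := by
  ext i j
  exact (F.isSlice_gM α hp.1 p.2 hp.2 i j).symm

lemma posDef_gM (α : M) {p : ℝ × EuclideanSpace ℝ (Fin n)} (hp : p ∈ J ×ˢ chartDom n α) :
    (evM (F.gM α) p).PosDef := by
  rw [F.evM_gM α hp]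
  exact posDef_comp (g p.1).symm (g p.1).pos hp.2

lemma giM_mul (α : M) : F.giM α * F.gM α = 1 :=
  Matrix.nonsing_inv_mul _ (isUnit_det_of_posDef fun _ hp => F.posDef_gM α hp)

lemma posDef_giM (α : M) {p : ℝ × EuclideanSpace ℝ (Fin n)} (hp : p ∈ J ×ˢ chartDom n α) :
    (evM (F.giM α) p).PosDef :=
  posDef_evM_inv (F.giM_mul α) (fun _ hp => F.posDef_gM α hp) hp

/-- The volume density in the chart at `α`. -/
noncomputable def wM (α : M) : SmoothFn (J ×ˢ chartDom n α) :=
  (F.gM α).det.sqrt fun p hp => by rw [ev_det _ hp]; exact (F.posDef_gM α hp).det_pos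

lemma wM_mul_wM (α : M) : F.wM α * F.wM α = (F.gM α).det := sqrt_mul_sqrt _ _

lemma ev_wM (α : M) {p : ℝ × EuclideanSpace ℝ (Fin n)} (hp : p ∈ J ×ˢ chartDom n α) :
    (F.wM α).ev p = Real.sqrt (comp (g p.1).inner α p.2).det := by
  rw [wM, SmoothFn.sqrt, ev_of _ hp, ev_det _ hp, F.evM_gM α hp]

lemma wM_pos (α : M) {p : ℝ × EuclideanSpace ℝ (Fin n)} (hp : p ∈ J ×ˢ chartDom n α) :
    0 < (F.wM α).ev p := by
  rw [F.ev_wM α hp, ← F.evM_gM α hp]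
  exact Real.sqrt_pos.mpr (F.posDef_gM α hp).det_pos

lemma exists_wM_inv (α : M) : ∃ w', F.wM α * w' = 1 :=
  exists_inverse _ fun _ hp => (F.wM_pos α hp).ne'

variable (hJ : UniqueDiffOn ℝ J)

/-- The coordinate derivations of the chart at `α`. -/
noncomputable abbrev _root_.IntrinsicMCF.dM (hJ : UniqueDiffOn ℝ J) (α : M) (i : Fin n) :
    Derivation ℝ (SmoothFn (J ×ˢ chartDom n α)) (SmoothFn (J ×ˢ chartDom n α)) :=
  dd (uniqueDiffOn_prod hJ (isOpen_chartDom α)) i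

/-- The time derivation of the chart at `α`. -/
noncomputable abbrev _root_.IntrinsicMCF.tM (hJ : UniqueDiffOn ℝ J) (α : M) :
    Derivation ℝ (SmoothFn (J ×ˢ chartDom n α)) (SmoothFn (J ×ˢ chartDom n α)) :=
  dt (uniqueDiffOn_prod hJ (isOpen_chartDom α))

/-- The Christoffel symbols in the chart at `α`. -/
noncomputable abbrev ΓM (α : M) : Fin n → Matrix (Fin n) (Fin n) (SmoothFn (J ×ˢ chartDom n α)) :=
  koszul (dM hJ α) (F.gM α) (F.giM α)

lemma leviCivita_ΓM (α : M) : LeviCivita (dM hJ α) (F.gM α) (F.ΓM hJ α) :=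
  leviCivita_koszul (F.gM_symm α) (F.giM_mul α)

lemma time_deriv_gM (α : M) : Dm (tM hJ α) (F.gM α)
    = gVelocity (dM hJ α) (F.ΓM hJ α) (F.gM α) (F.giM α) (F.hM α) := by
  ext i j
  refine ext_ev ?_
  rintro ⟨t, y⟩ ⟨ht, hy⟩
  have h1 := hasDerivWithinAt_time (hS := uniqueDiffOn_prod hJ (isOpen_chartDom α)) (F.gM α i j)
    ht hy (φ := fun s => comp (g s).inner α y i j) fun s hs => F.isSlice_gM α hs y hy i j
  have h2 := F.evol_g t ht α y hy i j
  rw [metricVelocity_eq (hS := uniqueDiffOn_prod hJ (isOpen_chartDom α)) (isOpen_chartDom α) ht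
    (F.giM_mul α) (F.isSlice_gM α ht) (F.isSlice_hM α ht) hy (F.hM_symm α)] at h2
  exact (hJ t ht).eq_deriv _ h1 h2

lemma time_deriv_hM (α : M) : Dm (tM hJ α) (F.hM α)
    = hVelocity (dM hJ α) (F.ΓM hJ α) (F.gM α) (F.giM α) (F.hM α) := by
  ext i j
  refine ext_ev ?_
  rintro ⟨t, y⟩ ⟨ht, hy⟩
  have h1 := hasDerivWithinAt_time (hS := uniqueDiffOn_prod hJ (isOpen_chartDom α)) (F.hM α i j)
    ht hy (φ := fun s => comp (h s) α y i j) fun s hs => F.isSlice_hM α hs y hy i j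
  have h2 := F.evol_h t ht α y hy i j
  rw [tensorVelocity_eq (hS := uniqueDiffOn_prod hJ (isOpen_chartDom α)) (isOpen_chartDom α) ht
    (F.giM_mul α) (F.isSlice_gM α ht) (F.isSlice_hM α ht) hy (F.hM_symm α) (F.gM_symm α)] at h2
  exact (hJ t ht).eq_deriv _ h1 h2

/-- The derivations on the overlap of the charts at `α` and `β`. -/
noncomputable abbrev _root_.IntrinsicMCF.dO (hJ : UniqueDiffOn ℝ J) (α β : M) (i : Fin n) :
    Derivation ℝ (SmoothFn (J ×ˢ overlap n α β)) (SmoothFn (J ×ˢ overlap n α β)) :=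
  dd (uniqueDiffOn_prod hJ (isOpen_overlap α β)) i

lemma map_giM_mul (α β : M) :
    (F.giM α).map (restrictHom J α β) * (F.gM α).map (restrictHom J α β) = 1 := by
  rw [← Matrix.map_mul, F.giM_mul, Matrix.map_one _ (map_zero _) (map_one _)]

/-- Restriction to the overlap counts as a coordinate change with identity Jacobian. The expressions
from two charts can then be compared in the ring of the overlap, one by restriction and the other by
the transition map. -/
lemma coordChange_restrict (hJ' : J ⊆ closure (interior J)) (α β : M) :
    CoordChange (dO hJ α β) (dM hJ α) (restrictHom J α β)
      (jac (uniqueDiffOn_prod hJ (isOpen_overlap α β)) contDiffOn_id)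
      (jac (uniqueDiffOn_prod hJ (isOpen_overlap α β)) contDiffOn_id)⁻¹
      ((F.gM α).map (restrictHom J α β)) ((F.giM α).map (restrictHom J α β))
      ((F.hM α).map (restrictHom J α β)) (F.gM α) (F.giM α) (F.hM α)
      (koszul (dO hJ α β) ((F.gM α).map (restrictHom J α β))
        ((F.giM α).map (restrictHom J α β))) (F.ΓM hJ α) := by
  have h1 : jac (uniqueDiffOn_prod hJ (isOpen_overlap (n := n) α β)) contDiffOn_id = 1 := by
    ext p i
    refine ext_ev ?_
    rintro ⟨t, y⟩ ⟨ht, hy⟩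
    have hp : (t, y) ∈ J ×ˢ overlap n α β := mk_mem_prod ht hy
    rw [ev_jac (isOpen_overlap α β) _ ht hy, fderiv_id, ← evalAt_eq hp]
    rcases eq_or_ne p i with rfl | hpi
    · simp
    · simp [hpi]
  refine coordChange_pull hJ' (isOpen_overlap α β) (isOpen_chartDom α) contDiffOn_id
    (mapsTo_id_overlap α β) ?_ (F.gM_symm α) (F.map_giM_mul α β) (F.giM_mul α) ?_ ?_
  · rw [← transpose_map, F.gM_symm]
  · rw [h1, transpose_one, Matrix.one_mul, Matrix.mul_one]; rfl
  · rw [h1, transpose_one, Matrix.one_mul, Matrix.mul_one]; rfl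

lemma map_restrict_eq (α β : M) {B : ℝ → TwoTensor n M}
    {N : ∀ α, Matrix (Fin n) (Fin n) (SmoothFn (J ×ˢ chartDom n α))}
    (hN : ∀ t ∈ J, ∀ α, IsSlice t (comp (B t) α) (N α)) :
    (N α).map (restrictHom J α β)
      = (jac (uniqueDiffOn_prod hJ (isOpen_overlap α β)) (contDiffOn_transition α β))ᵀ
        * (N β).map (transitionHom J α β)
        * jac (uniqueDiffOn_prod hJ (isOpen_overlap α β)) (contDiffOn_transition α β) := by
  ext i j
  refine ext_ev ?_
  rintro ⟨t, y⟩ ⟨ht, hy⟩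
  have hp : (t, y) ∈ J ×ˢ overlap n α β := mk_mem_prod ht hy
  rw [map_apply, ev_restrictHom _ ht hy, ← hN t ht α y hy.1, comp_transition _ hy]
  simp only [mul_apply, transpose_apply, map_apply, ← evalAt_eq hp, map_sum, map_mul]
  simp only [evalAt_eq hp, ev_jac (isOpen_overlap α β) _ ht hy, ev_transitionHom _ ht hy, hN t ht β _ (mapsTo_transition α β hy)]

lemma coordChange_transition (hJ' : J ⊆ closure (interior J)) (α β : M) :
    CoordChange (dO hJ α β) (dM hJ β) (transitionHom J α β)
      (jac (uniqueDiffOn_prod hJ (isOpen_overlap α β)) (contDiffOn_transition α β))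
      (jac (uniqueDiffOn_prod hJ (isOpen_overlap α β)) (contDiffOn_transition α β))⁻¹
      ((F.gM α).map (restrictHom J α β)) ((F.giM α).map (restrictHom J α β))
      ((F.hM α).map (restrictHom J α β)) (F.gM β) (F.giM β) (F.hM β)
      (koszul (dO hJ α β) ((F.gM α).map (restrictHom J α β))
        ((F.giM α).map (restrictHom J α β))) (F.ΓM hJ β) :=
  coordChange_pull hJ' (isOpen_overlap α β) (isOpen_chartDom β) (contDiffOn_transition α β)
    (mapsTo_transition α β) (by rw [← transpose_map, F.gM_symm]) (F.gM_symm β)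
    (F.map_giM_mul α β) (F.giM_mul β)
    (map_restrict_eq hJ α β fun _ ht α => F.isSlice_gM α ht)
    (map_restrict_eq hJ α β fun _ ht α => F.isSlice_hM α ht)

section

variable (hJ' : J ⊆ closure (interior J))

include hJ hJ'

lemma compat_trace : Compat fun α => (F.giM α * F.hM α).trace := fun α β =>
  (F.coordChange_restrict hJ hJ' α β).meanCurv_eq.symm.trans
    (F.coordChange_transition hJ hJ' α β).meanCurv_eq

lemma compat_normSq : Compat fun α => (F.giM α * F.hM α * (F.giM α * F.hM α)).trace :=
  fun α β => (F.coordChange_restrict hJ hJ' α β).normSq_eq.symm.trans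
    (F.coordChange_transition hJ hJ' α β).normSq_eq

lemma compat_nablaSq : Compat fun α => nablaSq (dM hJ α) (F.ΓM hJ α) (F.giM α) (F.hM α) :=
  fun α β => (F.coordChange_restrict hJ hJ' α β).nablaSq_eq.symm.trans
    (F.coordChange_transition hJ hJ' α β).nablaSq_eq

lemma compat_curvSq :
    Compat fun α => curvSq (dM hJ α) (F.ΓM hJ α) (F.gM α) (F.giM α) (F.hM α) :=
  fun α β => (F.coordChange_restrict hJ hJ' α β).curvSq_eq.symm.trans
    (F.coordChange_transition hJ hJ' α β).curvSq_eq

lemma compat_gradInner {u v : ∀ α : M, SmoothFn (J ×ˢ chartDom n α)} (hu : Compat u)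
    (hv : Compat v) : Compat fun α => gradInner (dM hJ α) (F.giM α) (u α) (v α) := by
  intro α β
  rw [← (F.coordChange_restrict hJ hJ' α β).gradInner_eq, hu, hv,
    (F.coordChange_transition hJ hJ' α β).gradInner_eq]

end

end IsFlow

/-! ### The Gauss and Codazzi equations are preserved -/

section Algebra

open Matrix
open scoped Kronecker

variable {A : Type*} [CommRing A] [Algebra ℝ A] {ι : Type*} [Fintype ι] [DecidableEq ι]
  {d : ι → Derivation ℝ A A} {g gi h : Matrix ι ι A} {Γ : ι → Matrix ι ι A}

/-- Used with ε the evaluation at a point of initial time. Gauss and Codazzi kill the tangential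
block and the bottom row of F, and skewness for the Lorentzian form kills the last column. -/
lemma map_curv_bundleConn_eq_zero {Q : Type*} [CommRing Q] [Algebra ℝ Q]
    (hd : ∀ i j x, d i (d j x) = d j (d i x)) (ε : A →+* Q) (L : LeviCivita d g Γ)
    (hgi : gi * g = 1) (hh : hᵀ = h)
    (hG : ∀ i j k l, ε ((g * curv d Γ i j) k l) = -(ε (h i k) * ε (h j l) - ε (h i l) * ε (h j k)))
    (hC : ∀ i j k, ε (nabla d Γ h i j k) = ε (nabla d Γ h j i k)) (i j : ι) (a b : ι ⊕ Unit) :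
    ε (curv d (bundleConn Γ gi h) i j a b) = 0 := by
  have hs : ∀ a b, h a b = h b a := fun a b => congrFun (congrFun hh b) a
  have hgi' : g * gi = 1 := mul_eq_one_comm.mp hgi
  have h11 : ∀ a c, ε (curv d (bundleConn Γ gi h) i j (Sum.inl a) (Sum.inl c)) = 0 := by
    intro a c
    have e : curv d Γ i j = gi * (g * curv d Γ i j) := by
      rw [← Matrix.mul_assoc, hgi, Matrix.one_mul]
    rw [curv_bundleConn_inl_inl, e]
    simp only [mul_apply (M := gi), map_add, map_sub, map_mul, map_sum, hG, Finset.sum_mul,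
      ← Finset.sum_add_distrib, ← Finset.sum_sub_distrib]
    refine Finset.sum_eq_zero fun k _ => ?_
    rw [hs i k, hs j k]; ring
  have h21 : ∀ u c, ε (curv d (bundleConn Γ gi h) i j (Sum.inr u) (Sum.inl c)) = 0 := by
    intro u c
    rw [curv_bundleConn_inr_inl L, map_sub, hC, sub_self]
  have hskew := curv_skew hd (bundleConn_compat L hgi' hh) i j
  set Φ := curv d (bundleConn Γ gi h) i j with hΦ
  have h12 : ∀ a u, ε (Φ (Sum.inl a) (Sum.inr u)) = 0 := by
    intro a u
    have h1 : ∀ b, (g * of fun c (_ : Unit) => Φ (Sum.inl c) (Sum.inr u)) b u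
        = Φ (Sum.inr u) (Sum.inl b) := by
      intro b
      have := congrFun (congrFun hskew (Sum.inl b)) (Sum.inr u)
      simp only [bundleForm, Matrix.add_apply, mul_apply, Fintype.sum_sum_type, fromBlocks_apply₁₁,
        fromBlocks_apply₁₂, fromBlocks_apply₂₂, transpose_apply, Matrix.zero_apply, zero_mul,
        mul_zero, Finset.sum_const_zero, add_zero, zero_add, Finset.univ_unique,
        Finset.sum_singleton, Matrix.neg_apply] at this
      rw [mul_apply]
      simp only [of_apply]
      have h3 : (1 : Matrix Unit Unit A) default u = 1 := by
        rw [Subsingleton.elim default u, one_apply_eq]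
      rw [h3, Subsingleton.elim default u] at this
      linear_combination this
    have h2 : Φ (Sum.inl a) (Sum.inr u) = ∑ b, gi a b * Φ (Sum.inr u) (Sum.inl b) := by
      have : (of fun c (_ : Unit) => Φ (Sum.inl c) (Sum.inr u))
          = gi * (g * of fun c (_ : Unit) => Φ (Sum.inl c) (Sum.inr u)) := by
        rw [← Matrix.mul_assoc, hgi, Matrix.one_mul]
      have h3 := congrFun (congrFun this a) u
      rw [mul_apply] at h3
      simpa [h1] using h3
    rw [h2, map_sum]
    exact Finset.sum_eq_zero fun b _ => by rw [map_mul, h21, mul_zero]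
  have h22 : ∀ u u', ε (Φ (Sum.inr u) (Sum.inr u')) = 0 := by
    intro u u'
    have := congrFun (congrFun hskew (Sum.inr u)) (Sum.inr u')
    simp only [bundleForm, Matrix.add_apply, mul_apply, Fintype.sum_sum_type, fromBlocks_apply₂₁,
        fromBlocks_apply₁₂, fromBlocks_apply₂₂, transpose_apply, Matrix.zero_apply, zero_mul,
        mul_zero, Finset.sum_const_zero, add_zero, zero_add, Finset.univ_unique,
        Finset.sum_singleton, Matrix.neg_apply] at this
    rw [Subsingleton.elim u default, Subsingleton.elim u' default] at *
    rw [one_apply_eq] at this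
    have h3 : Φ (Sum.inr default) (Sum.inr default) + Φ (Sum.inr default) (Sum.inr default) = 0 := by
      linear_combination -this
    rw [double_cancel h3, map_zero]
  rcases a with a | a <;> rcases b with b | b
  exacts [h11 a b, h12 a b, h21 a b, h22 a b]

/-- The matrix of the quadratic form `curvSq` in the components of the curvature. -/
def curvForm (g gi : Matrix ι ι A) :
    Matrix ((ι × ι) × ((ι ⊕ Unit) × (ι ⊕ Unit))) ((ι × ι) × ((ι ⊕ Unit) × (ι ⊕ Unit))) A :=
  (gi ⊗ₖ gi) ⊗ₖ (frameForm g ⊗ₖ frameForm gi)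

lemma frameForm_transpose (hg : gᵀ = g) : (frameForm g)ᵀ = frameForm g := by
  simp [frameForm, fromBlocks_transpose, hg]

lemma curvForm_transpose (hg : gᵀ = g) (hgi : giᵀ = gi) :
    (curvForm g gi)ᵀ = curvForm g gi := by
  have e : ∀ {m k : Type _} (P : Matrix m m A) (R : Matrix k k A), (P ⊗ₖ R)ᵀ = Pᵀ ⊗ₖ Rᵀ :=
    fun P R => by ext; simp
  rw [curvForm, e, e, e, hgi, frameForm_transpose hg, frameForm_transpose hgi]

lemma curvSq_eq_curvForm (hgi : giᵀ = gi) : curvSq d Γ g gi h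
    = ∑ x, ∑ y, curvForm g gi x y * (bundleCurv d Γ gi h x * bundleCurv d Γ gi h y) := by
  have hs : ∀ a b, frameForm gi a b = frameForm gi b a := fun a b =>
    congrFun (congrFun (frameForm_transpose hgi) b) a
  simp only [curvSq, Matrix.trace, diag, mul_apply, transpose_apply, Fintype.sum_prod_type,
    curvForm, kroneckerMap_apply, bundleCurv, Finset.mul_sum, Finset.sum_mul]
  refine Finset.sum_congr rfl fun i _ => ?_
  have r1 : ∀ f : ι → ι → ι → A, ∑ k, ∑ j, ∑ l, f k j l = ∑ j, ∑ k, ∑ l, f k j l :=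
    fun f => Finset.sum_comm
  rw [r1]
  refine Finset.sum_congr rfl fun j _ => ?_
  have r2 : ∀ f : ι → ι → (ι ⊕ Unit) → (ι ⊕ Unit) → (ι ⊕ Unit) → (ι ⊕ Unit) → A,
      ∑ k, ∑ l, ∑ b, ∑ e, ∑ c, ∑ a, f k l b e c a = ∑ a, ∑ b, ∑ k, ∑ l, ∑ c, ∑ e, f k l b e c a := by
    intro f
    have q1 : ∀ k l, ∑ b, ∑ e, ∑ c, ∑ a, f k l b e c a = ∑ a, ∑ b, ∑ c, ∑ e, f k l b e c a := by
      intro k l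
      calc _ = ∑ b, ∑ c, ∑ e, ∑ a, f k l b e c a :=
            Finset.sum_congr rfl fun _ _ => Finset.sum_comm
        _ = ∑ b, ∑ c, ∑ a, ∑ e, f k l b e c a :=
            Finset.sum_congr rfl fun _ _ => Finset.sum_congr rfl fun _ _ => Finset.sum_comm
        _ = ∑ b, ∑ a, ∑ c, ∑ e, f k l b e c a :=
            Finset.sum_congr rfl fun _ _ => Finset.sum_comm
        _ = _ := Finset.sum_comm
    simp only [q1]
    have q2 : ∀ φ : ι → ι → (ι ⊕ Unit) → A, ∑ k, ∑ l, ∑ a, φ k l a = ∑ a, ∑ k, ∑ l, φ k l a := by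
      intro φ
      calc _ = ∑ k, ∑ a, ∑ l, φ k l a := Finset.sum_congr rfl fun _ _ => Finset.sum_comm
        _ = _ := Finset.sum_comm
    rw [q2]
    exact Finset.sum_congr rfl fun a _ => q2 _
  rw [r2]
  refine Finset.sum_congr rfl fun a _ => Finset.sum_congr rfl fun b _ =>
    Finset.sum_congr rfl fun k _ => Finset.sum_congr rfl fun l _ =>
    Finset.sum_congr rfl fun c _ => Finset.sum_congr rfl fun e _ => ?_
  rw [hs e b]; ring

end Algebra

section PosDef

open Matrix

lemma posDef_frameForm {ι : Type*} [Fintype ι] [DecidableEq ι] {N : Matrix ι ι ℝ}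
    (hN : N.PosDef) : (frameForm N).PosDef := by
  refine Matrix.PosDef.of_dotProduct_mulVec_pos ?_ fun v hv => ?_
  · have := hN.isHermitian
    rw [Matrix.IsHermitian, conjTranspose_eq_transpose_of_trivial] at this
    rw [Matrix.IsHermitian, conjTranspose_eq_transpose_of_trivial, frameForm_transpose this]
  · have h1 : star v ⬝ᵥ frameForm N *ᵥ v
        = (star (v ∘ Sum.inl) ⬝ᵥ N *ᵥ (v ∘ Sum.inl)) + v (Sum.inr ()) ^ 2 := by
      simp [dotProduct, mulVec, frameForm, Fintype.sum_sum_type, sq]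
    rw [h1]
    by_cases h2 : v ∘ Sum.inl = 0
    · have h3 : v (Sum.inr ()) ≠ 0 := by
        intro h3
        apply hv
        ext (a | a)
        · exact congrFun h2 a
        · exact h3
      rw [h2]
      simp only [mulVec_zero, dotProduct_zero, zero_add]
      positivity
    · exact add_pos_of_pos_of_nonneg (hN.dotProduct_mulVec_pos h2) (sq_nonneg _)

end PosDef

/-! ### Vanishing of the Gauss-Codazzi tensor along the flow -/

namespace IsFlow

open Matrix SmoothFn Filter Topology
open scoped Kronecker

variable {n : ℕ} {M : Type*} [TopologicalSpace M] [ChartedSpace (EuclideanSpace ℝ (Fin n)) M]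
  [IsManifold (𝓡 n) ∞ M] {J : Set ℝ} {g : ℝ → Metric n M} {h : ℝ → TwoTensor n M}
  (F : IsFlow g h J) (hJ : UniqueDiffOn ℝ J)

lemma giM_symm (α : M) : (F.giM α)ᵀ = F.giM α := by
  rw [giM, transpose_nonsing_inv, F.gM_symm]

/-- The Gauss-Codazzi tensor in the chart at `α`. -/
noncomputable abbrev curvM (α : M) :
    (Fin n × Fin n) × ((Fin n ⊕ Unit) × (Fin n ⊕ Unit)) → SmoothFn (J ×ˢ chartDom n α) :=
  bundleCurv (dM hJ α) (F.ΓM hJ α) (F.giM α) (F.hM α)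

/-- The squared norm of the Gauss-Codazzi tensor in the chart at `α`. -/
noncomputable abbrev defectM (α : M) : SmoothFn (J ×ˢ chartDom n α) :=
  curvSq (dM hJ α) (F.ΓM hJ α) (F.gM α) (F.giM α) (F.hM α)

lemma posDef_curvForm (α : M) {p : ℝ × EuclideanSpace ℝ (Fin n)}
    (hp : p ∈ J ×ˢ chartDom n α) : (evM (curvForm (F.gM α) (F.giM α)) p).PosDef := by
  have h1 : ∀ N : Matrix (Fin n) (Fin n) (SmoothFn (J ×ˢ chartDom n α)),
      evM (frameForm N) p = frameForm (evM N p) := by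
    intro N
    rw [evM_eq_mapMatrix _ hp, evM_eq_mapMatrix _ hp]
    simp [frameForm, fromBlocks_map, Matrix.map_zero, Matrix.map_one]
  have h2 : evM (curvForm (F.gM α) (F.giM α)) p
      = (evM (F.giM α) p ⊗ₖ evM (F.giM α) p)
        ⊗ₖ (frameForm (evM (F.gM α) p) ⊗ₖ frameForm (evM (F.giM α) p)) := by
    rw [← h1, ← h1]
    ext x y
    simp only [evM, curvForm, kroneckerMap_apply, of_apply, ← evalAt_eq hp, map_mul]
  rw [h2]
  exact ((F.posDef_giM α hp).kronecker (F.posDef_giM α hp)).kronecker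
    ((posDef_frameForm (F.posDef_gM α hp)).kronecker (posDef_frameForm (F.posDef_giM α hp)))

lemma ev_defectM (α : M) {p : ℝ × EuclideanSpace ℝ (Fin n)} (hp : p ∈ J ×ˢ chartDom n α) :
    (F.defectM hJ α).ev p = star (fun x => (F.curvM hJ α x).ev p)
      ⬝ᵥ evM (curvForm (F.gM α) (F.giM α)) p *ᵥ fun x => (F.curvM hJ α x).ev p := by
  rw [defectM, curvSq_eq_curvForm (F.giM_symm α)]
  simp only [← evalAt_eq hp, map_sum, map_mul, dotProduct, mulVec, evM, of_apply,
      Finset.mul_sum, star_trivial, Pi.star_apply]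
  exact Finset.sum_congr rfl fun _ _ => Finset.sum_congr rfl fun _ _ => by ring

lemma defectM_nonneg (α : M) {p : ℝ × EuclideanSpace ℝ (Fin n)} (hp : p ∈ J ×ˢ chartDom n α) :
    0 ≤ (F.defectM hJ α).ev p := by
  rw [F.ev_defectM hJ α hp]
  exact (F.posDef_curvForm α hp).posSemidef.dotProduct_mulVec_nonneg _

lemma curvM_eq_zero_of_defectM (α : M) {p : ℝ × EuclideanSpace ℝ (Fin n)}
    (hp : p ∈ J ×ˢ chartDom n α) (h0 : (F.defectM hJ α).ev p = 0)
    (x : (Fin n × Fin n) × ((Fin n ⊕ Unit) × (Fin n ⊕ Unit))) : (F.curvM hJ α x).ev p = 0 := by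
  by_contra hx
  have h1 : (fun x => (F.curvM hJ α x).ev p) ≠ 0 := fun h1 => hx (congrFun h1 x)
  have := (F.posDef_curvForm α hp).dotProduct_mulVec_pos h1
  rw [← F.ev_defectM hJ α hp, h0] at this
  exact lt_irrefl _ this

lemma curvM_eq_zero_of_isSpaceLike (hJ' : J ⊆ closure (interior J)) {t : ℝ} (ht : t ∈ J)
    (hS : IsSpaceLike (g t) (h t)) (α : M)
    {y : EuclideanSpace ℝ (Fin n)} (hy : y ∈ chartDom n α)
    (x : (Fin n × Fin n) × ((Fin n ⊕ Unit) × (Fin n ⊕ Unit))) :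
    (F.curvM hJ α x).ev (t, y) = 0 := by
  have hp : (t, y) ∈ J ×ˢ chartDom n α := mk_mem_prod ht hy
  have := map_curv_bundleConn_eq_zero (dd_comm hJ' (isOpen_chartDom α)) (evalAt hp).toRingHom
    (F.leviCivita_ΓM hJ α) (F.giM_mul α) (F.hM_symm α) ?_ ?_ x.1.1 x.1.2 x.2.1 x.2.2
  · rw [← evalAt_eq hp]; exact this
  · intro i j k l
    have h1 := hS.gauss α y hy i j k l
    rw [riemann_eq (hS := uniqueDiffOn_prod hJ (isOpen_chartDom α)) (isOpen_chartDom α) ht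
      (F.giM_mul α) (F.isSlice_gM α ht) hy] at h1
    simp only [← F.ev_hM α ht hy, ← evalAt_eq hp] at h1
    exact h1
  · intro i j k
    have h1 := hS.codazzi α y hy i j k
    rw [covDeriv_eq (hS := uniqueDiffOn_prod hJ (isOpen_chartDom α)) (isOpen_chartDom α) ht
      (F.giM_mul α) (F.isSlice_gM α ht) (F.isSlice_hM α ht) hy,
      covDeriv_eq (hS := uniqueDiffOn_prod hJ (isOpen_chartDom α)) (isOpen_chartDom α) ht
      (F.giM_mul α) (F.isSlice_gM α ht) (F.isSlice_hM α ht) hy] at h1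
    simp only [← evalAt_eq hp] at h1
    exact h1

/-- The Gauss and Codazzi equations are preserved along the flow. -/
theorem curv_bundleConn_eq_zero [CompactSpace M] (hJc : J.OrdConnected)
    (hJ' : J ⊆ closure (interior J)) (hJ0 : IsLeast J 0) (hinit : IsSpaceLike (g 0) (h 0))
    (α : M) (i j : Fin n) :
    curv (dM hJ α) (bundleConn (F.ΓM hJ α) (F.giM α) (F.hM α)) i j = 0 := by
  set u : ℝ → M → ℝ := fun t x => (F.defectM hJ x).ev (t, extChartAt (𝓡 n) x x) with hu
  have hrep : Represents u (F.defectM hJ) :=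
    (F.compat_curvSq hJ hJ').represents fun _ _ _ => rfl
  have hmem : ∀ {t : ℝ} (_ : t ∈ J) (x : M),
      (t, extChartAt (𝓡 n) x x) ∈ J ×ˢ chartDom n x := fun ht x =>
    mk_mem_prod ht ((extChartAt (𝓡 n) x).map_source (mem_extChartAt_source x))
  have hzero : ∀ t ∈ J, ∀ x, u t x = 0 := by
    intro t ht x
    refine eq_zero_of_deriv_le_at_max hJc hJ0 hrep.continuousOn (fun x => ?_)
      (fun t ht x => F.defectM_nonneg hJ x (hmem ht x)) (fun t ht x => ?_) ht x
    · rw [hu]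
      simp only
      rw [F.ev_defectM hJ x (hmem hJ0.1 x)]
      have : (fun z => (F.curvM hJ x z).ev (0, extChartAt (𝓡 n) x x)) = 0 := by
        funext z
        exact F.curvM_eq_zero_of_isSpaceLike hJ hJ' hJ0.1 hinit x (hmem hJ0.1 x).2 z
      rw [this]; simp
    -- The heat equation has chart-dependent lower-order terms, so the inequality is obtained in the
    -- chart at x, with a constant valid near (t, x).
    · obtain ⟨C, hC⟩ := eventually_heat_quadratic_le (hS := uniqueDiffOn_prod hJ (isOpen_chartDom x))
        (isOpen_chartDom x) (v := F.curvM hJ x) (K := curvForm (F.gM x) (F.giM x))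
        (gi := F.giM x) (curvForm_transpose (F.gM_symm x) (F.giM_symm x))
        (bundleCurv_heat (dd_comm hJ' (isOpen_chartDom x)) (dt_dd_comm hJ' (isOpen_chartDom x))
          (F.leviCivita_ΓM hJ x) (F.giM_mul x) (F.hM_symm x) (F.time_deriv_gM hJ x)
          (F.time_deriv_hM hJ x))
        (fun p hp => F.posDef_curvForm x hp) (fun p hp => F.posDef_giM x hp) (hmem ht x)
      rw [← curvSq_eq_curvForm (F.giM_symm x)] at hC
      refine ⟨C, ?_⟩
      have hx : x ∈ (extChartAt (𝓡 n) x).source := mem_extChartAt_source x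
      have hnhds : J ×ˢ (extChartAt (𝓡 n) x).source ∈ 𝓝[J ×ˢ univ] (t, x) :=
        mem_nhdsWithin.mpr ⟨univ ×ˢ (extChartAt (𝓡 n) x).source,
          isOpen_univ.prod (isOpen_extChartAt_source x), ⟨mem_univ _, hx⟩,
          fun p hp => ⟨hp.2.1, hp.1.2⟩⟩
      have htend : Tendsto (fun p : ℝ × M => (p.1, extChartAt (𝓡 n) x p.2)) (𝓝[J ×ˢ univ] (t, x))
          (𝓝[J ×ˢ chartDom n x] (t, extChartAt (𝓡 n) x x)) := by
        refine tendsto_nhdsWithin_iff.mpr ⟨?_, ?_⟩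
        · have h2 : ContinuousAt (fun p : ℝ × M => (p.1, extChartAt (𝓡 n) x p.2)) (t, x) :=
            continuousAt_fst.prodMk ((continuousAt_extChartAt x).comp
              (f := fun p : ℝ × M => p.2) (x := (t, x)) continuousAt_snd)
          exact h2.tendsto.mono_left nhdsWithin_le_nhds
        · filter_upwards [hnhds] with p hp using
            mk_mem_prod hp.1 ((extChartAt (𝓡 n) x).map_source hp.2)
      filter_upwards [htend.eventually hC, hnhds] with p hCp hp
      have hp2 := (extChartAt (𝓡 n) x).map_source hp.2
      refine ⟨(tM hJ x (F.defectM hJ x)).ev (p.1, extChartAt (𝓡 n) x p.2),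
        hasDerivWithinAt_time _ hp.1 hp2 fun s hs => hrep.apply hs hp.2, fun hmax => ?_⟩
      rw [hrep.apply hp.1 hp.2]
      -- A maximum over M is in particular one over the chart domain, because the chart expressions
      -- represent one function u.
      refine hCp fun z hz => ?_
      change (F.defectM hJ x).ev (p.1, z) ≤ (F.defectM hJ x).ev (p.1, _)
      rw [← hrep p.1 hp.1 x z hz, ← hrep.apply hp.1 hp.2]
      exact hmax (mem_univ _)
  ext a b
  refine ext_ev ?_
  rintro ⟨t, y⟩ ⟨ht, hy⟩
  have hp : (t, y) ∈ J ×ˢ chartDom n α := mk_mem_prod ht hy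
  rw [Matrix.zero_apply, ← evalAt_eq hp 0, map_zero]
  exact F.curvM_eq_zero_of_defectM hJ α hp
    (by rw [← hrep t ht α y hy]; exact hzero t ht _) ((i, j), (a, b))

end IsFlow

/-! ### The scalar invariants in the differential rings -/

section Bridge

open Matrix SmoothFn

variable {n : ℕ} {J : Set ℝ} {U : Set (EuclideanSpace ℝ (Fin n))}
  {hS : UniqueDiffOn ℝ (J ×ˢ U)} {t : ℝ}
  {G K : MatrixField n} {g gi h : Matrix (Fin n) (Fin n) (SmoothFn (J ×ˢ U))}
  (hU : IsOpen U) (ht : t ∈ J) (hgi : gi * g = 1) (hG : IsSlice t G g) (hK : IsSlice t K h)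
  {y : EuclideanSpace ℝ (Fin n)} (hy : y ∈ U)

include ht hgi hG hy

include hU in
lemma normSqGrad_eq {φ : EuclideanSpace ℝ (Fin n) → ℝ} {f : SmoothFn (J ×ˢ U)}
    (hφ : ∀ z ∈ U, φ z = f.ev (t, z)) :
    normSqGrad G φ y = (gradInner (dd hS) gi f f).ev (t, y) := by
  have hp : (t, y) ∈ J ×ˢ U := mk_mem_prod ht hy
  simp only [normSqGrad, gradInner, pd_eq (hS := hS) hU ht hφ hy, inv_slice ht hgi hG y hy,
    ← evalAt_eq hp, map_sum, map_mul, mul_assoc]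

include hK

include hU in
lemma normSqCovDeriv_eq (hh : hᵀ = h) (hg : gᵀ = g) : normSqCovDeriv G K y
    = (nablaSq (dd hS) (koszul (dd hS) g gi) gi h).ev (t, y) := by
  have hp : (t, y) ∈ J ×ˢ U := mk_mem_prod ht hy
  have hs : ∀ i a b, nabla (dd hS) (koszul (dd hS) g gi) h i a b
      = nabla (dd hS) (koszul (dd hS) g gi) h i b a :=
    fun i a b => congrFun (congrFun (nabla_symm hh i) b) a
  have hgs : ∀ a b, gi a b = gi b a := fun a b => by
    have h1 := (leviCivita_koszul (d := dd hS) hg hgi).inv_symm hgi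
    exact congrFun (congrFun h1 b) a
  simp only [normSqCovDeriv, nablaSq, covDeriv_eq (hS := hS) hU ht hgi hG hK hy,
    inv_slice ht hgi hG y hy, ← evalAt_eq hp, map_sum, map_mul, Matrix.trace, diag, mul_apply,
    Finset.mul_sum, Finset.sum_mul]
  refine Finset.sum_congr rfl fun i _ => Finset.sum_congr rfl fun j _ => ?_
  have r : ∀ f : Fin n → Fin n → Fin n → Fin n → ℝ,
      ∑ k, ∑ l, ∑ p, ∑ q, f k l p q = ∑ l, ∑ p, ∑ q, ∑ k, f k l p q := by
    intro f
    calc _ = ∑ l, ∑ k, ∑ p, ∑ q, f k l p q := Finset.sum_comm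
      _ = ∑ l, ∑ p, ∑ k, ∑ q, f k l p q := Finset.sum_congr rfl fun _ _ => Finset.sum_comm
      _ = _ := Finset.sum_congr rfl fun _ _ => Finset.sum_congr rfl fun _ _ => Finset.sum_comm
  rw [r]
  exact Finset.sum_congr rfl fun l _ => Finset.sum_congr rfl fun p _ =>
    Finset.sum_congr rfl fun q _ => Finset.sum_congr rfl fun k _ => by
      rw [hs j l q, hgs k l]; ring

/-- After raising an index the trace-free part is g⁻¹h - (H/n)·1. As tr 1 = n, the trace of its
square is |A|² - H²/n. -/
lemma traceless_normSq_eq (hn : n ≠ 0) (hh : hᵀ = h) (hg : gᵀ = g) :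
    normSq G (traceless G K) y = ((gi * h * (gi * h)).trace
      - (1 / n : ℝ) • (gi * h).trace ^ 2).ev (t, y) := by
  have hp : (t, y) ∈ J ×ˢ U := mk_mem_prod ht hy
  set c : SmoothFn (J ×ˢ U) := (1 / n : ℝ) • (gi * h).trace with hc
  have h1 : IsSlice t (traceless G K) (h - c • g) := by
    intro z hz i j
    have hp : (t, z) ∈ J ×ˢ U := mk_mem_prod ht hz
    simp only [traceless, trace_eq ht hgi hG hK hz hh, Matrix.sub_apply, Matrix.smul_apply,
      smul_eq_mul, hK z hz, hG z hz, hc, ← evalAt_eq hp, map_sub, map_mul, map_smul]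
    ring
  rw [normSq_eq ht hgi hG h1 hy (by rw [transpose_sub, transpose_smul, hh, hg]) hg]
  congr 1
  have h2 : gi * (h - c • g) = gi * h - c • 1 := by
    rw [Matrix.mul_sub, Matrix.mul_smul, hgi]
  have hn' : (n : ℝ) ≠ 0 := by exact_mod_cast hn
  have h3 : (n : SmoothFn (J ×ˢ U)) * c = (gi * h).trace := by
    rw [hc, mul_smul_comm, ← nsmul_eq_mul, ← Nat.cast_smul_eq_nsmul ℝ, smul_smul,
      one_div_mul_cancel hn', one_smul]
  have h4 : (1 / n : ℝ) • (gi * h).trace ^ 2 = c * (gi * h).trace := by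
    rw [hc, smul_mul_assoc, sq]
  rw [h2, h4]
  simp only [Matrix.sub_mul, Matrix.mul_sub, Matrix.smul_mul, Matrix.mul_smul, Matrix.one_mul,
    Matrix.mul_one, trace_sub, trace_smul, trace_one, Fintype.card_fin, smul_eq_mul]
  linear_combination c * h3

end Bridge

/-! ### Nonnegativity of the norms -/

section Nonneg

open Matrix
open scoped Kronecker

variable {n : ℕ} {G K : MatrixField n} {y : EuclideanSpace ℝ (Fin n)}

lemma normSqGrad_nonneg (hG : (G y)⁻¹.PosSemidef) (φ : EuclideanSpace ℝ (Fin n) → ℝ) :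
    0 ≤ normSqGrad G φ y := by
  refine (hG.dotProduct_mulVec_nonneg fun i => pd i φ y).trans_eq ?_
  simp only [normSqGrad, dotProduct, mulVec, star_trivial, Finset.mul_sum, Pi.star_apply]
  exact Finset.sum_congr rfl fun _ _ => Finset.sum_congr rfl fun _ _ => by ring

/-- Norms of tensors are quadratic forms of Kronecker powers of g⁻¹, which remain positive
semidefinite. -/
lemma normSq_nonneg (hG : (G y)⁻¹.PosSemidef) : 0 ≤ normSq G K y := by
  refine ((hG.kronecker hG).dotProduct_mulVec_nonneg fun x => K y x.1 x.2).trans_eq ?_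
  simp only [normSq, dotProduct, mulVec, star_trivial, Finset.mul_sum, Pi.star_apply,
    Fintype.sum_prod_type, kroneckerMap_apply]
  refine Finset.sum_congr rfl fun i _ => ?_
  rw [Finset.sum_comm]
  exact Finset.sum_congr rfl fun _ _ => Finset.sum_congr rfl fun _ _ =>
    Finset.sum_congr rfl fun _ _ => by ring

lemma normSqCovDeriv_nonneg (hG : (G y)⁻¹.PosSemidef) : 0 ≤ normSqCovDeriv G K y := by
  refine ((hG.kronecker (hG.kronecker hG)).dotProduct_mulVec_nonneg
    fun x => covDeriv G K x.1 x.2.1 x.2.2 y).trans_eq ?_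
  simp only [normSqCovDeriv, dotProduct, mulVec, star_trivial, Finset.mul_sum, Pi.star_apply,
    Fintype.sum_prod_type, kroneckerMap_apply]
  refine Finset.sum_congr rfl fun i _ => ?_
  have r : ∀ f : Fin n → Fin n → Fin n → Fin n → Fin n → ℝ,
      ∑ k, ∑ p, ∑ j, ∑ l, ∑ q, f k p j l q = ∑ j, ∑ k, ∑ l, ∑ p, ∑ q, f k p j l q := by
    intro f
    calc _ = ∑ k, ∑ j, ∑ p, ∑ l, ∑ q, f k p j l q :=
          Finset.sum_congr rfl fun _ _ => Finset.sum_comm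
      _ = ∑ j, ∑ k, ∑ p, ∑ l, ∑ q, f k p j l q := Finset.sum_comm
      _ = _ := Finset.sum_congr rfl fun _ _ => Finset.sum_congr rfl fun _ _ => Finset.sum_comm
  rw [r]
  exact Finset.sum_congr rfl fun _ _ => Finset.sum_congr rfl fun _ _ =>
    Finset.sum_congr rfl fun _ _ => Finset.sum_congr rfl fun _ _ =>
    Finset.sum_congr rfl fun _ _ => by ring

end Nonneg

section ScalarNonneg

variable {n : ℕ} {M : Type*} [TopologicalSpace M] [ChartedSpace (EuclideanSpace ℝ (Fin n)) M]
  [IsManifold (𝓡 n) ∞ M] (g : Metric n M) (h : TwoTensor n M) (x : M)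

lemma posSemidef_inv_comp : (comp g.inner x (extChartAt (𝓡 n) x x))⁻¹.PosSemidef :=
  (posDef_comp g.symm g.pos ((extChartAt (𝓡 n) x).map_source (mem_extChartAt_source x))).inv
    |>.posSemidef

lemma normA_sq : normA g h x ^ 2
    = normSq (comp g.inner x) (comp h x) (extChartAt (𝓡 n) x x) :=
  Real.sq_sqrt (normSq_nonneg (posSemidef_inv_comp g x))

lemma gradHSq_nonneg : 0 ≤ gradHSq g h x := normSqGrad_nonneg (posSemidef_inv_comp g x) _

lemma gradASq_nonneg : 0 ≤ gradASq g h x := normSqCovDeriv_nonneg (posSemidef_inv_comp g x)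

lemma gradNormASq_nonneg : 0 ≤ gradNormASq g h x := normSqGrad_nonneg (posSemidef_inv_comp g x) _

lemma tracelessSq_nonneg : 0 ≤ tracelessSq g h x := normSq_nonneg (posSemidef_inv_comp g x)

lemma normA_nonneg : 0 ≤ normA g h x := Real.sqrt_nonneg _

end ScalarNonneg

/-! ### Chart expressions of the integrands -/

namespace IsFlow

open Matrix SmoothFn

variable {n : ℕ} {M : Type*} [TopologicalSpace M] [ChartedSpace (EuclideanSpace ℝ (Fin n)) M]
  [IsManifold (𝓡 n) ∞ M] {J : Set ℝ} {g : ℝ → Metric n M} {h : ℝ → TwoTensor n M}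
  (F : IsFlow g h J) (hJ : UniqueDiffOn ℝ J) (hJ' : J ⊆ closure (interior J))

/-- The mean curvature in the chart at `α`. -/
noncomputable abbrev meanM (α : M) : SmoothFn (J ×ˢ chartDom n α) := (F.giM α * F.hM α).trace

/-- The squared norm of `h` in the chart at `α`. -/
noncomputable abbrev normM (α : M) : SmoothFn (J ×ˢ chartDom n α) :=
  (F.giM α * F.hM α * (F.giM α * F.hM α)).trace

lemma _root_.IntrinsicMCF.extChartAt_mem_chartDom (x : M) :
    extChartAt (𝓡 n) x x ∈ chartDom n x :=
  (extChartAt (𝓡 n) x).map_source (mem_extChartAt_source x)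

include hJ hJ'

lemma represents_meanCurv : Represents (fun t x => meanCurv (g t) (h t) x) F.meanM :=
  (F.compat_trace hJ hJ').represents fun _ ht x =>
    trace_eq ht (F.giM_mul x) (F.isSlice_gM x ht) (F.isSlice_hM x ht) (extChartAt_mem_chartDom x)
      (F.hM_symm x)

lemma represents_normA_sq : Represents (fun t x => normA (g t) (h t) x ^ 2) F.normM :=
  (F.compat_normSq hJ hJ').represents fun _ ht x => by
    rw [normA_sq]
    exact normSq_eq ht (F.giM_mul x) (F.isSlice_gM x ht) (F.isSlice_hM x ht)
      (extChartAt_mem_chartDom x) (F.hM_symm x) (F.gM_symm x)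

lemma represents_gradHSq : Represents (fun t x => gradHSq (g t) (h t) x)
    fun α => gradInner (dM hJ α) (F.giM α) (F.meanM α) (F.meanM α) :=
  (F.compat_gradInner hJ hJ' (F.compat_trace hJ hJ') (F.compat_trace hJ hJ')).represents
    fun _ ht x => normSqGrad_eq (isOpen_chartDom x) ht (F.giM_mul x) (F.isSlice_gM x ht)
      (extChartAt_mem_chartDom x) fun _ hz => trace_eq ht (F.giM_mul x) (F.isSlice_gM x ht)
        (F.isSlice_hM x ht) hz (F.hM_symm x)

lemma represents_gradNormASq : Represents (fun t x => gradNormASq (g t) (h t) x)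
    fun α => gradInner (dM hJ α) (F.giM α) (F.normM α) (F.normM α) :=
  (F.compat_gradInner hJ hJ' (F.compat_normSq hJ hJ') (F.compat_normSq hJ hJ')).represents
    fun _ ht x => normSqGrad_eq (isOpen_chartDom x) ht (F.giM_mul x) (F.isSlice_gM x ht)
      (extChartAt_mem_chartDom x) fun _ hz => normSq_eq ht (F.giM_mul x) (F.isSlice_gM x ht)
        (F.isSlice_hM x ht) hz (F.hM_symm x) (F.gM_symm x)

lemma represents_gradASq : Represents (fun t x => gradASq (g t) (h t) x)
    fun α => nablaSq (dM hJ α) (F.ΓM hJ α) (F.giM α) (F.hM α) :=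
  (F.compat_nablaSq hJ hJ').represents fun _ ht x =>
    normSqCovDeriv_eq (isOpen_chartDom x) ht (F.giM_mul x) (F.isSlice_gM x ht)
      (F.isSlice_hM x ht) (extChartAt_mem_chartDom x) (F.hM_symm x) (F.gM_symm x)

lemma compat_tracelessSq : Compat fun α => F.normM α - (1 / n : ℝ) • F.meanM α ^ 2 := by
  have hc : Compat fun α : M => (algebraMap ℝ (SmoothFn (J ×ˢ chartDom n α)) (-(1 / n))) := by
    intro α β
    refine ext_ev ?_
    rintro ⟨t, y⟩ ⟨ht, hy⟩
    rw [ev_restrictHom _ ht hy, ev_transitionHom _ ht hy,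
      ← evalAt_eq (mk_mem_prod ht (overlap_subset α β hy)),
      ← evalAt_eq (mk_mem_prod ht (mapsTo_transition α β hy)), AlgHom.commutes, AlgHom.commutes]
  have h1 := (F.compat_normSq hJ hJ').add (hc.mul ((F.compat_trace hJ hJ').pow 2))
  have h2 : (fun α => F.normM α - (1 / n : ℝ) • F.meanM α ^ 2)
      = fun α => F.normM α + algebraMap ℝ _ (-(1 / n)) * F.meanM α ^ 2 := by
    funext α
    rw [← Algebra.smul_def, neg_smul, sub_eq_add_neg]
  rw [h2]
  exact h1

lemma represents_tracelessSq (hn : n ≠ 0) : Represents (fun t x => tracelessSq (g t) (h t) x)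
    fun α => F.normM α - (1 / n : ℝ) • F.meanM α ^ 2 :=
  (F.compat_tracelessSq hJ hJ').represents fun _ ht x =>
    traceless_normSq_eq ht (F.giM_mul x) (F.isSlice_gM x ht)
      (F.isSlice_hM x ht) (extChartAt_mem_chartDom x) hn (F.hM_symm x) (F.gM_symm x)

end IsFlow

/-! ### Integrals against compactly supported functions in a coordinate domain -/

section LocalIntegrals

open SmoothFn Filter Topology

lemma continuous_mul_of_tsupport {X : Type*} [TopologicalSpace X] {U : Set X} (hU : IsOpen U)
    {χ f : X → ℝ} (hχ : Continuous χ) (hχU : tsupport χ ⊆ U) (hf : ContinuousOn f U) :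
    Continuous fun y => χ y * f y := by
  rw [continuous_iff_continuousAt]
  intro y
  by_cases hy : y ∈ tsupport χ
  · exact hχ.continuousAt.mul (hf.continuousAt (hU.mem_nhds (hχU hy)))
  · have h1 : (fun y => χ y * f y) =ᶠ[𝓝 y] fun _ => 0 := by
      filter_upwards [(isClosed_tsupport χ).isOpen_compl.mem_nhds hy] with z hz
      rw [image_eq_zero_of_notMem_tsupport hz, zero_mul]
    exact continuousAt_const.congr h1.symm

variable {n : ℕ} {J : Set ℝ} {U : Set (EuclideanSpace ℝ (Fin n))}

lemma integrable_mul_of_tsupport (hU : IsOpen U) {χ f : EuclideanSpace ℝ (Fin n) → ℝ}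
    (hχ : Continuous χ) (hχc : HasCompactSupport χ) (hχU : tsupport χ ⊆ U)
    (hf : ContinuousOn f U) : Integrable fun y => χ y * f y :=
  (continuous_mul_of_tsupport hU hχ hχU hf).integrable_of_hasCompactSupport hχc.mul_right

lemma continuousOn_ev_slice (f : SmoothFn (J ×ˢ U)) {t : ℝ} (ht : t ∈ J) :
    ContinuousOn (fun y => f.ev (t, y)) U :=
  f.contDiffOn.continuousOn.comp (by fun_prop) fun _ hy => mk_mem_prod ht hy

/-- Supplies a compact time interval on which difference quotients are dominated. If t is the last
point of J, it ends at t itself. -/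
lemma exists_Icc_mem_nhdsWithin (hJ : J.OrdConnected) (hJ0 : IsLeast J 0) {t : ℝ} (ht : t ∈ J) :
    ∃ b, t ∈ Icc 0 b ∧ Icc 0 b ⊆ J ∧ Icc 0 b ∈ 𝓝[J] t := by
  by_cases h : ∃ b ∈ J, t < b
  · obtain ⟨b, hb, htb⟩ := h
    refine ⟨b, ⟨hJ0.2 ht, htb.le⟩, hJ.out hJ0.1 hb, ?_⟩
    refine mem_nhdsWithin.mpr ⟨Iio b, isOpen_Iio, htb, fun s hs => ⟨hJ0.2 hs.2, hs.1.le⟩⟩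
  · push Not at h
    refine ⟨t, ⟨hJ0.2 ht, le_rfl⟩, hJ.out hJ0.1 ht, ?_⟩
    exact mem_of_superset self_mem_nhdsWithin fun s hs => ⟨hJ0.2 hs, h s hs⟩

variable {hS : UniqueDiffOn ℝ (J ×ˢ U)} {χ : EuclideanSpace ℝ (Fin n) → ℝ}

/-- Differentiation under the integral sign. -/
lemma hasDerivWithinAt_integral (hJ : J.OrdConnected) (hJ0 : IsLeast J 0) (hU : IsOpen U)
    (hχ : Continuous χ) (hχc : HasCompactSupport χ) (hχU : tsupport χ ⊆ U)
    (f : SmoothFn (J ×ˢ U)) {t : ℝ} (ht : t ∈ J) :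
    HasDerivWithinAt (fun s => ∫ y, χ y * f.ev (s, y)) (∫ y, χ y * (dt hS f).ev (t, y)) J t := by
  obtain ⟨b, htb, hbJ, hb⟩ := exists_Icc_mem_nhdsWithin hJ hJ0 ht
  obtain ⟨C, hC⟩ : ∃ C, ∀ p ∈ Icc 0 b ×ˢ tsupport χ, ‖(dt hS f).ev p‖ ≤ C :=
    (isCompact_Icc.prod hχc).exists_bound_of_continuousOn
      ((dt hS f).contDiffOn.continuousOn.mono (prod_mono hbJ hχU))
  have hint : ∀ s ∈ J, Integrable fun y => χ y * f.ev (s, y) := fun s hs =>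
    integrable_mul_of_tsupport hU hχ hχc hχU (continuousOn_ev_slice f hs)
  rw [hasDerivWithinAt_iff_tendsto_slope]
  have hev : ∀ᶠ s in 𝓝[J \ {t}] t, s ∈ Icc 0 b :=
    nhdsWithin_mono t sdiff_subset hb
  have hslope : ∀ᶠ s in 𝓝[J \ {t}] t, slope (fun s => ∫ y, χ y * f.ev (s, y)) t s
      = ∫ y, χ y * slope (fun s => f.ev (s, y)) t s := by
    filter_upwards [hev] with s hs
    rw [slope_def_field, ← integral_sub (hint s (hbJ hs)) (hint t ht), ← integral_div]
    refine integral_congr_ae (Eventually.of_forall fun y => ?_)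
    simp only [slope_def_field]
    ring
  refine Tendsto.congr' (EventuallyEq.symm hslope) ?_
  -- By the mean value inequality the slopes are bounded by the supremum C of the time derivative
  -- over the compact set [0, b] × supp χ.
  refine tendsto_integral_filter_of_dominated_convergence (fun y => |χ y| * C) ?_ ?_ ?_ ?_
  · filter_upwards [hev] with s hs
    have h1 : (fun y => χ y * slope (fun s => f.ev (s, y)) t s)
        = fun y => (χ y * f.ev (s, y) - χ y * f.ev (t, y)) / (s - t) := by
      funext y
      rw [slope_def_field]; ring
    rw [h1]
    exact (((hint s (hbJ hs)).sub (hint t ht)).div_const _).aestronglyMeasurable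
  · filter_upwards [hev, self_mem_nhdsWithin] with s hs hst
    refine Eventually.of_forall fun y => ?_
    by_cases hy : y ∈ tsupport χ
    · have h1 := (convex_Icc 0 b).norm_image_sub_le_of_norm_hasDerivWithin_le
        (f := fun r => f.ev (r, y)) (f' := fun r => (dt hS f).ev (r, y))
        (fun r hr => (hasDerivWithinAt_time f (hbJ hr) (hχU hy) fun _ _ => rfl).mono hbJ)
        (fun r hr => hC (r, y) (mk_mem_prod hr hy)) htb hs
      rw [norm_mul, slope_def_field, norm_div]
      refine mul_le_mul_of_nonneg_left ?_ (abs_nonneg _)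
      rw [div_le_iff₀ (norm_pos_iff.mpr (sub_ne_zero.mpr hst.2))]
      exact h1
    · rw [image_eq_zero_of_notMem_tsupport hy]; simp
  · exact (hχ.abs.integrable_of_hasCompactSupport hχc.abs).mul_const C
  · refine Eventually.of_forall fun y => ?_
    by_cases hy : y ∈ tsupport χ
    · have h1 := hasDerivWithinAt_time (hS := hS) f ht (hχU hy) (φ := fun s => f.ev (s, y))
        fun _ _ => rfl
      exact (hasDerivWithinAt_iff_tendsto_slope.mp h1).const_mul _
    · simp only [image_eq_zero_of_notMem_tsupport hy, zero_mul]
      exact tendsto_const_nhds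

/-- Integration by parts. -/
lemma integral_mul_dd (hU : IsOpen U) (hχ : ContDiff ℝ ∞ χ) (hχc : HasCompactSupport χ)
    (hχU : tsupport χ ⊆ U) (f : SmoothFn (J ×ˢ U)) {t : ℝ} (ht : t ∈ J) (l : Fin n) :
    ∫ y, χ y * (dd hS l f).ev (t, y) = -∫ y, pd l χ y * f.ev (t, y) := by
  have hχ' : Continuous (pd l χ) := by
    have := hχ.continuous_fderiv (by norm_num)
    exact this.clm_apply continuous_const
  have hsupp : tsupport (pd l χ) ⊆ tsupport χ :=
    (tsupport_fderiv_apply_subset ℝ (EuclideanSpace.single l 1))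
  have h0 : (fun y => χ y * (dd hS l f).ev (t, y)) = fun y => χ y *
      fderiv ℝ (fun z => f.ev (t, z)) y (EuclideanSpace.single l 1) := by
    funext y
    by_cases hy : y ∈ tsupport χ
    · rw [fderiv_slice (hS := hS) hU f ht (fun _ _ => rfl) (hχU hy)]; rfl
    · rw [image_eq_zero_of_notMem_tsupport hy]; simp
  rw [h0]
  refine integral_mul_fderiv_eq_neg_fderiv_mul_of_integrable ?_ ?_ ?_ ?_ ?_
  · exact integrable_mul_of_tsupport hU hχ' (hχc.mono' (subset_tsupport _ |>.trans hsupp))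
      (hsupp.trans hχU) (continuousOn_ev_slice f ht)
  · rw [← h0]
    exact integrable_mul_of_tsupport hU hχ.continuous hχc hχU (continuousOn_ev_slice _ ht)
  · exact integrable_mul_of_tsupport hU hχ.continuous hχc hχU (continuousOn_ev_slice f ht)
  · exact fun y _ => (hχ.differentiable (by norm_num)) y
  · exact fun y hy => (hasFDerivAt_slice hU f ht (fun _ _ => rfl) (hχU hy)).differentiableAt

end LocalIntegrals

/-! ### The volume measure -/

section Localize

open Filter Topology

variable {n : ℕ} {M : Type*} [TopologicalSpace M] [T2Space M] [CompactSpace M]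
  [ChartedSpace (EuclideanSpace ℝ (Fin n)) M] [IsManifold (𝓡 n) ∞ M]

variable (n) in
/-- The coordinate expression of a function supported in the chart at `α`, extended by zero. -/
noncomputable def localize (α : M) (f : M → ℝ) : EuclideanSpace ℝ (Fin n) → ℝ :=
  (chartDom n α).indicator fun y => f ((extChartAt (𝓡 n) α).symm y)

variable {α : M} {f : M → ℝ}

lemma localize_of_mem {y : EuclideanSpace ℝ (Fin n)} (hy : y ∈ chartDom n α) :
    localize n α f y = f ((extChartAt (𝓡 n) α).symm y) :=
  indicator_of_mem hy _

lemma isCompact_image_tsupport (hf : tsupport f ⊆ (extChartAt (𝓡 n) α).source) :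
    IsCompact (extChartAt (𝓡 n) α '' tsupport f) :=
  (isClosed_tsupport f).isCompact.image_of_continuousOn ((continuousOn_extChartAt α).mono hf)

lemma image_tsupport_subset (hf : tsupport f ⊆ (extChartAt (𝓡 n) α).source) :
    extChartAt (𝓡 n) α '' tsupport f ⊆ chartDom n α := by
  rintro _ ⟨x, hx, rfl⟩
  exact (extChartAt (𝓡 n) α).map_source (hf hx)

lemma localize_eq_zero {y : EuclideanSpace ℝ (Fin n)}
    (hy : y ∉ extChartAt (𝓡 n) α '' tsupport f) : localize n α f y = 0 := by
  by_cases hyU : y ∈ chartDom n α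
  · rw [localize_of_mem hyU]
    by_contra h
    exact hy ⟨_, subset_tsupport _ h, (extChartAt (𝓡 n) α).right_inv hyU⟩
  · exact indicator_of_notMem hyU _

lemma hasCompactSupport_localize (hf : tsupport f ⊆ (extChartAt (𝓡 n) α).source) :
    HasCompactSupport (localize n α f) :=
  HasCompactSupport.intro (isCompact_image_tsupport hf) fun _ hy => localize_eq_zero hy

lemma tsupport_localize (hf : tsupport f ⊆ (extChartAt (𝓡 n) α).source) :
    tsupport (localize n α f) ⊆ chartDom n α := by
  refine (closure_minimal (fun y hy => ?_) (isCompact_image_tsupport hf).isClosed).trans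
    (image_tsupport_subset hf)
  by_contra h
  exact hy (localize_eq_zero h)

lemma contDiffOn_comp_symm {f : M → ℝ} (hf : ContMDiff (𝓡 n) 𝓘(ℝ, ℝ) ∞ f) (α : M) :
    ContDiffOn ℝ ∞ (fun y => f ((extChartAt (𝓡 n) α).symm y)) (chartDom n α) :=
  (hf.comp_contMDiffOn (contMDiffOn_extChartAt_symm α)).contDiffOn

lemma contDiff_localize (hf : tsupport f ⊆ (extChartAt (𝓡 n) α).source)
    (hf' : ContMDiff (𝓡 n) 𝓘(ℝ, ℝ) ∞ f) : ContDiff ℝ ∞ (localize n α f) := by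
  rw [contDiff_iff_contDiffAt]
  intro y
  by_cases hy : y ∈ extChartAt (𝓡 n) α '' tsupport f
  · have hyU := image_tsupport_subset hf hy
    have h1 := (contDiffOn_comp_symm hf' α).contDiffAt ((isOpen_chartDom α).mem_nhds hyU)
    refine h1.congr_of_eventuallyEq ?_
    filter_upwards [(isOpen_chartDom α).mem_nhds hyU] with z hz using localize_of_mem hz
  · refine contDiffAt_const (c := (0 : ℝ)) |>.congr_of_eventuallyEq ?_
    filter_upwards [(isCompact_image_tsupport hf).isClosed.isOpen_compl.mem_nhds hy] with z hz
      using localize_eq_zero hz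

end Localize

/-! ### Integrals against the volume measure -/

section Volume

open Filter Topology

variable {n : ℕ} {M : Type*} [TopologicalSpace M] [T2Space M] [CompactSpace M]
  [ChartedSpace (EuclideanSpace ℝ (Fin n)) M] [IsManifold (𝓡 n) ∞ M]

lemma tsupport_chartPartition (α : M) :
    tsupport (chartPartition n M α) ⊆ (extChartAt (𝓡 n) α).source := by
  rw [extChartAt_source]
  exact Classical.choose_spec (SmoothPartitionOfUnity.exists_isSubordinate_chartAt_source (𝓡 n) M) α

variable (n M) in
/-- The finitely many charts that contribute to the partition of unity. -/
noncomputable def activeCharts : Finset M :=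
  ((chartPartition n M).locallyFinite.finite_nonempty_of_compact).toFinset

lemma chartPartition_eq_zero {α : M} (hα : α ∉ activeCharts n M) (x : M) :
    chartPartition n M α x = 0 := by
  by_contra h
  exact hα ((Set.Finite.mem_toFinset _).mpr ⟨x, h⟩)

lemma sum_chartPartition (x : M) : ∑ α ∈ activeCharts n M, chartPartition n M α x = 1 := by
  rw [← (chartPartition n M).sum_eq_one (mem_univ x), finsum_eq_sum_of_support_subset]
  intro α hα
  by_contra h
  exact hα (chartPartition_eq_zero h x)

variable (n) in
/-- The partition function of the chart at `α` in coordinates. -/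
noncomputable abbrev cutoff (α : M) : EuclideanSpace ℝ (Fin n) → ℝ :=
  localize n α (chartPartition n M α)

lemma contDiff_cutoff (α : M) : ContDiff ℝ ∞ (cutoff n α) :=
  contDiff_localize (tsupport_chartPartition α) (chartPartition n M α).contMDiff

variable [MeasurableSpace M] [BorelSpace M]

/-- By compactness only finitely many partition functions are nonzero, so the measure is a finite
sum of finite measures and continuous functions integrate chart by chart. -/
lemma integrable_vol_and_integral_vol {g : Metric n M}
    (hw : ∀ α : M, ContinuousOn (fun y => Real.sqrt (comp g.inner α y).det) (chartDom n α))
    {f : M → ℝ} (hf : Continuous f) :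
    Integrable f (vol g) ∧ ∫ x, f x ∂(vol g) = ∑ α ∈ activeCharts n M, ∫ y, cutoff n α y *
      (f ((extChartAt (𝓡 n) α).symm y) * Real.sqrt (comp g.inner α y).det) := by
  set D : M → EuclideanSpace ℝ (Fin n) → ℝ := fun α y =>
    chartPartition n M α ((extChartAt (𝓡 n) α).symm y) * Real.sqrt (comp g.inner α y).det with hD
  set μ : M → Measure M := fun α => Measure.map (extChartAt (𝓡 n) α).symm
      ((volume.restrict (extChartAt (𝓡 n) α).target).withDensity fun y => ENNReal.ofReal (D α y))
    with hμ
  have hmeas : ∀ α : M, MeasurableSet (chartDom n α) := fun α => (isOpen_chartDom α).measurableSet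
  have h0 : ∀ α ∉ activeCharts n M, μ α = 0 := by
    intro α hα
    simp only [hμ, hD, chartPartition_eq_zero hα, zero_mul, ENNReal.ofReal_zero]
    rw [show (fun _ : EuclideanSpace ℝ (Fin n) => (0 : ENNReal)) = 0 from rfl, withDensity_zero,
      Measure.map_zero]
  have h1 : vol g = ∑ α ∈ activeCharts n M, μ α := by
    ext s hs
    rw [vol, Measure.sum_apply _ hs, Measure.finsetSum_apply, tsum_eq_sum]
    intro α hα
    change μ α s = 0
    rw [h0 α hα]; rfl
  have hDc : ∀ α, ContinuousOn (D α) (chartDom n α) := fun α =>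
    ((chartPartition n M α).contMDiff.continuous.comp_continuousOn
      (continuousOn_extChartAt_symm α)).mul (hw α)
  have hDi : ∀ α, IntegrableOn (D α) (chartDom n α) := by
    intro α
    have := (integrable_mul_of_tsupport (isOpen_chartDom α) (contDiff_cutoff α).continuous
      (hasCompactSupport_localize (tsupport_chartPartition α))
      (tsupport_localize (tsupport_chartPartition α)) (hw α)).integrableOn (s := chartDom n α)
    refine this.congr_fun (fun y hy => ?_) (hmeas α)
    simp only [cutoff, localize_of_mem hy, hD]
  have hfin : ∀ α, IsFiniteMeasure (μ α) := fun α => by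
    have := isFiniteMeasure_withDensity_ofReal (hDi α).2
    infer_instance
  have hfm : StronglyMeasurable f := hf.measurable.stronglyMeasurable
  have hint : ∀ α, Integrable f (μ α) := by
    intro α
    obtain ⟨C, hC⟩ := isCompact_univ.exists_bound_of_continuousOn hf.continuousOn
    exact Integrable.of_bound hfm.aestronglyMeasurable C
      (Eventually.of_forall fun x => hC x (mem_univ _))
  rw [h1, integral_finsetSum_measure fun α _ => hint α]
  refine ⟨integrable_finsetSum_measure.mpr fun α _ => hint α, ?_⟩
  refine Finset.sum_congr rfl fun α _ => ?_
  have hDm : AEMeasurable (D α) (volume.restrict (chartDom n α)) :=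
    (hDc α).aemeasurable (hmeas α)
  have hsm : AEMeasurable (extChartAt (𝓡 n) α).symm
      ((volume.restrict (chartDom n α)).withDensity fun y => ENNReal.ofReal (D α y)) :=
    ((continuousOn_extChartAt_symm α).aemeasurable (hmeas α)).mono_ac
      (withDensity_absolutelyContinuous _ _)
  rw [hμ]
  simp only
  rw [integral_map hsm hfm.aestronglyMeasurable,
    integral_withDensity_eq_integral_toReal_smul₀ hDm.ennreal_ofReal
      (Eventually.of_forall fun _ => ENNReal.ofReal_lt_top)]
  rw [← integral_indicator (hmeas α)]
  refine integral_congr_ae (Eventually.of_forall fun y => ?_)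
  by_cases hy : y ∈ chartDom n α
  · have hD0 : 0 ≤ D α y := mul_nonneg ((chartPartition n M).nonneg α _) (Real.sqrt_nonneg _)
    rw [indicator_of_mem hy, ENNReal.toReal_ofReal hD0, smul_eq_mul]
    simp only [cutoff, localize_of_mem hy, hD]
    ring
  · simp only [indicator_of_notMem hy, cutoff, localize, zero_mul]

end Volume

/-! ### Independence of the chart -/

section ChangeOfVariables

open Matrix Filter Topology

variable {n : ℕ} {M : Type*} [TopologicalSpace M] [ChartedSpace (EuclideanSpace ℝ (Fin n)) M]
  [IsManifold (𝓡 n) ∞ M] {α β : M}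

lemma image_transition : transition n α β '' overlap n α β = overlap n β α := by
  refine Subset.antisymm ?_ fun z hz => ?_
  · rintro _ ⟨y, hy, rfl⟩
    exact transition_mem_overlap hy
  · exact ⟨_, transition_mem_overlap hz, transition_transition hz⟩

lemma injOn_transition : InjOn (transition n α β) (overlap n α β) := fun y hy z hz h => by
  rw [← transition_transition hy, h, transition_transition hz]

/-- The determinant of the metric picks up the square of the Jacobian determinant, whose root is the
factor in the change of variables formula. -/
lemma sqrt_det_transition (g : Metric n M) {y : EuclideanSpace ℝ (Fin n)}
    (hy : y ∈ overlap n α β) : Real.sqrt (comp g.inner α y).det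
      = |(fderiv ℝ (transition n α β) y).det| *
        Real.sqrt (comp g.inner β (transition n α β y)).det := by
  set L := fderiv ℝ (transition n α β) y with hL
  set b := (EuclideanSpace.basisFun (Fin n) ℝ).toBasis with hb
  set N : Matrix (Fin n) (Fin n) ℝ := LinearMap.toMatrix b b L.toLinearMap with hN
  have h1 : comp g.inner α y = Nᵀ * comp g.inner β (transition n α β y) * N := by
    ext i j
    rw [comp_transition _ hy]
    simp only [mul_apply, transpose_apply, hN, LinearMap.toMatrix_apply, hb]
    simp [hL]
  have h2 : N.det = L.det := LinearMap.det_toMatrix b _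
  rw [h1, det_mul, det_mul, det_transpose, h2, mul_right_comm, ← sq,
    Real.sqrt_mul (sq_nonneg _), Real.sqrt_sq_eq_abs]

variable [T2Space M] [CompactSpace M]

/-- The integral of a function supported in two charts does not depend on the chart. -/
lemma integral_localize_eq (g : Metric n M) {f : M → ℝ}
    (hf : ∀ x, f x ≠ 0 → x ∈ (extChartAt (𝓡 n) α).source ∧ x ∈ (extChartAt (𝓡 n) β).source) :
    ∫ y, localize n β f y * Real.sqrt (comp g.inner β y).det
      = ∫ y, localize n α f y * Real.sqrt (comp g.inner α y).det := by
  -- Both integrands vanish off the overlap, and the transition map is a bijection between the two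
  -- overlaps.
  have h0 : ∀ (a b : M), (∀ x, f x ≠ 0 → x ∈ (extChartAt (𝓡 n) b).source) →
      ∀ y, y ∉ overlap n a b → localize n a f y * Real.sqrt (comp g.inner a y).det = 0 := by
    intro a b hf y hy
    by_cases hyU : y ∈ chartDom n a
    · rw [localize_of_mem hyU]
      by_contra h
      exact hy ⟨hyU, hf _ (left_ne_zero_of_mul h)⟩
    · rw [localize, indicator_of_notMem hyU, zero_mul]
  rw [← setIntegral_eq_integral_of_forall_compl_eq_zero (h0 β α fun x hx => (hf x hx).1),
    ← setIntegral_eq_integral_of_forall_compl_eq_zero (h0 α β fun x hx => (hf x hx).2),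
    ← image_transition (α := α) (β := β),
    integral_image_eq_integral_abs_det_fderiv_smul volume (isOpen_overlap α β).measurableSet
      (fun y hy => (((contDiffOn_transition α β).contDiffAt
        ((isOpen_overlap α β).mem_nhds hy)).differentiableAt
          (by norm_num)).hasFDerivAt.hasFDerivWithinAt) injOn_transition]
  refine setIntegral_congr_fun (isOpen_overlap α β).measurableSet fun y hy => ?_
  simp only [smul_eq_mul]
  rw [sqrt_det_transition g hy, localize_of_mem (mapsTo_transition α β hy), localize_of_mem hy.1,
    symm_transition hy]
  ring

variable [MeasurableSpace M] [BorelSpace M]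

/-- Each piece χ_β f is supported in both charts and can be moved to the chart at α, where the
pieces add up to f again. -/
lemma integral_vol_of_tsupport {g : Metric n M}
    (hw : ∀ α : M, ContinuousOn (fun y => Real.sqrt (comp g.inner α y).det) (chartDom n α))
    {f : M → ℝ} (hf : Continuous f) (hfα : tsupport f ⊆ (extChartAt (𝓡 n) α).source) :
    ∫ x, f x ∂(vol g) = ∫ y, localize n α f y * Real.sqrt (comp g.inner α y).det := by
  rw [(integrable_vol_and_integral_vol hw hf).2]
  set k : M → M → ℝ := fun β x => chartPartition n M β x * f x with hk
  have hkc : ∀ β, Continuous (k β) := fun β =>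
    (chartPartition n M β).contMDiff.continuous.mul hf
  have hkα : ∀ β, tsupport (k β) ⊆ (extChartAt (𝓡 n) α).source := fun β =>
    (tsupport_mul_subset_right).trans hfα
  have h1 : ∀ β ∈ activeCharts n M, ∫ y, cutoff n β y *
      (f ((extChartAt (𝓡 n) β).symm y) * Real.sqrt (comp g.inner β y).det)
      = ∫ y, localize n α (k β) y * Real.sqrt (comp g.inner α y).det := by
    intro β _
    rw [← integral_localize_eq (β := β)]
    · refine integral_congr_ae (Eventually.of_forall fun y => ?_)
      simp only [cutoff, localize, hk]
      by_cases hy : y ∈ chartDom n β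
      · simp only [indicator_of_mem hy]; ring
      · simp only [indicator_of_notMem hy]; ring
    · intro x hx
      exact ⟨hkα β (subset_tsupport _ hx), tsupport_chartPartition β
        (subset_tsupport _ (left_ne_zero_of_mul hx))⟩
  rw [Finset.sum_congr rfl h1, ← integral_finsetSum]
  · refine integral_congr_ae (Eventually.of_forall fun y => ?_)
    simp only [← Finset.sum_mul]
    congr 1
    simp only [localize, hk]
    by_cases hy : y ∈ chartDom n α
    · simp only [indicator_of_mem hy]
      rw [← Finset.sum_mul, sum_chartPartition, one_mul]
    · simp only [indicator_of_notMem hy]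
      simp
  · intro β _
    have hc : Continuous (localize n α (k β)) := by
      rw [continuous_iff_continuousAt]
      intro y
      by_cases hy : y ∈ extChartAt (𝓡 n) α '' tsupport (k β)
      · have hyU := image_tsupport_subset (hkα β) hy
        have h2 : ContinuousAt (fun y => k β ((extChartAt (𝓡 n) α).symm y)) y :=
          ((hkc β).comp_continuousOn (continuousOn_extChartAt_symm α)).continuousAt
            ((isOpen_chartDom α).mem_nhds hyU)
        refine h2.congr ?_
        filter_upwards [(isOpen_chartDom α).mem_nhds hyU] with z hz using (localize_of_mem hz).symm
      · refine (continuousAt_const (y := (0 : ℝ))).congr ?_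
        filter_upwards [(isCompact_image_tsupport (hkα β)).isClosed.isOpen_compl.mem_nhds hy]
          with z hz using (localize_eq_zero hz).symm
    exact integrable_mul_of_tsupport (isOpen_chartDom α) hc (hasCompactSupport_localize (hkα β))
      (tsupport_localize (hkα β)) (hw α)

end ChangeOfVariables

/-! ### The divergence theorem and differentiation of integrals -/

namespace IsFlow

open Matrix SmoothFn Filter Topology

variable {n : ℕ} {M : Type*} [TopologicalSpace M] [ChartedSpace (EuclideanSpace ℝ (Fin n)) M]
  [IsManifold (𝓡 n) ∞ M] {J : Set ℝ} {g : ℝ → Metric n M} {h : ℝ → TwoTensor n M}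
  (F : IsFlow g h J) (hJ : UniqueDiffOn ℝ J) (hJ' : J ⊆ closure (interior J))
  [T2Space M] [CompactSpace M]

/-- The partition functions in the differential ring of the chart at `β`. -/
noncomputable def _root_.IntrinsicMCF.partM (J : Set ℝ) (α β : M) :
    SmoothFn (J ×ˢ chartDom n β) :=
  SmoothFn.of (fun p => chartPartition n M α ((extChartAt (𝓡 n) β).symm p.2))
    ((contDiffOn_comp_symm (chartPartition n M α).contMDiff β).comp contDiffOn_snd
      fun _ hp => hp.2)

lemma _root_.IntrinsicMCF.ev_partM {α β : M} {t : ℝ} (ht : t ∈ J)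
    {y : EuclideanSpace ℝ (Fin n)} (hy : y ∈ chartDom n β) :
    (partM J α β).ev (t, y) = chartPartition n M α ((extChartAt (𝓡 n) β).symm y) :=
  ev_of _ (mk_mem_prod ht hy)

lemma _root_.IntrinsicMCF.compat_partM (α : M) : Compat (partM (n := n) J α) := by
  intro β γ
  refine ext_ev ?_
  rintro ⟨t, y⟩ ⟨ht, hy⟩
  rw [ev_restrictHom _ ht hy, ev_transitionHom _ ht hy, ev_partM ht hy.1,
    ev_partM ht (mapsTo_transition β γ hy), symm_transition hy]

lemma _root_.IntrinsicMCF.sum_partM (β : M) :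
    ∑ α ∈ activeCharts n M, partM (n := n) J α β = 1 := by
  refine ext_ev ?_
  rintro ⟨t, y⟩ ⟨ht, hy⟩
  have hp : (t, y) ∈ J ×ˢ chartDom n β := mk_mem_prod ht hy
  rw [← evalAt_eq hp, ← evalAt_eq hp, map_sum, map_one]
  simp only [evalAt_eq hp, ev_partM ht hy]
  exact sum_chartPartition _

include F in
lemma continuousOn_sqrt_det {t : ℝ} (ht : t ∈ J) (α : M) :
    ContinuousOn (fun y => Real.sqrt (comp (g t).inner α y).det) (chartDom n α) :=
  (continuousOn_ev_slice (F.wM α) ht).congr fun _ hy => (F.ev_wM α (mk_mem_prod ht hy)).symm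

variable [MeasurableSpace M] [BorelSpace M]

include F in
lemma integrable_vol {t : ℝ} (ht : t ∈ J) {f : M → ℝ} (hf : Continuous f) :
    Integrable f (vol (g t)) :=
  (integrable_vol_and_integral_vol (F.continuousOn_sqrt_det ht) hf).1

lemma integral_vol_eq {f : ℝ → M → ℝ} {u : ∀ α : M, SmoothFn (J ×ˢ chartDom n α)}
    (hf : Represents f u) {t : ℝ} (ht : t ∈ J) : ∫ x, f t x ∂(vol (g t))
      = ∑ α ∈ activeCharts n M, ∫ y, cutoff n α y * (u α * F.wM α).ev (t, y) := by
  rw [(integrable_vol_and_integral_vol (F.continuousOn_sqrt_det ht) (hf.continuous ht)).2]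
  refine Finset.sum_congr rfl fun α _ => integral_congr_ae (Eventually.of_forall fun y => ?_)
  by_cases hy : y ∈ chartDom n α
  · have hp : (t, y) ∈ J ×ˢ chartDom n α := mk_mem_prod ht hy
    simp only
    rw [← evalAt_eq hp, map_mul, evalAt_eq hp, evalAt_eq hp, hf t ht α y hy, F.ev_wM α hp]
  · simp only [cutoff, localize, indicator_of_notMem hy, zero_mul]

include hJ hJ' in
/-- The divergence of a gradient integrates to zero. -/
lemma sum_integral_grad_cutoff {v : ∀ α : M, SmoothFn (J ×ˢ chartDom n α)} (hv : Compat v)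
    {t : ℝ} (ht : t ∈ J) : ∑ α ∈ activeCharts n M, ∑ l, ∫ y, pd l (cutoff n α) y *
      (F.wM α * ∑ k, F.giM α l k * dM hJ α k (v α)).ev (t, y) = 0 := by
  -- The sum over l of the integrands is ⟨∇χ_α, ∇v⟩ dv in the chart at α, a global function
  -- supported where χ_α is. Summing over α gives ⟨∇1, ∇v⟩ = 0.
  set G : ∀ α β : M, SmoothFn (J ×ˢ chartDom n β) := fun α β =>
    gradInner (dM hJ β) (F.giM β) (partM J α β) (v β) with hG
  set Φ : M → ℝ → M → ℝ := fun α s x => (G α x).ev (s, extChartAt (𝓡 n) x x) with hΦ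
  have hrep : ∀ α, Represents (Φ α) (G α) := fun α =>
    (F.compat_gradInner hJ hJ' (compat_partM α) hv).represents fun _ _ _ => rfl
  have hsupp : ∀ α, tsupport (Φ α t) ⊆ tsupport (chartPartition n M α) := by
    intro α
    refine closure_minimal (fun x hx => ?_) (isClosed_tsupport _)
    by_contra hx'
    apply hx
    have hy := extChartAt_mem_chartDom (n := n) x
    have hp : (t, extChartAt (𝓡 n) x x) ∈ J ×ˢ chartDom n x := mk_mem_prod ht hy
    have hd : ∀ l, (dM hJ x l (partM J α x)).ev (t, extChartAt (𝓡 n) x x) = 0 := by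
      intro l
      rw [← pd_eq (isOpen_chartDom x) ht (fun z hz => (ev_partM ht hz).symm) hy, pd]
      have h1 : (fun z => chartPartition n M α ((extChartAt (𝓡 n) x).symm z))
          =ᶠ[𝓝 (extChartAt (𝓡 n) x x)] fun _ => 0 := by
        have h2 : ∀ᶠ x' in 𝓝 ((extChartAt (𝓡 n) x).symm (extChartAt (𝓡 n) x x)),
            chartPartition n M α x' = 0 := by
          rw [extChartAt_to_inv]
          filter_upwards [(isClosed_tsupport _).isOpen_compl.mem_nhds hx'] with z hz using
            image_eq_zero_of_notMem_tsupport hz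
        exact (continuousAt_extChartAt_symm x).eventually h2
      rw [h1.fderiv_eq]
      simp
    simp only [hΦ, hG, gradInner, ← evalAt_eq hp, map_sum, map_mul]
    simp only [evalAt_eq hp, hd, zero_mul, mul_zero, Finset.sum_const_zero]
  have h1 : ∀ α ∈ activeCharts n M, ∑ l, ∫ y, pd l (cutoff n α) y *
      (F.wM α * ∑ k, F.giM α l k * dM hJ α k (v α)).ev (t, y) = ∫ x, Φ α t x ∂(vol (g t)) := by
    intro α _
    have hχ := contDiff_cutoff (n := n) α
    have hχU := tsupport_localize (tsupport_chartPartition (n := n) α)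
    have hχc := hasCompactSupport_localize (tsupport_chartPartition (n := n) α)
    have hsupp' : ∀ l, tsupport (pd l (cutoff n α)) ⊆ tsupport (cutoff n α) := fun l =>
      tsupport_fderiv_apply_subset ℝ (EuclideanSpace.single l 1)
    rw [integral_vol_of_tsupport (α := α) (F.continuousOn_sqrt_det ht) ((hrep α).continuous ht)
      ((hsupp α).trans (tsupport_chartPartition α)), ← integral_finsetSum]
    · refine integral_congr_ae (Eventually.of_forall fun y => ?_)
      simp only
      by_cases hy : y ∈ chartDom n α
      · have hp : (t, y) ∈ J ×ˢ chartDom n α := mk_mem_prod ht hy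
        have hd : ∀ l, pd l (cutoff n α) y = (dM hJ α l (partM J α α)).ev (t, y) := fun l =>
          pd_eq (isOpen_chartDom α) ht (fun z hz => by
            rw [ev_partM ht hz, cutoff, localize_of_mem hz]) hy l
        rw [localize_of_mem hy, hrep α t ht α y hy, ← F.ev_wM α hp]
        simp only [hd, hG, gradInner, ← evalAt_eq hp, map_sum, map_mul, Finset.mul_sum,
          Finset.sum_mul]
        exact Finset.sum_congr rfl fun _ _ => Finset.sum_congr rfl fun _ _ => by ring
      · have hy' : y ∉ tsupport (cutoff n α) := fun h => hy (hχU h)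
        rw [localize, indicator_of_notMem hy, zero_mul]
        refine Finset.sum_eq_zero fun l _ => ?_
        rw [image_eq_zero_of_notMem_tsupport fun h => hy' (hsupp' l h), zero_mul]
    · intro l _
      have hχ' : Continuous (pd l (cutoff n α)) :=
        (hχ.continuous_fderiv (by norm_num)).clm_apply continuous_const
      exact integrable_mul_of_tsupport (isOpen_chartDom α) hχ'
        (hχc.mono' ((subset_tsupport _).trans (hsupp' l))) ((hsupp' l).trans hχU)
        (continuousOn_ev_slice _ ht)
  rw [Finset.sum_congr rfl h1, ← integral_finsetSum _ fun α _ =>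
    F.integrable_vol ht ((hrep α).continuous ht)]
  refine integral_eq_zero_of_ae (Eventually.of_forall fun x => ?_)
  have hp : (t, extChartAt (𝓡 n) x x) ∈ J ×ˢ chartDom n x :=
    mk_mem_prod ht (extChartAt_mem_chartDom (n := n) x)
  have h2 : ∑ α ∈ activeCharts n M, G α x = 0 := by
    have h3 : ∑ α ∈ activeCharts n M, G α x
        = gradInner (dM hJ x) (F.giM x) (∑ α ∈ activeCharts n M, partM J α x) (v x) := by
      simp only [hG, gradInner, map_sum, Finset.sum_mul, Finset.mul_sum]
      rw [Finset.sum_comm]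
      exact Finset.sum_congr rfl fun _ _ => Finset.sum_comm
    rw [h3, sum_partM]
    simp [gradInner]
  simp only [hΦ, ← evalAt_eq hp, ← map_sum, h2, map_zero, Pi.zero_apply]

/-- Evolution of an integral whose density satisfies a divergence-form equation. -/
theorem hasDerivWithinAt_integral_vol (hJc : J.OrdConnected) (hJ0 : IsLeast J 0)
    {f e : ℝ → M → ℝ} {u q v : ∀ α : M, SmoothFn (J ×ˢ chartDom n α)}
    (hJ' : J ⊆ closure (interior J))
    (hf : Represents f u) (he : Represents e q) (hv : Compat v)
    (hevol : ∀ α, tM hJ α (u α * F.wM α)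
      = ∑ l, dM hJ α l (F.wM α * ∑ k, F.giM α l k * dM hJ α k (v α)) - F.wM α * q α)
    {t : ℝ} (ht : t ∈ J) :
    HasDerivWithinAt (fun s => ∫ x, f s x ∂(vol (g s))) (-∫ x, e t x ∂(vol (g t))) J t := by
  have h1 : HasDerivWithinAt (fun s => ∑ α ∈ activeCharts n M,
      ∫ y, cutoff n α y * (u α * F.wM α).ev (s, y))
      (∑ α ∈ activeCharts n M, ∫ y, cutoff n α y * (tM hJ α (u α * F.wM α)).ev (t, y)) J t :=
    HasDerivWithinAt.fun_sum fun α _ =>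
      hasDerivWithinAt_integral hJc hJ0 (isOpen_chartDom α) (contDiff_cutoff α).continuous
        (hasCompactSupport_localize (tsupport_chartPartition α))
        (tsupport_localize (tsupport_chartPartition α)) _ ht
  -- Integration by parts in each chart moves the divergence onto the cutoff; the resulting terms
  -- cancel only after summing over the charts.
  have h2 : ∑ α ∈ activeCharts n M, ∫ y, cutoff n α y * (tM hJ α (u α * F.wM α)).ev (t, y)
      = -∫ x, e t x ∂(vol (g t)) := by
    have h3 : ∀ α ∈ activeCharts n M, ∫ y, cutoff n α y * (tM hJ α (u α * F.wM α)).ev (t, y)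
        = -(∑ l, ∫ y, pd l (cutoff n α) y *
            (F.wM α * ∑ k, F.giM α l k * dM hJ α k (v α)).ev (t, y))
          - ∫ y, cutoff n α y * (q α * F.wM α).ev (t, y) := by
      intro α _
      have hint : ∀ f : SmoothFn (J ×ˢ chartDom n α),
          Integrable fun y => cutoff n α y * f.ev (t, y) := fun f =>
        integrable_mul_of_tsupport (isOpen_chartDom α) (contDiff_cutoff α).continuous
          (hasCompactSupport_localize (tsupport_chartPartition α))
          (tsupport_localize (tsupport_chartPartition α)) (continuousOn_ev_slice f ht)
      rw [← Finset.sum_neg_distrib]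
      simp only [← integral_mul_dd (hS := uniqueDiffOn_prod hJ (isOpen_chartDom α))
        (isOpen_chartDom α) (contDiff_cutoff α)
        (hasCompactSupport_localize (tsupport_chartPartition α))
        (tsupport_localize (tsupport_chartPartition α)) _ ht]
      rw [← integral_finsetSum _ fun l _ => hint _, ← integral_sub
        (integrable_finsetSum _ fun l _ => hint _) (hint _)]
      refine integral_congr_ae (Eventually.of_forall fun y => ?_)
      by_cases hy : y ∈ chartDom n α
      · have hp : (t, y) ∈ J ×ˢ chartDom n α := mk_mem_prod ht hy
        simp only
        rw [hevol, ← Finset.mul_sum, ← mul_sub]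
        congr 1
        rw [mul_comm (q α)]
        simp only [← evalAt_eq hp, map_sub, map_sum]
      · simp only [cutoff, localize, indicator_of_notMem hy, zero_mul, Finset.sum_const_zero,
          sub_zero]
    rw [Finset.sum_congr rfl h3, Finset.sum_sub_distrib, Finset.sum_neg_distrib,
      F.sum_integral_grad_cutoff hJ hJ' hv ht, F.integral_vol_eq he ht]
    simp
  rw [← h2]
  exact h1.congr (fun s hs => F.integral_vol_eq hf hs) (F.integral_vol_eq hf ht)

end IsFlow

/-! ### Monotonicity formulas -/

lemma natCast_mul_one_div_smul {A : Type*} [CommRing A] [Algebra ℝ A] {n : ℕ} (hn : 0 < n) (x : A) :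
    (n : A) * ((1 / n : ℝ) • x) = x := by
  have hn' : (n : ℝ) ≠ 0 := by exact_mod_cast hn.ne'
  rw [mul_smul_comm, ← nsmul_eq_mul, ← Nat.cast_smul_eq_nsmul ℝ, smul_smul,
    one_div_mul_cancel hn', one_smul]

lemma smul_eq_natCast_mul {A : Type*} [CommRing A] [Algebra ℝ A] (n : ℕ) (x : A) :
    (n : ℝ) • x = n * x := by
  rw [Nat.cast_smul_eq_nsmul, nsmul_eq_mul]

namespace IsFlow

open Matrix SmoothFn

variable {n : ℕ} {M : Type*} [TopologicalSpace M] [ChartedSpace (EuclideanSpace ℝ (Fin n)) M]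
  [IsManifold (𝓡 n) ∞ M] {J : Set ℝ} {g : ℝ → Metric n M} {h : ℝ → TwoTensor n M}
  (F : IsFlow g h J) [T2Space M] [CompactSpace M] [MeasurableSpace M] [BorelSpace M]

include F

theorem hasDerivWithinAt_integral_meanCurv_pow (hn0 : 0 < n) (hJc : J.OrdConnected)
    (hJ0 : IsLeast J 0) (hJn : J.Nontrivial) (hinit : IsSpaceLike (g 0) (h 0)) {t : ℝ}
    (ht : t ∈ J) :
    HasDerivWithinAt (fun s => ∫ x, meanCurv (g s) (h s) x ^ n ∂(vol (g s)))
      (-(n : ℝ) * ((n : ℝ) - 1) *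
          (∫ x, gradHSq (g t) (h t) x * meanCurv (g t) (h t) x ^ (n - 2) ∂(vol (g t)))
        - (n : ℝ) *
          (∫ x, meanCurv (g t) (h t) x ^ n * tracelessSq (g t) (h t) x ∂(vol (g t)))) J t := by
  obtain ⟨hJ', hJ⟩ := subset_closure_interior_of_ordConnected hJc hJn
  have r1 := (F.represents_gradHSq hJ hJ').mul ((F.represents_meanCurv hJ hJ').pow (n - 2))
  have r2 := ((F.represents_meanCurv hJ hJ').pow n).mul (F.represents_tracelessSq hJ hJ' hn0.ne')
  have he := (r1.smul ((n : ℝ) * ((n : ℝ) - 1))).add (r2.smul (n : ℝ))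
  have key := F.hasDerivWithinAt_integral_vol hJ hJc hJ0 hJ'
    ((F.represents_meanCurv hJ hJ').pow n) he ((F.compat_trace hJ hJ').pow n) (fun α => ?_) ht
  · convert key using 1
    rw [integral_add ((F.integrable_vol ht (r1.continuous ht)).const_mul _)
      ((F.integrable_vol ht (r2.continuous ht)).const_mul _), integral_const_mul,
      integral_const_mul]
    ring
  · obtain ⟨w', hw'⟩ := F.exists_wM_inv α
    rw [evolution_meanCurv_pow_vol (F.leviCivita_ΓM hJ α) (F.giM_mul α) (F.hM_symm α)
      (F.time_deriv_gM hJ α) (F.time_deriv_hM hJ α)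
      (F.curv_bundleConn_eq_zero hJ hJc hJ' hJ0 hinit α) (F.wM_mul_wM α) hw' hn0]
    have hc : (n : ℝ) * ((n : ℝ) - 1) = ((n * (n - 1) : ℕ) : ℝ) := by
      rw [Nat.cast_mul, Nat.cast_pred hn0]
    rw [hc, smul_eq_natCast_mul, smul_eq_natCast_mul, Nat.cast_mul]
    -- Here n|A|² - H² is recognised as n(|A|² - H²/n).
    linear_combination -F.wM α * F.meanM α ^ n * natCast_mul_one_div_smul hn0 (F.meanM α ^ 2)

/-- The norm |A| need not be smooth at its zeros. Since n = 2m, its n-th power is the m-th power of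
the smooth function |A|², and the computation is polynomial in |A|². -/
theorem hasDerivWithinAt_integral_normA_pow {m : ℕ} (hnm : n = 2 * m) (hm : 0 < m)
    (hJc : J.OrdConnected) (hJ0 : IsLeast J 0) (hJn : J.Nontrivial)
    (hinit : IsSpaceLike (g 0) (h 0)) {t : ℝ} (ht : t ∈ J) :
    HasDerivWithinAt (fun s => ∫ x, normA (g s) (h s) x ^ n ∂(vol (g s)))
      (-((n : ℝ) / 2 - 1) * ((n : ℝ) / 2) *
          (∫ x, normA (g t) (h t) x ^ ((n : ℤ) - 4) * gradNormASq (g t) (h t) x ∂(vol (g t)))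
        - (n : ℝ) *
          (∫ x, normA (g t) (h t) x ^ (n - 2) * gradASq (g t) (h t) x ∂(vol (g t)))
        - (n : ℝ) *
          (∫ x, normA (g t) (h t) x ^ n * tracelessSq (g t) (h t) x ∂(vol (g t)))) J t := by
  obtain ⟨hJ', hJ⟩ := subset_closure_interior_of_ordConnected hJc hJn
  have hn0 : 0 < n := by omega
  have hA := F.represents_normA_sq hJ hJ'
  have r1 := (hA.pow (m - 2)).mul (F.represents_gradNormASq hJ hJ')
  have r2 := (hA.pow (m - 1)).mul (F.represents_gradASq hJ hJ')
  have r3 := (hA.pow m).mul (F.represents_tracelessSq hJ hJ' hn0.ne')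
  have he := ((r1.smul ((m : ℝ) * ((m : ℝ) - 1))).add (r2.smul (n : ℝ))).add (r3.smul (n : ℝ))
  have key := F.hasDerivWithinAt_integral_vol hJ hJc hJ0 hJ' (hA.pow m) he
    ((F.compat_normSq hJ hJ').pow m) (fun α => ?_) ht
  · have p1 : ∀ s x, normA (g s) (h s) x ^ n = (normA (g s) (h s) x ^ 2) ^ m := fun s x => by
      rw [← pow_mul]
      exact congrArg (normA (g s) (h s) x ^ ·) hnm
    have p2 : ∀ x, normA (g t) (h t) x ^ (n - 2) = (normA (g t) (h t) x ^ 2) ^ (m - 1) :=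
      fun x => by rw [← pow_mul]; congr 1; omega
    -- For n = 2 the exponent n - 4 is negative, but the coefficient m(m - 1) is zero, so the value
    -- of the integral is irrelevant. For m ≥ 2 the exponent is the natural number 2(m - 2).
    have p3 : -((n : ℝ) / 2 - 1) * ((n : ℝ) / 2) *
          (∫ x, normA (g t) (h t) x ^ ((n : ℤ) - 4) * gradNormASq (g t) (h t) x ∂(vol (g t)))
        = -((m : ℝ) * ((m : ℝ) - 1)) * ∫ x, (normA (g t) (h t) x ^ 2) ^ (m - 2)
            * gradNormASq (g t) (h t) x ∂(vol (g t)) := by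
      have c1 : (n : ℝ) / 2 = m := by rw [hnm]; push_cast; ring
      rw [c1]
      rcases Nat.lt_or_ge m 2 with h2 | h2
      · obtain rfl : m = 1 := by omega
        simp
      · have e : ((n : ℤ) - 4) = ((2 * (m - 2) : ℕ) : ℤ) := by omega
        simp only [e, zpow_natCast, pow_mul]
        ring
    rw [p3]
    simp only [p1, p2]
    convert key using 1
    have i12 : Integrable (fun x => (m : ℝ) * ((m : ℝ) - 1) * ((normA (g t) (h t) x ^ 2) ^ (m - 2)
          * gradNormASq (g t) (h t) x) + (n : ℝ) * ((normA (g t) (h t) x ^ 2) ^ (m - 1)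
          * gradASq (g t) (h t) x)) (vol (g t)) :=
      ((F.integrable_vol ht (r1.continuous ht)).const_mul _).add
        ((F.integrable_vol ht (r2.continuous ht)).const_mul _)
    rw [integral_add i12 ((F.integrable_vol ht (r3.continuous ht)).const_mul _),
      integral_add ((F.integrable_vol ht (r1.continuous ht)).const_mul _)
        ((F.integrable_vol ht (r2.continuous ht)).const_mul _), integral_const_mul,
      integral_const_mul, integral_const_mul]
    ring
  · obtain ⟨w', hw'⟩ := F.exists_wM_inv α
    rw [evolution_normSq_pow_vol (F.leviCivita_ΓM hJ α) (F.giM_mul α) (F.hM_symm α)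
      (F.time_deriv_gM hJ α) (F.time_deriv_hM hJ α)
      (F.curv_bundleConn_eq_zero hJ hJc hJ' hJ0 hinit α) (F.wM_mul_wM α) hw' hm]
    have hc : (m : ℝ) * ((m : ℝ) - 1) = ((m * (m - 1) : ℕ) : ℝ) := by
      rw [Nat.cast_mul, Nat.cast_pred hm]
    rw [hc, smul_eq_natCast_mul, smul_eq_natCast_mul, smul_eq_natCast_mul, Nat.cast_mul]
    have hnA : (n : SmoothFn (J ×ˢ chartDom n α)) = 2 * m := by
      have := congrArg (Nat.cast : ℕ → SmoothFn (J ×ˢ chartDom n α)) hnm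
      rwa [Nat.cast_mul, Nat.cast_ofNat] at this
    linear_combination -F.wM α * F.normM α ^ m * natCast_mul_one_div_smul hn0 (F.meanM α ^ 2)
      + F.wM α * (F.normM α ^ m * F.normM α
        + F.normM α ^ (m - 1) * nablaSq (dM hJ α) (F.ΓM hJ α) (F.giM α) (F.hM α)) * hnA

end IsFlow

lemma antitoneOn_of_hasDerivWithinAt {J : Set ℝ} (hJ : J.OrdConnected) {f f' : ℝ → ℝ}
    (hf : ∀ t ∈ J, HasDerivWithinAt f (f' t) J t) (hf' : ∀ t ∈ J, f' t ≤ 0) : AntitoneOn f J :=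
  antitoneOn_of_hasDerivWithinAt_nonpos hJ.convex (fun t ht => (hf t ht).continuousWithinAt)
    (fun t ht => (hf t (interior_subset ht)).mono interior_subset)
    fun t ht => hf' t (interior_subset ht)

end IntrinsicMCF

theorem proposition2p3 {n : ℕ} (hn : Even n) (hn0 : 0 < n)
    {M : Type*} [TopologicalSpace M] [T2Space M] [CompactSpace M]
    [ChartedSpace (EuclideanSpace ℝ (Fin n)) M] [IsManifold (𝓡 n) ∞ M]
    [MeasurableSpace M] [BorelSpace M]
    (J : Set ℝ) (hJ : J.OrdConnected) (hJ0 : IsLeast J 0) (hJn : J.Nontrivial)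
    (g : ℝ → IntrinsicMCF.Metric n M) (h : ℝ → IntrinsicMCF.TwoTensor n M)
    (hflow : IntrinsicMCF.IsFlow g h J)
    (hinit : IntrinsicMCF.IsSpaceLike (g 0) (h 0)) :
    (∀ t ∈ J,
      HasDerivWithinAt
        (fun s => ∫ x, IntrinsicMCF.meanCurv (g s) (h s) x ^ n ∂(IntrinsicMCF.vol (g s)))
        (-(n : ℝ) * ((n : ℝ) - 1) *
            (∫ x, IntrinsicMCF.gradHSq (g t) (h t) x * IntrinsicMCF.meanCurv (g t) (h t) x ^ (n - 2)
              ∂(IntrinsicMCF.vol (g t)))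
          - (n : ℝ) *
            (∫ x, IntrinsicMCF.meanCurv (g t) (h t) x ^ n * IntrinsicMCF.tracelessSq (g t) (h t) x
              ∂(IntrinsicMCF.vol (g t)))) J t ∧
      -(n : ℝ) * ((n : ℝ) - 1) *
            (∫ x, IntrinsicMCF.gradHSq (g t) (h t) x * IntrinsicMCF.meanCurv (g t) (h t) x ^ (n - 2)
              ∂(IntrinsicMCF.vol (g t)))
          - (n : ℝ) *
            (∫ x, IntrinsicMCF.meanCurv (g t) (h t) x ^ n * IntrinsicMCF.tracelessSq (g t) (h t) x
              ∂(IntrinsicMCF.vol (g t))) ≤ 0) ∧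
    (∀ t ∈ J,
      HasDerivWithinAt
        (fun s => ∫ x, IntrinsicMCF.normA (g s) (h s) x ^ n ∂(IntrinsicMCF.vol (g s)))
        (-((n : ℝ) / 2 - 1) * ((n : ℝ) / 2) *
            (∫ x, IntrinsicMCF.normA (g t) (h t) x ^ ((n : ℤ) - 4)
                * IntrinsicMCF.gradNormASq (g t) (h t) x ∂(IntrinsicMCF.vol (g t)))
          - (n : ℝ) *
            (∫ x, IntrinsicMCF.normA (g t) (h t) x ^ (n - 2) * IntrinsicMCF.gradASq (g t) (h t) x
              ∂(IntrinsicMCF.vol (g t)))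
          - (n : ℝ) *
            (∫ x, IntrinsicMCF.normA (g t) (h t) x ^ n * IntrinsicMCF.tracelessSq (g t) (h t) x
              ∂(IntrinsicMCF.vol (g t)))) J t ∧
      -((n : ℝ) / 2 - 1) * ((n : ℝ) / 2) *
            (∫ x, IntrinsicMCF.normA (g t) (h t) x ^ ((n : ℤ) - 4)
                * IntrinsicMCF.gradNormASq (g t) (h t) x ∂(IntrinsicMCF.vol (g t)))
          - (n : ℝ) *
            (∫ x, IntrinsicMCF.normA (g t) (h t) x ^ (n - 2) * IntrinsicMCF.gradASq (g t) (h t) x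
              ∂(IntrinsicMCF.vol (g t)))
          - (n : ℝ) *
            (∫ x, IntrinsicMCF.normA (g t) (h t) x ^ n * IntrinsicMCF.tracelessSq (g t) (h t) x
              ∂(IntrinsicMCF.vol (g t))) ≤ 0) ∧
    AntitoneOn
      (fun s => ∫ x, IntrinsicMCF.meanCurv (g s) (h s) x ^ n ∂(IntrinsicMCF.vol (g s))) J ∧
    AntitoneOn
      (fun s => ∫ x, IntrinsicMCF.normA (g s) (h s) x ^ n ∂(IntrinsicMCF.vol (g s))) J := by
  obtain ⟨m, hm⟩ := hn
  have hnm : n = 2 * m := by omega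
  have hm0 : 0 < m := by omega
  have hn2 : (2 : ℝ) ≤ n := by exact_mod_cast (by omega : 2 ≤ n)
  -- H may change sign, so evenness of the exponents n and n - 2 is what makes the integrands
  -- nonnegative.
  have hev : Even (n - 2) := ⟨m - 1, by omega⟩
  have hH : ∀ t ∈ J, _ := fun t ht =>
    hflow.hasDerivWithinAt_integral_meanCurv_pow hn0 hJ hJ0 hJn hinit ht
  have hA : ∀ t ∈ J, _ := fun t ht =>
    hflow.hasDerivWithinAt_integral_normA_pow hnm hm0 hJ hJ0 hJn hinit ht
  have hH' : ∀ t ∈ J, -(n : ℝ) * ((n : ℝ) - 1) *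
        (∫ x, IntrinsicMCF.gradHSq (g t) (h t) x * IntrinsicMCF.meanCurv (g t) (h t) x ^ (n - 2)
          ∂(IntrinsicMCF.vol (g t)))
      - (n : ℝ) *
        (∫ x, IntrinsicMCF.meanCurv (g t) (h t) x ^ n * IntrinsicMCF.tracelessSq (g t) (h t) x
          ∂(IntrinsicMCF.vol (g t))) ≤ 0 := by
    intro t _
    have i1 : 0 ≤ ∫ x, IntrinsicMCF.gradHSq (g t) (h t) x
        * IntrinsicMCF.meanCurv (g t) (h t) x ^ (n - 2) ∂(IntrinsicMCF.vol (g t)) :=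
      integral_nonneg fun x => mul_nonneg (IntrinsicMCF.gradHSq_nonneg _ _ _) (hev.pow_nonneg _)
    have i2 : 0 ≤ ∫ x, IntrinsicMCF.meanCurv (g t) (h t) x ^ n
        * IntrinsicMCF.tracelessSq (g t) (h t) x ∂(IntrinsicMCF.vol (g t)) :=
      integral_nonneg fun x =>
        mul_nonneg (Even.pow_nonneg ⟨m, hm⟩ _) (IntrinsicMCF.tracelessSq_nonneg _ _ _)
    have j1 := mul_nonneg (mul_nonneg (by linarith : (0 : ℝ) ≤ n)
      (by linarith : (0 : ℝ) ≤ (n : ℝ) - 1)) i1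
    have j2 := mul_nonneg (by linarith : (0 : ℝ) ≤ n) i2
    linarith
  have hA' : ∀ t ∈ J, -((n : ℝ) / 2 - 1) * ((n : ℝ) / 2) *
        (∫ x, IntrinsicMCF.normA (g t) (h t) x ^ ((n : ℤ) - 4)
            * IntrinsicMCF.gradNormASq (g t) (h t) x ∂(IntrinsicMCF.vol (g t)))
      - (n : ℝ) *
        (∫ x, IntrinsicMCF.normA (g t) (h t) x ^ (n - 2) * IntrinsicMCF.gradASq (g t) (h t) x
          ∂(IntrinsicMCF.vol (g t)))
      - (n : ℝ) *
        (∫ x, IntrinsicMCF.normA (g t) (h t) x ^ n * IntrinsicMCF.tracelessSq (g t) (h t) x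
          ∂(IntrinsicMCF.vol (g t))) ≤ 0 := by
    intro t _
    have i1 : 0 ≤ ∫ x, IntrinsicMCF.normA (g t) (h t) x ^ ((n : ℤ) - 4)
        * IntrinsicMCF.gradNormASq (g t) (h t) x ∂(IntrinsicMCF.vol (g t)) :=
      integral_nonneg fun x => mul_nonneg (zpow_nonneg (IntrinsicMCF.normA_nonneg _ _ _) _)
        (IntrinsicMCF.gradNormASq_nonneg _ _ _)
    have i2 : 0 ≤ ∫ x, IntrinsicMCF.normA (g t) (h t) x ^ (n - 2)
        * IntrinsicMCF.gradASq (g t) (h t) x ∂(IntrinsicMCF.vol (g t)) :=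
      integral_nonneg fun x => mul_nonneg (pow_nonneg (IntrinsicMCF.normA_nonneg _ _ _) _)
        (IntrinsicMCF.gradASq_nonneg _ _ _)
    have i3 : 0 ≤ ∫ x, IntrinsicMCF.normA (g t) (h t) x ^ n
        * IntrinsicMCF.tracelessSq (g t) (h t) x ∂(IntrinsicMCF.vol (g t)) :=
      integral_nonneg fun x => mul_nonneg (pow_nonneg (IntrinsicMCF.normA_nonneg _ _ _) _)
        (IntrinsicMCF.tracelessSq_nonneg _ _ _)
    have j1 := mul_nonneg (mul_nonneg (by linarith : (0 : ℝ) ≤ (n : ℝ) / 2 - 1)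
      (by linarith : (0 : ℝ) ≤ (n : ℝ) / 2)) i1
    have j2 := mul_nonneg (by linarith : (0 : ℝ) ≤ n) i2
    have j3 := mul_nonneg (by linarith : (0 : ℝ) ≤ n) i3
    linarith
  exact ⟨fun t ht => ⟨hH t ht, hH' t ht⟩, fun t ht => ⟨hA t ht, hA' t ht⟩,
    IntrinsicMCF.antitoneOn_of_hasDerivWithinAt hJ hH hH',
    IntrinsicMCF.antitoneOn_of_hasDerivWithinAt hJ hA hA'⟩
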